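/- Let $\mathcal U=\{1,\dots,n\}$ carry the uniform probability measure, and for $g\colon\mathcal U\to\mathbb R$ put $\langle f,g\rangle=\mathbb E_u f(u)g(u)$ and $\|g\|_p=(\mathbb E_u|g(u)|^p)^{1/p}$. A projector is a real symmetric matrix $\Pi$ with $\Pi^2=\Pi$, acting on functions on $\mathcal U$. A Boolean function $f\colon\mathcal U\to\{0,1\}$, $f\neq 0$, is $\mu$-sparse if $\Pr_u[f(u)=1]\le\mu$. For $c>0$ call $g$ *$(c,\mu)$-good* for $\Pi$ if $g\ne 0$, $g\in\operatorname{Im}\Pi$ and $$\|g\|_4^4\;\ge\;c\,\frac{\|g\|_2^4}{\mu\,(\operatorname{rank}\Pi)^{1/3}} .$$ **Relaxation.** For constants $\varepsilon,a,b>0$ and $\mu>0$, consider the following polynomial equations in the variables $f(u),t(u),y_u,y'_u$ $(u\in\mathcal U)$ and $z,z'$: $f(u)^2=f(u)$; $\ \mathbb E_u f(u)=\mu$; $\ \|\Pi f\|_2^2=(1-\varepsilon)\mu+z^2$; $\ \mathbb E_u(\Pi t)(u)^4=a\mu+z'^2$; $\ (\Pi f)(u)^2-b\,t(u)=y_u^2$;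 $\ (\Pi f)(u)^2+b\,t(u)=y_u'^2$. A level-$\ell$ pseudoexpectation is a linear functional $\tilde{\mathbb E}$ on polynomials of degree at most $\ell$ with $\tilde{\mathbb E}1=1$ and $\tilde{\mathbb E}P^2\ge0$ whenever $\deg P\le\ell/2$. It is a solution of the level-$\ell$ sum-of-squares relaxation $\mathrm{SOS}_\ell(\Pi,\mu)$ if each equation $P=0$ of the list satisfies $\deg P\le \ell/2$ and $\tilde{\mathbb E}P^2=0$. **Theorem.** There are absolute constants $\varepsilon,a,b,c,p_0>0$ and $\ell\in\mathbb N$ such that the following holds. 1. (Relaxation.) For all $n$, every projector $\Pi$ and every nonzero Boolean $f$ with $\|\Pi f\|_2^2\ge(1-\varepsilon)\|f\|_2^2$, some assignment to the variables extending $f$ satisfies the equations with $\mu=\Pr_u[f(u)=1]$; that is, evaluation at it is a solution of $\mathrm{SOS}_\ell(\Pi,\mu)$. 2. (Rounding.) For all $n$, every projector $\Pi$, every real $\mu>0$ and every solution $\tilde{\mathbb E}$ of $\mathrm{SOS}_\ell(\Pi,\mu)$, at least one of the following holds: * for some $u$, the function $\Pi\delta_u$ is $(c,\mu)$-good, where $\langle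 h,\delta_u\rangle=h(u)$ for all $h$; * for a standard Gaussian function $t$ (independent standard normal coordinates in an orthonormal basis for $\langle\cdot,\cdot\rangle$), $\Pi t$ is $(c,\mu)$-good with probability at least $p_0$; * for some $u_1,\dots,u_4\in\mathcal U$, the weight $W=\prod_{j=1}^4(\Pi f)(u_j)^2$ has $\tilde{\mathbb E}W>0$, and for a Gaussian function $t$ whose first two moments agree with those of $f$ under $P\mapsto\tilde{\mathbb E}[WP]/\tilde{\mathbb E}W$, $\Pi t$ is $(c,\mu)$-good with probability at least $p_0$. 3. (Polynomial time.) There is a randomized algorithm $A$ on a uniform real-number random access machine (a fixed program without real constants; unit-cost exact real $+,-,\times,/,\sqrt{\ }$, comparisons, and independent standard normal samples; integer registers with unit-cost addition, subtraction and comparison; no rounding of reals to integers) that on every $n\times n$ projector $\Pi$ stops within a number of steps bounded by a fixed polynomial in $n$, for all random choices, and such that, for every $\mu$, if some $\mu$-sparse nonzero Boolean $f$ satisfies $\|\Pi f\|_2^2\ge(1-\varepsilon)\|f\|_2^2$, then with probability at least $2/3$ the output $A(\Pi)$ is $(c,\mu)$-good for $\Pi$. The algorithm is not given $\mu$ or $f$.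 -/

import Mathlib

/-! ### A uniform real random access machine with a step count

Registers of two sorts: natural-number registers, used as counters and as array indices, and real
cells, organised in arrays. A program is a finite text without real constants; the same program
runs on inputs of all sizes. Exact real arithmetic (`+`, `-`, `*`, `/`, square root), comparisons
of reals, and the drawing of an independent standard normal number cost one step each. On natural
numbers there are only constants, addition, truncated subtraction and comparison, also at one
step each. There is no rounding operation from reals to natural numbers. -/

namespace RealRAM

/-- A real cell named in a program: the array `arr`, at the position given by the current values
of the natural-number registers listed in `idx`. -/
structure Cell where
  arr : ℕ
  idx : List ℕ

/-- Programs. In `loop x y p`, the body `p` is executed with register `x` set to `0, 1, …, N - 1`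
in turn, where `N` is the value of register `y` on entering the loop. -/
inductive Prog where
  | skip
  | natConst (x k : ℕ)
  | natAdd (x y z : ℕ)
  | natSub (x y z : ℕ)
  | cast (a : Cell) (x : ℕ)
  | copy (a b : Cell)
  | add (a b c : Cell)
  | sub (a b c : Cell)
  | mul (a b c : Cell)
  | div (a b c : Cell)
  | sqrt (a b : Cell)
  | gauss (a : Cell)
  | seq (p q : Prog)
  | ifNatLt (x y : ℕ) (p q : Prog)
  | ifRealLt (a b : Cell) (p q : Prog)
  | loop (x y : ℕ) (p : Prog)

/-- Machine states. `tape` is the supply of random numbers that have not been drawn yet, and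
`clock` counts the steps made so far. -/
structure State where
  nat : ℕ → ℕ
  real : ℕ → List ℕ → ℝ
  tape : ℕ → ℝ
  clock : ℕ

namespace State

def tick (s : State) : State := { s with clock := s.clock + 1 }

/-- The current value of a cell. -/
def get (s : State) (a : Cell) : ℝ := s.real a.arr (a.idx.map s.nat)

def setNat (s : State) (x v : ℕ) : State := { s with nat := Function.update s.nat x v }

/-- Write a value into a cell. -/
noncomputable def set (s : State) (a : Cell) (v : ℝ) : State :=
  { s with
    real := Function.update s.real a.arr
      (Function.update (s.real a.arr) (a.idx.map s.nat) v) }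

/-- Draw the next random number from the tape into a cell. -/
noncomputable def draw (s : State) (a : Cell) : State :=
  { s.set a (s.tape 0) with tape := fun i => s.tape (i + 1) }

end State

open Classical in
/-- Execution of a program. Every instruction, every test and every iteration of a loop advances
the clock. All programs terminate, since the loops are bounded. -/
noncomputable def run : Prog → State → State
  | .skip, s => s.tick
  | .natConst x k, s => (s.setNat x k).tick
  | .natAdd x y z, s => (s.setNat x (s.nat y + s.nat z)).tick
  | .natSub x y z, s => (s.setNat x (s.nat y - s.nat z)).tick
  | .cast a x, s => (s.set a (s.nat x : ℝ)).tick
  | .copy a b, s => (s.set a (s.get b)).tick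
  | .add a b c, s => (s.set a (s.get b + s.get c)).tick
  | .sub a b c, s => (s.set a (s.get b - s.get c)).tick
  | .mul a b c, s => (s.set a (s.get b * s.get c)).tick
  | .div a b c, s => (s.set a (s.get b / s.get c)).tick
  | .sqrt a b, s => (s.set a (Real.sqrt (s.get b))).tick
  | .gauss a, s => (s.draw a).tick
  | .seq p q, s => run q (run p s)
  | .ifNatLt x y p q, s => if s.nat x < s.nat y then run p s.tick else run q s.tick
  | .ifRealLt a b p q, s => if s.get a < s.get b then run p s.tick else run q s.tick
  | .loop x y p, s =>
      (List.range (s.nat y)).foldl (fun r i => run p (r.setNat x i).tick) s.tick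

/-- The initial state on input an `n × n` matrix: register `0` holds `n`, array `0` holds the
matrix, everything else is zero, and the tape holds `w`. -/
noncomputable def init {n : ℕ} (M : Matrix (Fin n) (Fin n) ℝ) (w : ℕ → ℝ) : State where
  nat := fun x => if x = 0 then n else 0
  real := fun a l =>
    match a, l with
    | 0, [i, j] => if h : i < n ∧ j < n then M ⟨i, h.1⟩ ⟨j, h.2⟩ else 0
    | _, _ => 0
  tape := w
  clock := 0

/-- The number of steps of a program on a matrix. -/
noncomputable def steps (p : Prog) {n : ℕ} (M : Matrix (Fin n) (Fin n) ℝ) (w : ℕ → ℝ) : ℕ :=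
  (run p (init M w)).clock

/-- The output of a program on an `n × n` matrix: the first `n` entries of array `1`. -/
noncomputable def output (p : Prog) {n : ℕ} (M : Matrix (Fin n) (Fin n) ℝ) (w : ℕ → ℝ) :
    Fin n → ℝ :=
  fun u => (run p (init M w)).real 1 [(u : ℕ)]

/-- The law of the random tape: independent standard normal numbers. -/
noncomputable def tapeLaw : MeasureTheory.Measure (ℕ → ℝ) :=
  MeasureTheory.Measure.infinitePi fun _ : ℕ => ProbabilityTheory.gaussianReal 0 1

/-- A program runs in polynomial time on a class of matrices if, on each matrix of the class and
for all random choices, its number of steps is at most a fixed polynomial in the size. -/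
def PolyTimeOn (p : Prog) (inputs : ∀ n : ℕ, Matrix (Fin n) (Fin n) ℝ → Prop) : Prop :=
  ∃ q : Polynomial ℕ, ∀ (n : ℕ) (M : Matrix (Fin n) (Fin n) ℝ), inputs n M →
    ∀ w : ℕ → ℝ, steps p M w ≤ q.eval n

end RealRAM

/-! ### Analytically sparse functions in the image of a projector -/

namespace ASVP

open MvPolynomial Matrix

/-- The average of a function over the universe `Fin n` with the uniform measure. -/
noncomputable def expect {n : ℕ} (h : Fin n → ℝ) : ℝ := (∑ u, h u) / n

/-- The expectation `p`-norm. -/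
noncomputable def pNorm {n : ℕ} (p : ℕ) (g : Fin n → ℝ) : ℝ :=
  (expect fun u => |g u| ^ p) ^ (1 / (p : ℝ))

/-- Orthogonal projectors. (For the uniform measure, self-adjoint means symmetric.) -/
def IsProjector (n : ℕ) (Q : Matrix (Fin n) (Fin n) ℝ) : Prop := Qᵀ = Q ∧ Q * Q = Q

def IsBoolean {n : ℕ} (f : Fin n → ℝ) : Prop := ∀ u, f u = 0 ∨ f u = 1

/-- A nonzero `0/1`-valued function that is at least `1 - ε` contained in the image of `Q`. Its
measure is `expect f`. -/
def IsNearlyIn {n : ℕ} (ε : ℝ) (Q : Matrix (Fin n) (Fin n) ℝ) (f : Fin n → ℝ) : Prop :=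
  IsBoolean f ∧ f ≠ 0 ∧ (1 - ε) * pNorm 2 f ^ 2 ≤ pNorm 2 (Q *ᵥ f) ^ 2

/-- The goal: a nonzero function in the image of `Q` whose fourth norm is large. -/
def IsGood {n : ℕ} (c μ : ℝ) (Q : Matrix (Fin n) (Fin n) ℝ) (g : Fin n → ℝ) : Prop :=
  g ≠ 0 ∧ (∃ h : Fin n → ℝ, g = Q *ᵥ h) ∧
    c * (pNorm 2 g ^ 4 / (μ * (Q.rank : ℝ) ^ (1 / 3 : ℝ))) ≤ pNorm 4 g ^ 4

/-! #### Pseudoexpectations -/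

/-- Level-`l` pseudoexpectations. Only the values on polynomials of degree at most `l` matter; a
linear functional on those polynomials always extends linearly to all polynomials. -/
def IsPseudoExpectation {σ : Type} (l : ℕ) (L : MvPolynomial σ ℝ →ₗ[ℝ] ℝ) : Prop :=
  L 1 = 1 ∧ ∀ p : MvPolynomial σ ℝ, 2 * p.totalDegree ≤ l → 0 ≤ L (p ^ 2)

/-- A level-`l` pseudoexpectation is consistent with the constraint `p ≡ 0`. -/
def IsConsistent {σ : Type} (l : ℕ) (L : MvPolynomial σ ℝ →ₗ[ℝ] ℝ) (p : MvPolynomial σ ℝ) :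
    Prop :=
  2 * p.totalDegree ≤ l ∧ L (p ^ 2) = 0

/-! #### The relaxation -/

/-- The variables: the values of `f`, the values of the truncation of the projection of `f`, and
auxiliary variables whose squares are the slacks of the inequality constraints. -/
inductive Var (n : ℕ) : Type where
  | val (u : Fin n)
  | trunc (u : Fin n)
  | slackPos (u : Fin n)
  | slackNeg (u : Fin n)
  | slackTwo
  | slackFour

/-- The polynomial giving the value at `u` of the projection of the function whose values are the
variables `x v`. -/
noncomputable def projPoly {n : ℕ} (Q : Matrix (Fin n) (Fin n) ℝ) (x : Fin n → Var n)
    (u : Fin n) : MvPolynomial (Var n) ℝ :=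
  ∑ v, C (Q u v) * X (x v)

/-- The average over the universe of a family of polynomials. -/
noncomputable def expectPoly {n : ℕ} (h : Fin n → MvPolynomial (Var n) ℝ) :
    MvPolynomial (Var n) ℝ :=
  C (1 / (n : ℝ)) * ∑ u, h u

/-- The constraints, where `f` stands for the function of the variables `val`, and `t` for that of
the variables `trunc`. -/
inductive Constraint {n : ℕ} (ε a b μ : ℝ) (Q : Matrix (Fin n) (Fin n) ℝ) :
    MvPolynomial (Var n) ℝ → Prop where
  /-- `f u ^ 2 = f u` -/
  | boolean (u : Fin n) : Constraint ε a b μ Q (X (.val u) ^ 2 - X (.val u))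
  /-- `f` has measure `μ` -/
  | measure : Constraint ε a b μ Q (expectPoly (fun u => X (.val u)) - C μ)
  /-- `‖Q f‖₂² ≥ (1 - ε) μ` -/
  | normTwo : Constraint ε a b μ Q
      (expectPoly (fun u => projPoly Q .val u ^ 2) - C ((1 - ε) * μ) - X .slackTwo ^ 2)
  /-- `‖Q t‖₄⁴ ≥ a μ` -/
  | normFour : Constraint ε a b μ Q
      (expectPoly (fun u => projPoly Q .trunc u ^ 4) - C (a * μ) - X .slackFour ^ 2)
  /-- `(Q f) u ^ 2 ≥ b * t u` -/
  | truncPos (u : Fin n) : Constraint ε a b μ Q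
      (projPoly Q .val u ^ 2 - C b * X (.trunc u) - X (.slackPos u) ^ 2)
  /-- `(Q f) u ^ 2 ≥ - b * t u` -/
  | truncNeg (u : Fin n) : Constraint ε a b μ Q
      (projPoly Q .val u ^ 2 + C b * X (.trunc u) - X (.slackNeg u) ^ 2)

/-- `L` is a solution of the level-`l` sum-of-squares relaxation. -/
def IsFeasible {n : ℕ} (l : ℕ) (ε a b μ : ℝ) (Q : Matrix (Fin n) (Fin n) ℝ)
    (L : MvPolynomial (Var n) ℝ →ₗ[ℝ] ℝ) : Prop :=
  IsPseudoExpectation l L ∧ ∀ p, Constraint ε a b μ Q p → IsConsistent l L p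

/-! #### The rounding -/

/-- The function `δ_u` with `⟨f, δ_u⟩ = f u` for the expectation inner product. -/
def delta {n : ℕ} (u : Fin n) : Fin n → ℝ := Pi.single u (n : ℝ)

/-- The standard Gaussian law on functions with the expectation inner product: in an orthonormal
basis, such as `√n` times the indicators of points, the coordinates are independent standard
normal. -/
noncomputable def stdGaussianFun (n : ℕ) : MeasureTheory.Measure (Fin n → ℝ) :=
  MeasureTheory.Measure.pi fun _ => ProbabilityTheory.gaussianReal 0 (n : NNReal)

/-- The weight `∏ⱼ (Q f)(ω j)²` of the reweighting at four points. -/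
noncomputable def weight {n : ℕ} (Q : Matrix (Fin n) (Fin n) ℝ) (ω : Fin 4 → Fin n) :
    MvPolynomial (Var n) ℝ :=
  ∏ j, projPoly Q .val (ω j) ^ 2

/-- Pseudoexpectation after reweighting by `w`. -/
noncomputable def reweighted {σ : Type} (L : MvPolynomial σ ℝ →ₗ[ℝ] ℝ) (w p : MvPolynomial σ ℝ) :
    ℝ :=
  L (w * p) / L w

/-- The Gaussian law whose first two moments are those of `f` under the reweighting of `L`
by `w`. -/
noncomputable def matchingGaussian {n : ℕ} (L : MvPolynomial (Var n) ℝ →ₗ[ℝ] ℝ)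
    (w : MvPolynomial (Var n) ℝ) : MeasureTheory.Measure (EuclideanSpace ℝ (Fin n)) :=
  ProbabilityTheory.multivariateGaussian
    (WithLp.toLp 2 fun u => reweighted L w (X (.val u)))
    (Matrix.of fun u v => reweighted L w (X (.val u) * X (.val v)) -
      reweighted L w (X (.val u)) * reweighted L w (X (.val v)))

/-- The rounding of `L` succeeds with probability at least `p₀` in one of its steps: a coordinate
projection, a projected standard Gaussian function, or, after a reweighting at four points, the
projection of a Gaussian function with matching moments. -/
def RoundingSucceeds {n : ℕ} (p₀ c μ : ℝ) (Q : Matrix (Fin n) (Fin n) ℝ)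
    (L : MvPolynomial (Var n) ℝ →ₗ[ℝ] ℝ) : Prop :=
  (∃ u : Fin n, IsGood c μ Q (Q *ᵥ delta u)) ∨
  p₀ ≤ (stdGaussianFun n).real {t | IsGood c μ Q (Q *ᵥ t)} ∨
  ∃ ω : Fin 4 → Fin n, 0 < L (weight Q ω) ∧
    p₀ ≤ (matchingGaussian L (weight Q ω)).real {t | IsGood c μ Q (Q *ᵥ t.ofLp)}

end ASVP

/-!
All inequalities are written with plain sums over the universe. A nonzero function `g` of the
image of `Q` is good as soon as `∑ g ^ 4 ≥ c * level * (∑ g ^ 2) ^ 2`, where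
`level = 1 / (n μ d ^ (1/3))` and `d` is the rank of `Q`. For a Gaussian function `t`, let `P u u`
be the second moment of `(Q t) u`. Then `Q t` is good with constant probability if `∑ (P u u) ^ 2`
is large compared with `(∑ P u u) ^ 2` (`gaussian_isGood`, by the inequality of Paley and Zygmund
and the comparison of the moments of Gaussian variables).

*Relaxation.* For a nearly contained Boolean `f`, let `t` be the restriction of `f` to the points
where `Q f ≥ 1 / 2`. Pairing `Q t` with `f` and using the Cauchy-Schwarz inequality twice gives a
lower bound for `∑ (Q t) ^ 4`, so that `f`, `t` and the square roots of the slacks are a solution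
(`isFeasible_planted`).

*Rounding.* The tensor `quad Q ω = ∑ u, ∏ j, Q u (ω j)` satisfies
`∑ ω, quad Q ω * ∏ j, t (ω j) = ∑ (Q t) ^ 4`. Since `t` is dominated by a multiple of `(Q f) ^ 2`,
the moments `W ω = E ∏ j, (Q f) (ω j) ^ 2` correlate with `|quad Q|`. Suppose that no step of the
rounding succeeds. Then the standard Gaussian function and the columns of `Q` are flat, which
bounds the norm of `quad Q` (`nrm_quad_le`), and the second moments after each reweighting at four
points are flat, which says that each row of the tensor of moments at five points has a small
Euclidean norm compared with its sum. Positive semidefiniteness of the slices of this tensor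
allows flatness to be passed from rows to marginals (`nrm_rowSum_le`), and after four such steps
the norm of the tensor `W` itself is small (`tupleNrm_four_marg_le`). By the Cauchy-Schwarz
inequality `W` correlates too little with `quad Q`, a contradiction
(`IsFeasible.roundingSucceeds`).

*Polynomial time.* The argument above uses of the pseudoexpectation only one matrix, indexed by
quintuples of points, which stands for the moments of degree ten of `Q f`: it is positive
semidefinite, fixed by `Q` in the last argument, invariant under three permutations of its entries
(`momentSymm`), and it has a large objective `∑ |quad Q| * diagonal`. Symmetry and objective are
needed only approximately. So the algorithm need not solve the relaxation: a first-order method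
that moves along the approximate top eigenvector of the gradient of the objective minus a
quadratic penalty (`driftStep`) finds such a matrix, without knowledge of `μ`, because the planted
matrix `φ φᵀ` with `φ = (Q f)^⊗5` is feasible (`DriftInvariant.step`). The top eigenvector is
replaced by a normalized high power (`trace_pow_succ_ge`). Then `Q`, the rank one matrix of one of
its columns, or one of the diagonal blocks of the matrix found is a positive semidefinite matrix
whose diagonal is far from flat (`exists_candidate`). Such a matrix is rounded to a single
function of the image without randomness: its Cholesky decomposition is a sum of rank one terms,
and the signs of the terms are chosen one by one so that a pessimistic estimator of the fourth
norm does not decrease (`signRound`, `lt_sum_signRound_pow_four`). The best candidate is the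
output, and it is good for every outcome of the random tape.

The program is written in a language of nested loops whose bounds are powers of the size of the
input (`RealRAM.Stmt`) and translated to the machine (`RealRAM.Stmt.reaches_compile`). The
translation does no arithmetic on natural-number registers, so that all of them stay bounded and
the running time is polynomial (`RealRAM.Prog.NatFree.exists_clock_le`), and it never divides by
zero.
-/

namespace ASVP

open Matrix

/-! ### Projectors and good functions -/

namespace IsProjector

variable {n : ℕ} {Q : Matrix (Fin n) (Fin n) ℝ}

theorem symm (hQ : IsProjector n Q) (u v : Fin n) : Q u v = Q v u :=
  congrFun (congrFun hQ.1 v) u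

theorem sum_mul (hQ : IsProjector n Q) (u w : Fin n) : ∑ v, Q u v * Q v w = Q u w := by
  simpa [Matrix.mul_apply] using congrFun (congrFun hQ.2 u) w

theorem sum_sq (hQ : IsProjector n Q) (u : Fin n) : ∑ v, Q u v ^ 2 = Q u u := by
  rw [← hQ.sum_mul u u]
  exact Finset.sum_congr rfl fun v _ => by rw [hQ.symm v u, sq]

theorem trace_eq_rank (hQ : IsProjector n Q) : ∑ u, Q u u = (Q.rank : ℝ) := by
  have h : IsIdempotentElem (Matrix.toLin' Q) := by
    rw [IsIdempotentElem, Module.End.mul_eq_comp, ← Matrix.toLin'_mul, hQ.2]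
  have h2 := LinearMap.IsProj.trace (LinearMap.IsIdempotentElem.isProj_range _ h)
  rw [Matrix.trace_toLin'_eq] at h2
  exact h2

theorem diag_nonneg (hQ : IsProjector n Q) (u : Fin n) : 0 ≤ Q u u :=
  hQ.sum_sq u ▸ Finset.sum_nonneg fun _ _ => sq_nonneg _

theorem apply_eq_zero_of_rank_eq_zero (hQ : IsProjector n Q) (h0 : Q.rank = 0) (u v : Fin n) :
    Q u v = 0 := by
  have h1 := hQ.trace_eq_rank
  rw [h0, Nat.cast_zero, Finset.sum_eq_zero_iff_of_nonneg fun u _ => hQ.diag_nonneg u] at h1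
  have h2 := hQ.sum_sq u
  rw [h1 u (Finset.mem_univ u), Finset.sum_eq_zero_iff_of_nonneg fun _ _ => sq_nonneg _] at h2
  exact pow_eq_zero_iff two_ne_zero |>.1 (h2 v (Finset.mem_univ v))

theorem mulVec_mulVec (hQ : IsProjector n Q) (f : Fin n → ℝ) : Q *ᵥ (Q *ᵥ f) = Q *ᵥ f := by
  rw [Matrix.mulVec_mulVec, hQ.2]

theorem posSemidef (hQ : IsProjector n Q) : Q.PosSemidef := by
  have := Matrix.posSemidef_conjTranspose_mul_self Q
  rwa [Matrix.conjTranspose_eq_transpose_of_trivial, hQ.1, hQ.2] at this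

theorem sum_mul_mulVec (hQ : IsProjector n Q) (f g : Fin n → ℝ) :
    ∑ u, (Q *ᵥ f) u * g u = ∑ u, f u * (Q *ᵥ g) u := by
  change (Q *ᵥ f) ⬝ᵥ g = f ⬝ᵥ (Q *ᵥ g)
  rw [Matrix.dotProduct_mulVec, ← Matrix.mulVec_transpose, hQ.1]

theorem sum_sq_mulVec (hQ : IsProjector n Q) (f : Fin n → ℝ) :
    ∑ u, (Q *ᵥ f) u ^ 2 = ∑ u, f u * (Q *ᵥ f) u := by
  rw [← hQ.mulVec_mulVec f, ← hQ.sum_mul_mulVec, hQ.mulVec_mulVec]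
  exact Finset.sum_congr rfl fun u _ => sq _

theorem sum_sq_mulVec_le (hQ : IsProjector n Q) (f : Fin n → ℝ) :
    ∑ u, (Q *ᵥ f) u ^ 2 ≤ ∑ u, f u ^ 2 := by
  have h : 0 ≤ ∑ u, (f u - (Q *ᵥ f) u) ^ 2 := Finset.sum_nonneg fun _ _ => sq_nonneg _
  have e : ∑ u, (f u - (Q *ᵥ f) u) ^ 2
      = ∑ u, f u ^ 2 - 2 * ∑ u, f u * (Q *ᵥ f) u + ∑ u, (Q *ᵥ f) u ^ 2 := by
    rw [Finset.mul_sum, ← Finset.sum_sub_distrib, ← Finset.sum_add_distrib]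
    exact Finset.sum_congr rfl fun u _ => by ring
  have := hQ.sum_sq_mulVec f
  linarith

theorem abs_le_one (hQ : IsProjector n Q) (u v : Fin n) : |Q u v| ≤ 1 := by
  have h1 : Q u u ^ 2 ≤ Q u u := by
    conv_rhs => rw [← hQ.sum_sq u]
    exact Finset.single_le_sum (f := fun v => Q u v ^ 2) (fun _ _ => sq_nonneg _)
      (Finset.mem_univ u)
  have h2 : Q u v ^ 2 ≤ Q u u := by
    conv_rhs => rw [← hQ.sum_sq u]
    exact Finset.single_le_sum (f := fun v => Q u v ^ 2) (fun _ _ => sq_nonneg _)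
      (Finset.mem_univ v)
  rw [← sq_le_one_iff_abs_le_one]
  nlinarith

end IsProjector

theorem pNorm_two_sq {n : ℕ} (g : Fin n → ℝ) : pNorm 2 g ^ 2 = (∑ u, g u ^ 2) / n := by
  have h : 0 ≤ expect fun u => |g u| ^ 2 := div_nonneg
    (Finset.sum_nonneg fun _ _ => by positivity) (Nat.cast_nonneg n)
  rw [pNorm, ← Real.rpow_natCast, ← Real.rpow_mul h]
  simp [expect]

theorem pNorm_four_pow {n : ℕ} (g : Fin n → ℝ) : pNorm 4 g ^ 4 = (∑ u, g u ^ 4) / n := by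
  have h : 0 ≤ expect fun u => |g u| ^ 4 := div_nonneg
    (Finset.sum_nonneg fun _ _ => by positivity) (Nat.cast_nonneg n)
  rw [pNorm, ← Real.rpow_natCast, ← Real.rpow_mul h]
  simp [expect, Even.pow_abs (show Even 4 by decide)]

/-- The level `1 / (n μ d^{1/3})`: in terms of plain sums over the universe, a function of the
image with `c * level * (∑ g ^ 2) ^ 2 ≤ ∑ g ^ 4` is good. -/
noncomputable def level {n : ℕ} (μ : ℝ) (Q : Matrix (Fin n) (Fin n) ℝ) : ℝ :=
  1 / (n * μ * (Q.rank : ℝ) ^ (1 / 3 : ℝ))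

theorem level_nonneg {n : ℕ} {μ : ℝ} (hμ : 0 ≤ μ) (Q : Matrix (Fin n) (Fin n) ℝ) :
    0 ≤ level μ Q := by unfold level; positivity

theorem level_pow_three {n : ℕ} (μ : ℝ) (Q : Matrix (Fin n) (Fin n) ℝ) :
    level μ Q ^ 3 = 1 / ((n * μ) ^ 3 * Q.rank) := by
  have : ((Q.rank : ℝ) ^ (1 / 3 : ℝ)) ^ 3 = Q.rank := by
    rw [← Real.rpow_natCast, ← Real.rpow_mul (Nat.cast_nonneg _)]; norm_num
  rw [level, div_pow, mul_pow, this, one_pow]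

theorem isGood_iff {n : ℕ} {c μ : ℝ} {Q : Matrix (Fin n) (Fin n) ℝ} {g : Fin n → ℝ} :
    IsGood c μ Q g ↔ g ≠ 0 ∧ (∃ h : Fin n → ℝ, g = Q *ᵥ h) ∧
      c * level μ Q * (∑ u, g u ^ 2) ^ 2 ≤ ∑ u, g u ^ 4 := by
  unfold IsGood
  refine and_congr_right fun hg => and_congr_right fun _ => ?_
  have hn : 0 < (n : ℝ) := by
    rcases Nat.eq_zero_or_pos n with rfl | h
    · exact absurd (Subsingleton.elim _ _) hg
    · exact_mod_cast h
  rw [pNorm_four_pow, show pNorm 2 g ^ 4 = (pNorm 2 g ^ 2) ^ 2 by ring, pNorm_two_sq, level,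
    le_div_iff₀ hn]
  have e : c * (((∑ u, g u ^ 2) / n) ^ 2 / (μ * (Q.rank : ℝ) ^ (1 / 3 : ℝ))) * n
      = c * (1 / (n * μ * (Q.rank : ℝ) ^ (1 / 3 : ℝ))) * (∑ u, g u ^ 2) ^ 2 := by
    rw [div_pow, div_div, mul_assoc, div_mul_eq_mul_div, mul_assoc, one_div_mul_eq_div]
    congr 1
    rw [show (n : ℝ) ^ 2 * (μ * (Q.rank : ℝ) ^ (1 / 3 : ℝ))
      = (n * (μ * (Q.rank : ℝ) ^ (1 / 3 : ℝ))) * n by ring, mul_div_mul_right _ _ hn.ne']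
    ring_nf
  rw [e]

end ASVP

namespace ASVP

open Matrix

/-! ### Local correlation forces global correlation -/

/-- The Euclidean norm of a real function on a finite type. -/
noncomputable def nrm {ι : Type*} [Fintype ι] (f : ι → ℝ) : ℝ := ‖WithLp.toLp 2 f‖

section nrm

variable {ι κ : Type*} [Fintype ι] [Fintype κ]

theorem nrm_nonneg (f : ι → ℝ) : 0 ≤ nrm f := norm_nonneg _

theorem nrm_sq (f : ι → ℝ) : nrm f ^ 2 = ∑ i, f i ^ 2 := EuclideanSpace.real_norm_sq_eq _

theorem nrm_le_of_sq_le {f : ι → ℝ} {r : ℝ} (hr : 0 ≤ r) (h : ∑ i, f i ^ 2 ≤ r ^ 2) :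
    nrm f ≤ r := by
  rw [← nrm_sq] at h
  exact le_of_sq_le_sq h hr

theorem nrm_add_le (f g : ι → ℝ) : nrm (fun i => f i + g i) ≤ nrm f + nrm g :=
  norm_add_le (WithLp.toLp 2 f) (WithLp.toLp 2 g)

theorem nrm_const_mul {c : ℝ} (hc : 0 ≤ c) (f : ι → ℝ) : nrm (fun i => c * f i) = c * nrm f := by
  have := norm_smul c (WithLp.toLp 2 f)
  rwa [Real.norm_of_nonneg hc] at this

theorem nrm_mono {f g : ι → ℝ} (h : ∀ i, |f i| ≤ g i) : nrm f ≤ nrm g :=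
  nrm_le_of_sq_le (nrm_nonneg g) <| by
    rw [nrm_sq]
    exact Finset.sum_le_sum fun i _ => sq_le_sq' (by linarith [neg_le_of_abs_le (h i)])
      (le_of_abs_le (h i))

theorem nrm_le_card_mul {f : ι → ℝ} {e : ℝ} (he : 0 ≤ e) (h : ∀ i, |f i| ≤ e) :
    nrm f ≤ Fintype.card ι * e := by
  refine nrm_le_of_sq_le (by positivity) ?_
  calc ∑ i, f i ^ 2 ≤ ∑ _i : ι, e ^ 2 := Finset.sum_le_sum fun i _ => by
        rw [← sq_abs]; exact pow_le_pow_left₀ (abs_nonneg _) (h i) 2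
    _ = Fintype.card ι * e ^ 2 := by simp
    _ ≤ _ := by
        rw [mul_pow]
        gcongr
        exact_mod_cast Nat.le_self_pow two_ne_zero _

theorem sum_mul_le_nrm (f g : ι → ℝ) : ∑ i, f i * g i ≤ nrm f * nrm g := by
  have := Real.sum_mul_le_sqrt_mul_sqrt Finset.univ f g
  rwa [← nrm_sq, ← nrm_sq, Real.sqrt_sq (nrm_nonneg f), Real.sqrt_sq (nrm_nonneg g)] at this

/-- A perturbation of size `e` at every point. -/
theorem nrm_le_add_of_abs_sub_le {f g : ι → ℝ} {e : ℝ} (he : 0 ≤ e) (h : ∀ i, |f i - g i| ≤ e) :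
    nrm f ≤ nrm g + Fintype.card ι * e := by
  have := nrm_add_le g fun i => f i - g i
  simp only [add_sub_cancel] at this
  exact this.trans (by gcongr; exact nrm_le_card_mul he h)

theorem nrm_le_of_le_mul_add {f g : ι → ℝ} {a e : ℝ} (ha : 0 ≤ a) (he : 0 ≤ e)
    (h : ∀ i, |f i| ≤ a * g i + e) : nrm f ≤ a * nrm g + Fintype.card ι * e := by
  refine (nrm_mono h).trans ?_
  rw [← nrm_const_mul ha g]
  exact nrm_le_add_of_abs_sub_le he fun i => by simp [abs_of_nonneg he]

theorem abs_sum_sub_sum_le {f g : ι → ℝ} {e : ℝ} (h : ∀ i, |f i - g i| ≤ e) :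
    |∑ i, f i - ∑ i, g i| ≤ Fintype.card ι * e := by
  rw [← Finset.sum_sub_distrib]
  refine (Finset.abs_sum_le_sum_abs _ _).trans ((Finset.sum_le_sum fun i _ => h i).trans ?_)
  simp

end nrm

variable {U : Type*} [Fintype U]

/-- If every row of a positive semidefinite matrix has Euclidean norm at most `a` times its sum,
then so has the vector of row sums. -/
theorem nrm_rowSum_le [DecidableEq U] {B : Matrix U U ℝ} (hB : B.PosSemidef) {a e : ℝ}
    (ha : 0 ≤ a) (he : 0 ≤ e) (h : ∀ x, nrm (B x) ≤ a * ∑ u, B x u + e) :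
    nrm (fun x => ∑ u, B x u) ≤ a * ∑ x, ∑ u, B x u + Fintype.card U ^ 2 * e := by
  set s : U → ℝ := fun x => ∑ u, B x u
  set S := ∑ x, ∑ u, B x u
  have hsym : ∀ x u, B x u = B u x := fun x u => by
    simpa using hB.1.apply u x
  set φ := a * nrm s + Fintype.card U * e
  have hφ0 : 0 ≤ φ := by have := nrm_nonneg s; positivity
  have hφ : nrm (fun x => nrm (B x)) ≤ φ :=
    nrm_le_of_le_mul_add ha he fun x => by rw [abs_of_nonneg (nrm_nonneg _)]; exact h x
  -- the quadratic form of `B` is at most its Frobenius norm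
  have hq : ∑ x, s x * ∑ u, B x u * s u ≤ φ * nrm s ^ 2 := by
    have h1 : ∑ x, s x * ∑ u, B x u * s u ≤ nrm s * nrm (fun x => ∑ u, B x u * s u) :=
      sum_mul_le_nrm _ _
    have h2 : nrm (fun x => ∑ u, B x u * s u) ≤ nrm s * φ := by
      refine (nrm_mono (g := fun x => nrm s * nrm (B x)) fun x => ?_).trans ?_
      · rw [abs_le]
        have e1 := sum_mul_le_nrm (B x) s
        have e2 := sum_mul_le_nrm (B x) (fun u => -s u)
        have e3 : nrm (fun u => -s u) = nrm s := norm_neg (WithLp.toLp 2 s)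
        simp only [mul_neg, Finset.sum_neg_distrib, e3] at e2
        constructor <;> linarith
      · rw [nrm_const_mul (nrm_nonneg s)]
        exact mul_le_mul_of_nonneg_left hφ (nrm_nonneg s)
    nlinarith [nrm_nonneg s]
  have hpos : ∀ y : U → ℝ, 0 ≤ ∑ x, y x * ∑ u, B x u * y u := fun y => by
    simpa [dotProduct, mulVec] using hB.dotProduct_mulVec_nonneg y
  have hS : 0 ≤ S := by simpa [S] using hpos fun _ => 1
  have key : φ * nrm s ^ 2 ≤ φ ^ 2 * S := by
    have h0 := hpos fun x => φ - s x
    have e1 : ∑ x, (φ - s x) * ∑ u, B x u * (φ - s u)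
        = φ ^ 2 * S - 2 * φ * nrm s ^ 2 + ∑ x, s x * ∑ u, B x u * s u := by
      have c1 : ∑ x, ∑ u, B x u * s u = nrm s ^ 2 := by
        rw [nrm_sq, Finset.sum_comm]
        refine Finset.sum_congr rfl fun u _ => ?_
        rw [← Finset.sum_mul, sq]
        congr 1
        exact Finset.sum_congr rfl fun x _ => hsym x u
      have c2 : ∀ x, ∑ u, B x u * (φ - s u) = φ * s x - ∑ u, B x u * s u := fun x => by
        simp only [mul_sub, Finset.sum_sub_distrib, s, ← Finset.sum_mul]; ring
      have c3 : ∑ x, s x * s x = nrm s ^ 2 := by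
        rw [nrm_sq]; exact Finset.sum_congr rfl fun x _ => (sq _).symm
      calc _ = ∑ x, (φ ^ 2 * s x - φ * ∑ u, B x u * s u - φ * (s x * s x)
                + s x * ∑ u, B x u * s u) :=
            Finset.sum_congr rfl fun x _ => by rw [c2]; ring
        _ = _ := by
            rw [Finset.sum_add_distrib, Finset.sum_sub_distrib, Finset.sum_sub_distrib,
              ← Finset.mul_sum, ← Finset.mul_sum, ← Finset.mul_sum, c1, c3]
            ring
    rw [e1] at h0
    linarith
  rcases hφ0.eq_or_lt with h0 | h0
  · have hz : ∀ x, nrm (B x) = 0 := by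
      have := nrm_sq fun x => nrm (B x)
      rw [le_antisymm (hφ.trans h0.ge) (nrm_nonneg _), zero_pow two_ne_zero] at this
      intro x
      have := (Finset.sum_eq_zero_iff_of_nonneg fun _ _ => sq_nonneg _).1 this.symm x
        (Finset.mem_univ x)
      exact pow_eq_zero_iff two_ne_zero |>.1 this
    have hs : s = 0 := funext fun x => by
      have h1 : ∑ u, B x u ^ 2 = 0 := by rw [← nrm_sq, hz, zero_pow two_ne_zero]
      refine Finset.sum_eq_zero fun u _ => ?_
      exact pow_eq_zero_iff two_ne_zero |>.1
        ((Finset.sum_eq_zero_iff_of_nonneg fun _ _ => sq_nonneg _).1 h1 u (Finset.mem_univ u))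
    have : nrm s = 0 := by rw [hs]; exact norm_zero
    rw [this]; positivity
  · have h1 : nrm s ^ 2 ≤ φ * S := by
      by_contra hc
      push Not at hc
      nlinarith
    have hS2 : S ≤ nrm s * Fintype.card U := by
      have h2 := sum_mul_le_nrm s fun _ => 1
      have h3 : nrm (fun _ : U => (1 : ℝ)) ≤ Fintype.card U * 1 :=
        nrm_le_card_mul zero_le_one fun _ => by simp
      simp only [mul_one] at h2 h3
      exact h2.trans (mul_le_mul_of_nonneg_left h3 (nrm_nonneg s))
    have hE : 0 ≤ (Fintype.card U : ℝ) * e := by positivity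
    by_contra hc
    push Not at hc
    have hs0 : 0 < nrm s := lt_of_le_of_lt (by positivity) hc
    have h4 : nrm s * nrm s ≤ nrm s * (a * S + Fintype.card U ^ 2 * e) := by
      calc nrm s * nrm s = nrm s ^ 2 := (sq _).symm
        _ ≤ a * nrm s * S + Fintype.card U * e * S := by rw [← add_mul]; exact h1
        _ ≤ a * nrm s * S + Fintype.card U * e * (nrm s * Fintype.card U) := by gcongr
        _ = _ := by ring
    exact absurd (le_of_mul_le_mul_left h4 hs0) (not_le.2 hc)

/-- The marginal of a function of tuples, over the first entry. -/
def marg (W : List U → ℝ) (l : List U) : ℝ := ∑ x, W (x :: l)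

theorem posSemidef_marg {W : List U → ℝ} {k : ℕ}
    (h : ∀ l : List U, l.length = k + 1 → (Matrix.of fun x u => W (l ++ [x, u])).PosSemidef)
    (l : List U) (hl : l.length = k) :
    (Matrix.of fun x u => marg W (l ++ [x, u])).PosSemidef := by
  have := Matrix.posSemidef_sum Finset.univ fun (y : U) _ => h (y :: l) (by simp [hl])
  convert this using 1
  ext x u
  simp [marg, Matrix.sum_apply]

/-- Approximate invariance under cyclic shifts passes to the marginal: with the symmetry in the
last two entries, cyclic shifts also produce the shift that leaves the first entry in place. -/
theorem abs_marg_sub_le {W : List U → ℝ} {k : ℕ} {η : ℝ}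
    (hsym : ∀ (l : List U) (x u : U), l.length = k → W (l ++ [x, u]) = W (l ++ [u, x]))
    (hcyc : ∀ (l : List U) (x : U), l.length = k + 1 → |W (l ++ [x]) - W (x :: l)| ≤ η)
    (l : List U) (y : U) (hl : l.length = k) :
    |marg W (l ++ [y]) - marg W (y :: l)| ≤ Fintype.card U * (3 * η) := by
  refine abs_sum_sub_sum_le fun x => ?_
  have h1 := hcyc (l ++ [y]) x (by simp [hl])
  have h2 := hcyc (y :: l) x (by simp [hl])
  have h3 := hcyc (l ++ [x]) y (by simp [hl])
  have h4 := hsym l x y hl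
  simp only [List.append_assoc, List.cons_append, List.nil_append] at h1 h2 h3
  rw [abs_le] at *
  constructor <;> linarith [h1.1, h1.2, h2.1, h2.2, h3.1, h3.2]

/-- The Euclidean norm of a function over all tuples of length `m`. -/
noncomputable def tupleNrm (m : ℕ) (f : List U → ℝ) : ℝ :=
  nrm fun v : Fin m → U => f (List.ofFn v)

theorem tupleNrm_succ (m : ℕ) (f : List U → ℝ) :
    tupleNrm (m + 1) f = tupleNrm m fun l => nrm fun x => f (l ++ [x]) := by
  have h : ∀ {r s : ℝ}, 0 ≤ r → 0 ≤ s → r ^ 2 = s ^ 2 → r = s := fun hr hs e => by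
    rwa [sq_eq_sq₀ hr hs] at e
  refine h (nrm_nonneg _) (nrm_nonneg _) ?_
  unfold tupleNrm
  rw [nrm_sq, nrm_sq, ← (Fin.snocEquiv fun _ : Fin (m + 1) => U).sum_comp, Fintype.sum_prod_type,
    Finset.sum_comm]
  refine Finset.sum_congr rfl fun v _ => ?_
  rw [nrm_sq]
  refine Finset.sum_congr rfl fun x _ => ?_
  rw [List.ofFn_succ_last]
  simp [Fin.snocEquiv]

section descent

variable {W : List U → ℝ} {k : ℕ} {a e η : ℝ}

/-- One level of the descent: if every row `W (l, ·)` has norm at most `a` times its sum, then so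
has every row of the marginal. -/
theorem nrm_marg_le [DecidableEq U] (ha : 0 ≤ a) (ha1 : a ≤ 1) (he : 0 ≤ e) (hη : 0 ≤ η)
    (hpsd : ∀ l : List U, l.length = k → (Matrix.of fun x u => W (l ++ [x, u])).PosSemidef)
    (hcyc : ∀ (l : List U) (x : U), l.length = k + 1 → |W (l ++ [x]) - W (x :: l)| ≤ η)
    (hrow : ∀ l : List U, l.length = k + 1 →
      nrm (fun x => W (l ++ [x])) ≤ a * ∑ x, W (l ++ [x]) + e)
    (l : List U) (hl : l.length = k) :
    nrm (fun x => marg W (l ++ [x])) ≤ a * ∑ x, marg W (l ++ [x])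
      + Fintype.card U ^ 2 * (e + 2 * η) := by
  set N : ℝ := (Fintype.card U : ℝ)
  have hN : 0 ≤ N := Nat.cast_nonneg _
  have hd : ∀ x, |marg W (l ++ [x]) - ∑ u, W (l ++ [x, u])| ≤ N * η := fun x => by
    rw [abs_sub_comm]
    refine abs_sum_sub_sum_le fun u => ?_
    simpa using hcyc (l ++ [x]) u (by simp [hl])
  have h1 := nrm_rowSum_le (hpsd l hl) ha he fun x => by
    have := hrow (l ++ [x]) (by simp [hl])
    simp only [List.append_assoc, List.cons_append, List.nil_append] at this
    exact this
  simp only [Matrix.of_apply] at h1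
  have h2 := nrm_le_add_of_abs_sub_le (by positivity) hd
  have h3 := abs_sum_sub_sum_le hd
  have h4 : a * (∑ x, ∑ u, W (l ++ [x, u])) ≤ a * ∑ x, marg W (l ++ [x]) + N * (N * η) := by
    have := mul_le_mul_of_nonneg_left (abs_le.1 h3).1 ha
    have h5 : a * (N * (N * η)) ≤ N * (N * η) :=
      mul_le_of_le_one_left (by positivity) ha1
    linarith
  linarith

/-- The norm of a function over all tuples of length `k + 1` is controlled by that of its
marginal, if every row has norm at most `a` times its sum. -/
theorem tupleNrm_succ_le (ha : 0 ≤ a) (ha1 : a ≤ 1) (he : 0 ≤ e) (hη : 0 ≤ η)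
    (hcyc : ∀ (l : List U) (x : U), l.length = k → |W (l ++ [x]) - W (x :: l)| ≤ η)
    (hrow : ∀ l : List U, l.length = k →
      nrm (fun x => W (l ++ [x])) ≤ a * ∑ x, W (l ++ [x]) + e) :
    tupleNrm (k + 1) W ≤ a * tupleNrm k (marg W)
      + Fintype.card U ^ k * (e + Fintype.card U * η) := by
  set N : ℝ := (Fintype.card U : ℝ)
  have hN : 0 ≤ N := Nat.cast_nonneg _
  rw [tupleNrm_succ]
  refine (nrm_le_of_le_mul_add (g := fun v => marg W (List.ofFn v)) (e := e + N * η) ha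
    (by positivity) fun v => ?_).trans_eq ?_
  · rw [abs_of_nonneg (nrm_nonneg _)]
    have h3 : |∑ x, W (List.ofFn v ++ [x]) - marg W (List.ofFn v)| ≤ N * η :=
      abs_sum_sub_sum_le fun x => hcyc _ x (by simp)
    have h5 : a * (N * η) ≤ N * η := mul_le_of_le_one_left (by positivity) ha1
    nlinarith [hrow (List.ofFn v) (by simp), (abs_le.1 h3).2]
  · simp [tupleNrm, N]

/-- A function of quintuples with positive semidefinite slices, nearly invariant under cyclic
shifts, all of whose rows are flat: the quadruple marginal has small norm. This is the step from
local to global correlation; flat rows are what remains when every reweighting at four points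
fails to produce a good function. -/
theorem tupleNrm_four_marg_le [DecidableEq U] (ha : 0 ≤ a) (ha1 : a ≤ 1) (he : 0 ≤ e) (hη : 0 ≤ η)
    (hpsd : ∀ l : List U, l.length = 3 → (Matrix.of fun x u => W (l ++ [x, u])).PosSemidef)
    (hcyc : ∀ (l : List U) (x : U), l.length = 4 → |W (l ++ [x]) - W (x :: l)| ≤ η)
    (hrow : ∀ l : List U, l.length = 4 →
      nrm (fun x => W (l ++ [x])) ≤ a * ∑ x, W (l ++ [x]) + e) :
    tupleNrm 4 (marg W) ≤ a ^ 4 * |∑ v : Fin 5 → U, W (List.ofFn v)|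
      + 300 * Fintype.card U ^ 8 * (e + η) := by
  set N : ℝ := (Fintype.card U : ℝ) with hNdef
  rcases Nat.eq_zero_or_pos (Fintype.card U) with h0 | h0
  · have : IsEmpty U := Fintype.card_eq_zero_iff.1 h0
    have : tupleNrm 4 (marg W) = 0 := by
      have := nrm_sq fun v : Fin 4 → U => marg W (List.ofFn v)
      rw [Finset.univ_eq_empty, Finset.sum_empty] at this
      exact pow_eq_zero_iff two_ne_zero |>.1 this
    rw [this]; positivity
  have hN : 1 ≤ N := Nat.one_le_cast.2 h0
  have hN0 : 0 ≤ N := by linarith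
  have sym : ∀ {V : List U → ℝ} {j : ℕ},
      (∀ l : List U, l.length = j → (Matrix.of fun x u => V (l ++ [x, u])).PosSemidef) →
      ∀ (l : List U) (x u : U), l.length = j → V (l ++ [x, u]) = V (l ++ [u, x]) :=
    fun h l x u hl => by simpa using (h l hl).1.apply u x
  have p3 := posSemidef_marg hpsd
  have p2 := posSemidef_marg p3
  have p1 := posSemidef_marg p2
  have c3 := abs_marg_sub_le (sym hpsd) hcyc
  have c2 := abs_marg_sub_le (sym p3) c3
  have c1 := abs_marg_sub_le (sym p2) c2
  have c0 := abs_marg_sub_le (sym p1) c1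
  have r3 := nrm_marg_le ha ha1 he hη hpsd hcyc hrow
  have r2 := nrm_marg_le ha ha1 (by positivity) (by positivity) p3 c3 r3
  have r1 := nrm_marg_le ha ha1 (by positivity) (by positivity) p2 c2 r2
  have r0 := nrm_marg_le ha ha1 (by positivity) (by positivity) p1 c1 r1
  have t3 := tupleNrm_succ_le ha ha1 (by positivity) (by positivity) c3 r3
  have t2 := tupleNrm_succ_le ha ha1 (by positivity) (by positivity) c2 r2
  have t1 := tupleNrm_succ_le ha ha1 (by positivity) (by positivity) c1 r1
  have t0 := tupleNrm_succ_le ha ha1 (by positivity) (by positivity) c0 r0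
  have hz : tupleNrm 0 (marg (marg (marg (marg (marg W))))) = |∑ v : Fin 5 → U, W (List.ofFn v)| := by
    have h1 : ∀ (m : ℕ) (f : List U → ℝ), ∑ v : Fin (m + 1) → U, f (List.ofFn v)
        = ∑ v : Fin m → U, marg f (List.ofFn v) := fun m f => by
      rw [← (Fin.consEquiv fun _ : Fin (m + 1) => U).sum_comp, Fintype.sum_prod_type,
        Finset.sum_comm]
      refine Finset.sum_congr rfl fun v _ => Finset.sum_congr rfl fun x _ => ?_
      simp [Fin.consEquiv]
    rw [h1, h1, h1, h1, h1]
    have := nrm_sq fun v : Fin 0 → U => marg (marg (marg (marg (marg W)))) (List.ofFn v)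
    rw [Fintype.sum_unique] at this
    rw [Fintype.sum_unique, tupleNrm, ← abs_of_nonneg (nrm_nonneg _)]
    exact (sq_eq_sq_iff_abs_eq_abs _ _).1 this
  rw [hz] at t0
  set T0 := |∑ v : Fin 5 → U, W (List.ofFn v)|
  clear_value T0
  have mono : ∀ {x y c : ℝ}, 0 ≤ c → x ≤ y + c → a * x ≤ a * y + c := fun {x y c} hc h => by
    have := mul_le_mul_of_nonneg_left h ha
    nlinarith [mul_le_of_le_one_left hc ha1]
  have s1 := mono (by positivity) t0
  have s2 := mono (by positivity) (t1.trans (add_le_add_left s1 _) |>.trans_eq (add_assoc _ _ _))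
  have s3 := mono (by positivity) (t2.trans (add_le_add_left s2 _) |>.trans_eq (add_assoc _ _ _))
  have s4 := t3.trans (add_le_add_left s3 _)
  refine s4.trans ?_
  rw [← hNdef]
  have hp : ∀ {i : ℕ}, i ≤ 8 → N ^ i ≤ N ^ 8 := fun h => pow_le_pow_right₀ hN h
  have b : ∀ {i : ℕ}, i ≤ 8 → N ^ i * η ≤ N ^ 8 * η := fun h =>
    mul_le_mul_of_nonneg_right (hp h) hη
  have b' : ∀ {i : ℕ}, i ≤ 8 → N ^ i * e ≤ N ^ 8 * e := fun h =>
    mul_le_mul_of_nonneg_right (hp h) he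
  have E : ∀ i ≤ 8, N ^ i * η ≤ N ^ 8 * η ∧ N ^ i * e ≤ N ^ 8 * e := fun i h => ⟨b h, b' h⟩
  ring_nf
  have e5 := E 5 (by norm_num)
  have e6 := E 6 (by norm_num)
  have e7 := E 7 (by norm_num)
  have n1 : 0 ≤ N ^ 8 * η := by positivity
  have n2 : 0 ≤ N ^ 8 * e := by positivity
  linarith [e5.1, e5.2, e6.1, e6.2, e7.1, e7.2]

end descent

end ASVP

namespace ASVP

open Matrix

/-! ### The tensor of the fourth norm of a projection -/

variable {n : ℕ} {Q : Matrix (Fin n) (Fin n) ℝ}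

/-- The tensor `∑ u, ∏ j, Q u (ω j)`: its pairing with `t (ω 0) ⋯ t (ω 3)` is `∑ u, (Q t) u ^ 4`. -/
def quad (Q : Matrix (Fin n) (Fin n) ℝ) (ω : Fin 4 → Fin n) : ℝ := ∑ u, ∏ j, Q u (ω j)

theorem sum_quad_mul (Q : Matrix (Fin n) (Fin n) ℝ) (t : Fin n → ℝ) :
    ∑ ω : Fin 4 → Fin n, quad Q ω * ∏ j, t (ω j) = ∑ u, (Q *ᵥ t) u ^ 4 := by
  simp only [quad, Finset.sum_mul, ← Finset.prod_mul_distrib]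
  rw [Finset.sum_comm]
  refine Finset.sum_congr rfl fun u _ => ?_
  rw [Matrix.mulVec, dotProduct, Fintype.sum_pow]

theorem sum_quad_sq (hQ : IsProjector n Q) :
    ∑ ω, quad Q ω ^ 2 = ∑ u, ∑ v, Q u v ^ 4 := by
  have h : ∀ ω, quad Q ω ^ 2 = ∑ u, quad Q ω * ∏ j, Q u (ω j) := fun ω => by
    rw [← Finset.mul_sum, sq]; rfl
  simp only [h]
  rw [Finset.sum_comm]
  refine Finset.sum_congr rfl fun u _ => ?_
  rw [sum_quad_mul Q (Q u)]
  refine Finset.sum_congr rfl fun v _ => ?_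
  have : (Q *ᵥ Q u) v = Q u v := by
    rw [Matrix.mulVec, dotProduct, hQ.symm u v, ← hQ.sum_mul v u]
    exact Finset.sum_congr rfl fun w _ => by rw [hQ.symm u w]
  rw [this]

theorem abs_quad_le (hQ : IsProjector n Q) (ω : Fin 4 → Fin n) : |quad Q ω| ≤ n := by
  refine (Finset.abs_sum_le_sum_abs _ _).trans ?_
  refine (Finset.sum_le_sum fun u _ => ?_).trans_eq (b := ∑ _u : Fin n, (1 : ℝ)) (by simp)
  rw [Finset.abs_prod]
  exact Finset.prod_le_one (fun _ _ => abs_nonneg _) fun j _ => hQ.abs_le_one _ _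

theorem nrm_quad_le (hQ : IsProjector n Q) {A : ℝ} (hA : 0 ≤ A)
    (hdiag : ∑ u, Q u u ^ 2 ≤ A * (∑ u, Q u u) ^ 2)
    (hcol : ∀ u, ∑ v, Q u v ^ 4 ≤ A * Q u u ^ 2) :
    nrm (quad Q) ≤ A * Q.rank := by
  rw [hQ.trace_eq_rank] at hdiag
  refine nrm_le_of_sq_le (by positivity) ?_
  rw [sum_quad_sq hQ]
  calc ∑ u, ∑ v, Q u v ^ 4 ≤ ∑ u, A * Q u u ^ 2 := Finset.sum_le_sum fun u _ => hcol u
    _ = A * ∑ u, Q u u ^ 2 := by rw [Finset.mul_sum]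
    _ ≤ A * (A * (Q.rank : ℝ) ^ 2) := by gcongr
    _ = _ := by ring

/-- If the projected standard Gaussian function, the columns of `Q`, and all rows of `W` are flat,
then `W` correlates little with the tensor `quad Q`. -/
theorem sum_mul_abs_quad_le (hQ : IsProjector n Q) {A e η : ℝ} (hA : 0 ≤ A) (hA1 : A ≤ 1)
    (he : 0 ≤ e) (hη : 0 ≤ η)
    (hdiag : ∑ u, Q u u ^ 2 ≤ A * (∑ u, Q u u) ^ 2)
    (hcol : ∀ u, ∑ v, Q u v ^ 4 ≤ A * Q u u ^ 2) {W : List (Fin n) → ℝ}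
    (hpsd : ∀ l : List (Fin n), l.length = 3 →
      (Matrix.of fun x u => W (l ++ [x, u])).PosSemidef)
    (hcyc : ∀ (l : List (Fin n)) (x : Fin n), l.length = 4 → |W (l ++ [x]) - W (x :: l)| ≤ η)
    (hrow : ∀ l : List (Fin n), l.length = 4 →
      nrm (fun x => W (l ++ [x])) ≤ √A * ∑ x, W (l ++ [x]) + e) :
    ∑ ω : Fin 4 → Fin n, (∑ u, W (List.ofFn ω ++ [u])) * |quad Q ω|
      ≤ A ^ 3 * Q.rank * |∑ v : Fin 5 → Fin n, W (List.ofFn v)| + 301 * n ^ 9 * (e + η) := by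
  have h4 := tupleNrm_four_marg_le (Real.sqrt_nonneg A) (Real.sqrt_le_one.2 hA1) he hη hpsd hcyc
    hrow
  rw [show √A ^ 4 = (√A ^ 2) ^ 2 by ring, Real.sq_sqrt hA, Fintype.card_fin] at h4
  set T := |∑ v : Fin 5 → Fin n, W (List.ofFn v)|
  have hT : 0 ≤ T := abs_nonneg _
  have hd : (Q.rank : ℝ) ≤ n := by
    exact_mod_cast (Matrix.rank_le_card_width Q).trans_eq (Fintype.card_fin n)
  have hd0 : (0 : ℝ) ≤ Q.rank := Nat.cast_nonneg _
  have hk := nrm_quad_le hQ hA hdiag hcol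
  have hk' : A * Q.rank ≤ n := (mul_le_of_le_one_left hd0 hA1).trans hd
  have hcs := sum_mul_le_nrm (fun ω : Fin 4 → Fin n => marg W (List.ofFn ω)) fun ω => |quad Q ω|
  have hq : nrm (fun ω => |quad Q ω|) ≤ nrm (quad Q) :=
    nrm_le_of_sq_le (nrm_nonneg _) (by rw [nrm_sq]; exact le_of_eq (by simp))
  have h5 : nrm (fun ω : Fin 4 → Fin n => marg W (List.ofFn ω)) * nrm (fun ω => |quad Q ω|)
      ≤ (A ^ 2 * T + 300 * n ^ 8 * (e + η)) * (A * Q.rank) := by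
    have := nrm_nonneg (quad Q)
    exact mul_le_mul h4 (hq.trans hk) (nrm_nonneg _) (by positivity)
  have h6 : ∑ ω : Fin 4 → Fin n, (∑ u, W (List.ofFn ω ++ [u])) * |quad Q ω|
      ≤ ∑ ω : Fin 4 → Fin n, (marg W (List.ofFn ω) * |quad Q ω| + n * η * n) := by
    refine Finset.sum_le_sum fun ω _ => ?_
    have h7 := abs_sum_sub_sum_le fun u => hcyc (List.ofFn ω) u (by simp)
    rw [Fintype.card_fin] at h7
    have h8 := (abs_le.1 h7).2
    have h9 := abs_quad_le hQ ω
    have h10 : (n : ℝ) * η * |quad Q ω| ≤ n * η * n := by gcongr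
    have : (∑ u, W (List.ofFn ω ++ [u])) * |quad Q ω|
        ≤ (marg W (List.ofFn ω) + n * η) * |quad Q ω| := by
      refine mul_le_mul_of_nonneg_right ?_ (abs_nonneg _)
      simp only [marg]; linarith
    linarith
  rw [Finset.sum_add_distrib] at h6
  simp only [Finset.sum_const, Finset.card_univ, Fintype.card_pi, Fintype.card_fin,
    Finset.prod_const, nsmul_eq_mul, Nat.cast_pow] at h6
  have h11 : 300 * (n : ℝ) ^ 8 * (e + η) * (A * Q.rank) ≤ 300 * n ^ 8 * (e + η) * n := by gcongr
  have h12 : (n : ℝ) ^ 4 * (n * η * n) ≤ n ^ 9 * η := by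
    rw [show (n : ℝ) ^ 4 * (n * η * n) = n ^ 6 * η by ring]
    refine mul_le_mul_of_nonneg_right ?_ hη
    rcases Nat.eq_zero_or_pos n with h0 | h0
    · simp [h0]
    · exact pow_le_pow_right₀ (Nat.one_le_cast.2 h0) (by norm_num)
  have h13 : 0 ≤ (n : ℝ) ^ 9 * e := by positivity
  linarith

/-! ### The planted function -/

/-- The truncation of a Boolean function `f` to the points where `F` is at least `1 / 2`. -/
noncomputable def truncation (f F : Fin n → ℝ) (u : Fin n) : ℝ :=
  if f u = 1 ∧ 1 / 2 ≤ F u then 1 else 0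

theorem truncation_nonneg (f F : Fin n → ℝ) (u : Fin n) : 0 ≤ truncation f F u := by
  unfold truncation; split_ifs <;> norm_num

theorem truncation_le (f F : Fin n → ℝ) (u : Fin n) : 1 / 4 * truncation f F u ≤ F u ^ 2 := by
  unfold truncation
  split_ifs with h
  · nlinarith [h.2]
  · simpa using sq_nonneg _

theorem IsBoolean.sq_eq {f : Fin n → ℝ} (hf : IsBoolean f) (u : Fin n) : f u ^ 2 = f u := by
  rcases hf u with h | h <;> simp [h]

theorem IsBoolean.nonneg {f : Fin n → ℝ} (hf : IsBoolean f) (u : Fin n) : 0 ≤ f u := by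
  rcases hf u with h | h <;> simp [h]

theorem IsNearlyIn.sum_pos {ε : ℝ} {f : Fin n → ℝ} (h : IsNearlyIn ε Q f) : 0 < ∑ u, f u := by
  refine (Finset.sum_nonneg fun u _ => h.1.nonneg u).lt_of_ne' fun h0 => h.2.1 ?_
  rw [Finset.sum_eq_zero_iff_of_nonneg fun u _ => h.1.nonneg u] at h0
  exact funext fun u => h0 u (Finset.mem_univ u)

theorem IsNearlyIn.pos {ε : ℝ} {f : Fin n → ℝ} (h : IsNearlyIn ε Q f) : 0 < n := by
  rcases Nat.eq_zero_or_pos n with rfl | hn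
  · exact absurd (Subsingleton.elim _ _) h.2.1
  · exact hn

theorem IsNearlyIn.sum_sq_ge {ε : ℝ} {f : Fin n → ℝ} (h : IsNearlyIn ε Q f) :
    (1 - ε) * ∑ u, f u ≤ ∑ u, (Q *ᵥ f) u ^ 2 := by
  have h2 := h.2.2
  have hn : 0 < (n : ℝ) := by exact_mod_cast h.pos
  rw [pNorm_two_sq, pNorm_two_sq, ← mul_div_assoc, div_le_div_iff_of_pos_right hn] at h2
  simpa [h.1.sq_eq] using h2

/-- The projection of the truncation keeps a constant fraction of the fourth norm of a nearly
contained Boolean function. -/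
theorem IsNearlyIn.sum_pow_four_ge (hQ : IsProjector n Q) {f : Fin n → ℝ}
    (h : IsNearlyIn (1 / 4) Q f) :
    (∑ u, f u) / 256 ≤ ∑ u, (Q *ᵥ truncation f (Q *ᵥ f)) u ^ 4 := by
  set k := ∑ u, f u
  set t := truncation f (Q *ᵥ f)
  set g := Q *ᵥ t
  have hk : 0 < k := h.sum_pos
  have h1 : k / 4 ≤ ∑ u, g u * f u := by
    have e1 := h.sum_sq_ge
    rw [hQ.sum_sq_mulVec] at e1
    have e2 : ∑ u, (f u * (Q *ᵥ f) u - f u / 2) ≤ ∑ u, t u * (Q *ᵥ f) u := by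
      refine Finset.sum_le_sum fun u _ => ?_
      rcases h.1 u with h0 | h0
      · simp [t, truncation, h0]
      · by_cases h2 : 1 / 2 ≤ (Q *ᵥ f) u
        · simp only [t, truncation, h0, h2, and_self, if_true]; linarith
        · simp only [t, truncation, h0, h2, and_false, if_false]; linarith
    rw [Finset.sum_sub_distrib, ← Finset.sum_div,
      ← hQ.sum_mul_mulVec t f] at e2
    have e3 : ∑ u, f u * (Q *ᵥ f) u = ∑ u, (Q *ᵥ f) u * f u :=
      Finset.sum_congr rfl fun u _ => mul_comm _ _
    linarith
  have h2 : (∑ u, g u * f u) ^ 2 ≤ k * ∑ u, g u ^ 2 * f u := by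
    have := Finset.sum_mul_sq_le_sq_mul_sq Finset.univ f fun u => g u * f u
    simp only [h.1.sq_eq, mul_pow] at this
    refine le_trans (le_of_eq ?_) this
    congr 1
    refine Finset.sum_congr rfl fun u _ => ?_
    rw [mul_left_comm, ← sq, h.1.sq_eq]
  have h3 : (∑ u, g u ^ 2 * f u) ^ 2 ≤ k * ∑ u, g u ^ 4 := by
    have := Finset.sum_mul_sq_le_sq_mul_sq Finset.univ f fun u => g u ^ 2
    simp only [h.1.sq_eq] at this
    refine le_trans (le_of_eq ?_) (this.trans_eq ?_)
    · congr 1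
      exact Finset.sum_congr rfl fun u _ => mul_comm _ _
    · congr 1
      exact Finset.sum_congr rfl fun u _ => by ring
  set a := ∑ u, g u * f u
  set b := ∑ u, g u ^ 2 * f u
  set c := ∑ u, g u ^ 4
  have h4 : k / 16 ≤ b := by
    have : k * (k / 16) ≤ k * b := by nlinarith
    exact le_of_mul_le_mul_left this hk
  have : k * (k / 256) ≤ k * c := by nlinarith
  exact le_of_mul_le_mul_left this hk

theorem IsNearlyIn.sum_abs_quad_ge (hQ : IsProjector n Q) {f : Fin n → ℝ}
    (h : IsNearlyIn (1 / 4) Q f) :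
    (∑ u, f u) / 4 ^ 8 ≤ ∑ ω, |quad Q ω| * ∏ j, (Q *ᵥ f) (ω j) ^ 2 := by
  have h1 := h.sum_pow_four_ge hQ
  rw [← sum_quad_mul] at h1
  have h2 : ∑ ω, (1 / 4) ^ 4 * (quad Q ω * ∏ j, truncation f (Q *ᵥ f) (ω j))
      ≤ ∑ ω, |quad Q ω| * ∏ j, (Q *ᵥ f) (ω j) ^ 2 := by
    refine Finset.sum_le_sum fun ω _ => ?_
    have h3 : ∏ j : Fin 4, (1 / 4 * truncation f (Q *ᵥ f) (ω j)) ≤ ∏ j, (Q *ᵥ f) (ω j) ^ 2 :=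
      Finset.prod_le_prod (fun j _ => mul_nonneg (by norm_num) (truncation_nonneg _ _ _))
        fun j _ => truncation_le _ _ _
    rw [Finset.prod_mul_distrib, Finset.prod_const, Finset.card_univ, Fintype.card_fin] at h3
    have h4 : 0 ≤ ∏ j : Fin 4, truncation f (Q *ᵥ f) (ω j) :=
      Finset.prod_nonneg fun j _ => truncation_nonneg _ _ _
    calc _ = quad Q ω * ((1 / 4) ^ 4 * ∏ j, truncation f (Q *ᵥ f) (ω j)) := by ring
      _ ≤ |quad Q ω| * ((1 / 4) ^ 4 * ∏ j, truncation f (Q *ᵥ f) (ω j)) := by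
          gcongr; exact le_abs_self _
      _ ≤ _ := by gcongr
  rw [← Finset.mul_sum] at h2
  linarith

end ASVP

namespace ASVP

open MvPolynomial Matrix

/-! ### Degrees of the polynomials of the relaxation -/

section degree

variable {σ : Type*} {p q : MvPolynomial σ ℝ} {d e m : ℕ}

theorem totalDegree_mul_le (hp : p.totalDegree ≤ d) (hq : q.totalDegree ≤ e) (h : d + e ≤ m) :
    (p * q).totalDegree ≤ m :=
  (totalDegree_mul p q).trans ((Nat.add_le_add hp hq).trans h)

theorem totalDegree_pow_le (hp : p.totalDegree ≤ d) (k : ℕ) (h : k * d ≤ m) :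
    (p ^ k).totalDegree ≤ m :=
  (totalDegree_pow p k).trans ((Nat.mul_le_mul_left k hp).trans h)

theorem totalDegree_add_le (hp : p.totalDegree ≤ m) (hq : q.totalDegree ≤ m) :
    (p + q).totalDegree ≤ m :=
  (totalDegree_add p q).trans (max_le hp hq)

theorem totalDegree_sub_le (hp : p.totalDegree ≤ m) (hq : q.totalDegree ≤ m) :
    (p - q).totalDegree ≤ m :=
  (totalDegree_sub p q).trans (max_le hp hq)

theorem totalDegree_C_le (r : ℝ) : (C r : MvPolynomial σ ℝ).totalDegree ≤ m := by
  rw [totalDegree_C]; exact Nat.zero_le m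

theorem totalDegree_X_le (i : σ) (h : 1 ≤ m) : (X i : MvPolynomial σ ℝ).totalDegree ≤ m := by
  rw [totalDegree_X]; exact h

theorem totalDegree_C_mul_le (r : ℝ) (hp : p.totalDegree ≤ m) : (C r * p).totalDegree ≤ m :=
  totalDegree_mul_le (totalDegree_C_le (m := 0) r) hp (by simp)

theorem totalDegree_sum_le {ι : Type*} (s : Finset ι) {f : ι → MvPolynomial σ ℝ}
    (h : ∀ i ∈ s, (f i).totalDegree ≤ m) : (∑ i ∈ s, f i).totalDegree ≤ m :=
  totalDegree_finsetSum_le h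

theorem totalDegree_prod_le {k : ℕ} {f : Fin k → MvPolynomial σ ℝ}
    (h : ∀ i, (f i).totalDegree ≤ d) (hm : k * d ≤ m) : (∏ i, f i).totalDegree ≤ m := by
  refine (totalDegree_finsetProd _ _).trans ((Finset.sum_le_sum fun i _ => h i).trans ?_)
  simpa using hm

variable {n : ℕ}

theorem totalDegree_projPoly_le (Q : Matrix (Fin n) (Fin n) ℝ) (x : Fin n → Var n) (u : Fin n)
    (h : 1 ≤ m) : (projPoly Q x u).totalDegree ≤ m :=
  totalDegree_sum_le _ fun _ _ => totalDegree_C_mul_le _ (totalDegree_X_le _ h)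

theorem totalDegree_expectPoly_le {h : Fin n → MvPolynomial (Var n) ℝ}
    (hd : ∀ u, (h u).totalDegree ≤ m) : (expectPoly h).totalDegree ≤ m :=
  totalDegree_C_mul_le _ (totalDegree_sum_le _ fun u _ => hd u)

theorem Constraint.totalDegree_le {ε a b μ : ℝ} {Q : Matrix (Fin n) (Fin n) ℝ}
    {p : MvPolynomial (Var n) ℝ} (h : Constraint ε a b μ Q p) : p.totalDegree ≤ 4 := by
  cases h with
  | boolean u =>
    exact totalDegree_sub_le (totalDegree_pow_le (totalDegree_X_le _ le_rfl) 2 (by norm_num))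
      (totalDegree_X_le _ (by norm_num))
  | measure =>
    exact totalDegree_sub_le (totalDegree_expectPoly_le fun u => totalDegree_X_le _ (by norm_num))
      (totalDegree_C_le _)
  | normTwo =>
    exact totalDegree_sub_le (totalDegree_sub_le (totalDegree_expectPoly_le fun u =>
      totalDegree_pow_le (totalDegree_projPoly_le _ _ _ le_rfl) 2 (by norm_num))
      (totalDegree_C_le _)) (totalDegree_pow_le (totalDegree_X_le _ le_rfl) 2 (by norm_num))
  | normFour =>
    exact totalDegree_sub_le (totalDegree_sub_le (totalDegree_expectPoly_le fun u =>
      totalDegree_pow_le (totalDegree_projPoly_le _ _ _ le_rfl) 4 (by norm_num))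
      (totalDegree_C_le _)) (totalDegree_pow_le (totalDegree_X_le _ le_rfl) 2 (by norm_num))
  | truncPos u =>
    exact totalDegree_sub_le (totalDegree_sub_le
      (totalDegree_pow_le (totalDegree_projPoly_le _ _ _ le_rfl) 2 (by norm_num))
      (totalDegree_C_mul_le _ (totalDegree_X_le _ (by norm_num))))
      (totalDegree_pow_le (totalDegree_X_le _ le_rfl) 2 (by norm_num))
  | truncNeg u =>
    exact totalDegree_sub_le (totalDegree_add_le
      (totalDegree_pow_le (totalDegree_projPoly_le _ _ _ le_rfl) 2 (by norm_num))
      (totalDegree_C_mul_le _ (totalDegree_X_le _ (by norm_num))))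
      (totalDegree_pow_le (totalDegree_X_le _ le_rfl) 2 (by norm_num))

end degree

/-! ### The relaxation is satisfied by nearly contained Boolean functions -/

/-- The assignment that extends `f` by its truncation `t` and by the square roots of the slacks
of the inequality constraints. -/
noncomputable def planted {n : ℕ} (Q : Matrix (Fin n) (Fin n) ℝ) (f : Fin n → ℝ) : Var n → ℝ
  | .val u => f u
  | .trunc u => truncation f (Q *ᵥ f) u
  | .slackPos u => √((Q *ᵥ f) u ^ 2 - 1 / 4 * truncation f (Q *ᵥ f) u)
  | .slackNeg u => √((Q *ᵥ f) u ^ 2 + 1 / 4 * truncation f (Q *ᵥ f) u)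
  | .slackTwo => √((∑ u, (Q *ᵥ f) u ^ 2) / n - (1 - 1 / 4) * expect f)
  | .slackFour => √((∑ u, (Q *ᵥ truncation f (Q *ᵥ f)) u ^ 4) / n - 1 / 256 * expect f)

theorem aeval_projPoly {n : ℕ} (Q : Matrix (Fin n) (Fin n) ℝ) (x : Fin n → Var n)
    (y : Var n → ℝ) (u : Fin n) :
    aeval y (projPoly Q x u) = (Q *ᵥ fun v => y (x v)) u := by
  simp [projPoly, mulVec, dotProduct]

theorem isFeasible_planted {n l : ℕ} (hl : 8 ≤ l) {Q : Matrix (Fin n) (Fin n) ℝ}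
    {f : Fin n → ℝ} (hQ : IsProjector n Q) (hf : IsNearlyIn (1 / 4) Q f) :
    IsFeasible l (1 / 4) (1 / 256) (1 / 4) (expect f) Q (aeval (planted Q f)).toLinearMap := by
  have hn : 0 < (n : ℝ) := by exact_mod_cast hf.pos
  refine ⟨⟨by simp, fun p _ => ?_⟩, fun p hp => ⟨by have := hp.totalDegree_le; omega, ?_⟩⟩
  · simpa using sq_nonneg _
  · suffices h : aeval (planted Q f) p = 0 by
      rw [AlgHom.toLinearMap_apply, map_pow, h, zero_pow two_ne_zero]
    have ht := fun u => truncation_le f (Q *ᵥ f) u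
    have ht0 := fun u => truncation_nonneg f (Q *ᵥ f) u
    cases hp with
    | boolean u => simp [planted, hf.1.sq_eq]
    | measure => simp [expectPoly, expect, planted, div_eq_inv_mul]
    | normTwo =>
      have h0 : 0 ≤ (∑ u, (Q *ᵥ f) u ^ 2) / n - (1 - 1 / 4) * expect f := by
        rw [sub_nonneg, expect, ← mul_div_assoc]
        exact div_le_div_of_nonneg_right hf.sum_sq_ge hn.le
      simp only [expectPoly, map_sub, map_mul, map_pow, map_sum, aeval_C, aeval_X,
        aeval_projPoly, planted, Real.sq_sqrt h0, Algebra.algebraMap_self_apply]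
      ring
    | normFour =>
      have h0 : 0 ≤ (∑ u, (Q *ᵥ truncation f (Q *ᵥ f)) u ^ 4) / n - 1 / 256 * expect f := by
        rw [sub_nonneg, expect, ← mul_div_assoc]
        refine div_le_div_of_nonneg_right ?_ hn.le
        have := hf.sum_pow_four_ge hQ
        linarith
      simp only [expectPoly, map_sub, map_mul, map_pow, map_sum, aeval_C, aeval_X,
        aeval_projPoly, planted, Real.sq_sqrt h0, Algebra.algebraMap_self_apply]
      ring
    | truncPos u =>
      have h0 : 0 ≤ (Q *ᵥ f) u ^ 2 - 1 / 4 * truncation f (Q *ᵥ f) u := by linarith [ht u]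
      simp only [map_sub, map_mul, map_pow, aeval_C, aeval_X, aeval_projPoly, planted,
        Real.sq_sqrt h0, Algebra.algebraMap_self_apply, sub_self]
    | truncNeg u =>
      have h0 : 0 ≤ (Q *ᵥ f) u ^ 2 + 1 / 4 * truncation f (Q *ᵥ f) u := by
        have := ht0 u
        positivity
      simp only [map_sub, map_add, map_mul, map_pow, aeval_C, aeval_X, aeval_projPoly, planted,
        Real.sq_sqrt h0, Algebra.algebraMap_self_apply, sub_self]

end ASVP

namespace ASVP

open MeasureTheory ProbabilityTheory

/-! ### Rounding by Gaussian functions -/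

/-- A constant `K` for which `E X ^ 8 ≤ K (E X ^ 2) ^ 4` for all Gaussian `X`. -/
noncomputable def gaussConst : ℝ := 128 * (1 + ∫ x, x ^ 8 ∂gaussianReal 0 1)

theorem one_le_gaussConst : 1 ≤ gaussConst := by
  have : 0 ≤ ∫ x, x ^ 8 ∂gaussianReal 0 1 :=
    integral_nonneg fun x => (show Even 8 by decide).pow_nonneg x
  unfold gaussConst; linarith

theorem integrable_pow_gaussianReal (m : ℝ) (v : NNReal) (k : ℕ) :
    Integrable (fun x => x ^ k) (gaussianReal m v) := by
  have h : MemLp id k (gaussianReal m v) := memLp_id_gaussianReal' k (by simp)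
  refine h.integrable_norm_pow'.mono' (by fun_prop) (.of_forall fun x => ?_)
  simp

theorem integral_sq_gaussianReal (m : ℝ) (v : NNReal) :
    ∫ x, x ^ 2 ∂gaussianReal m v = m ^ 2 + v := by
  have h := variance_eq_sub (memLp_id_gaussianReal' (μ := m) (v := v) 2 (by simp))
  rw [variance_id_gaussianReal] at h
  simp only [id_eq, integral_id_gaussianReal, Pi.pow_apply] at h
  linarith

theorem integral_pow_four_gaussianReal_ge (m : ℝ) (v : NNReal) :
    (m ^ 2 + v) ^ 2 ≤ ∫ x, x ^ 4 ∂gaussianReal m v := by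
  have h : 0 ≤ ∫ x, (x ^ 2 - (m ^ 2 + v)) ^ 2 ∂gaussianReal m v :=
    integral_nonneg fun x => sq_nonneg _
  have e : ∀ x : ℝ, (x ^ 2 - (m ^ 2 + v)) ^ 2
      = x ^ 4 - 2 * (m ^ 2 + v) * x ^ 2 + (m ^ 2 + v) ^ 2 := fun x => by ring
  simp only [e] at h
  rw [integral_add, integral_sub, integral_const_mul, integral_sq_gaussianReal] at h
  · simp only [integral_const, probReal_univ, one_smul] at h
    linarith
  · exact integrable_pow_gaussianReal m v 4
  · exact (integrable_pow_gaussianReal m v 2).const_mul _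
  · exact (integrable_pow_gaussianReal m v 4).sub ((integrable_pow_gaussianReal m v 2).const_mul _)
  · exact integrable_const _

theorem integral_pow_eight_gaussianReal_le (m : ℝ) (v : NNReal) :
    ∫ x, x ^ 8 ∂gaussianReal m v ≤ gaussConst * (m ^ 2 + v) ^ 4 := by
  have hmap : gaussianReal m v = (gaussianReal 0 1).map fun x => √v * x + m := by
    have h1 := gaussianReal_map_const_mul (μ := 0) (v := 1) √v
    have h2 := gaussianReal_map_add_const (μ := √v * 0) (v := NNReal.mk (√v ^ 2) (sq_nonneg _) * 1) m
    rw [← h1, Measure.map_map (by fun_prop) (by fun_prop)] at h2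
    refine Eq.trans ?_ h2.symm
    congr 1
    · ring
    · ext; simp
  rw [hmap, integral_map (by fun_prop) (by fun_prop)]
  have hi := integrable_pow_gaussianReal 0 1 8
  set M := ∫ x, x ^ 8 ∂gaussianReal 0 1
  have h0 : 0 ≤ M := integral_nonneg fun x => (show Even 8 by decide).pow_nonneg x
  have hp : ∀ x : ℝ, (√v * x + m) ^ 8 ≤ 128 * (v ^ 4 * x ^ 8 + m ^ 8) := fun x => by
    have h2 : ∀ s t : ℝ, (s + t) ^ 2 ≤ 2 * (s ^ 2 + t ^ 2) := fun s t => by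
      nlinarith [sq_nonneg (s - t)]
    have e1 : ((√v * x + m) ^ 2) ^ 2 ≤ (2 * ((√v * x) ^ 2 + m ^ 2)) ^ 2 :=
      pow_le_pow_left₀ (sq_nonneg _) (h2 _ _) 2
    have e2 := h2 ((√v * x) ^ 2) (m ^ 2)
    have e3 : ((√v * x + m) ^ 2) ^ 2 ≤ 8 * ((√v * x) ^ 4 + m ^ 4) := by nlinarith
    have e4 : (((√v * x + m) ^ 2) ^ 2) ^ 2 ≤ (8 * ((√v * x) ^ 4 + m ^ 4)) ^ 2 :=
      pow_le_pow_left₀ (sq_nonneg _) e3 2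
    have e5 := h2 ((√v * x) ^ 4) (m ^ 4)
    have e6 : √(v : ℝ) ^ 8 = v ^ 4 := by
      rw [show √(v : ℝ) ^ 8 = (√(v : ℝ) ^ 2) ^ 4 by ring, Real.sq_sqrt (NNReal.coe_nonneg v)]
    calc (√v * x + m) ^ 8 = (((√v * x + m) ^ 2) ^ 2) ^ 2 := by ring
      _ ≤ 128 * ((√v * x) ^ 8 + m ^ 8) := by nlinarith
      _ = _ := by rw [mul_pow, e6]
  have h1 : ∫ x, (√v * x + m) ^ 8 ∂gaussianReal 0 1
      ≤ ∫ x, 128 * (v ^ 4 * x ^ 8 + m ^ 8) ∂gaussianReal 0 1 := by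
    refine integral_mono_of_nonneg (.of_forall fun x => (show Even 8 by decide).pow_nonneg _)
      (((hi.const_mul _).add (integrable_const _)).const_mul _) (.of_forall hp)
  refine h1.trans ?_
  rw [integral_const_mul, integral_add (hi.const_mul _) (integrable_const _), integral_const_mul]
  simp only [integral_const, probReal_univ, one_smul]
  have hv : (0 : ℝ) ≤ v := v.2
  have hm : 0 ≤ m ^ 2 := sq_nonneg m
  have h3 : (v : ℝ) ^ 4 ≤ (m ^ 2 + v) ^ 4 := pow_le_pow_left₀ hv (by linarith) 4
  have h4 : m ^ 8 ≤ (m ^ 2 + v) ^ 4 := by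
    rw [show m ^ 8 = (m ^ 2) ^ 4 by ring]
    exact pow_le_pow_left₀ hm (by linarith) 4
  have : (v : ℝ) ^ 4 * M ≤ (m ^ 2 + v) ^ 4 * M := mul_le_mul_of_nonneg_right h3 h0
  change 128 * ((v : ℝ) ^ 4 * M + m ^ 8) ≤ 128 * (1 + M) * (m ^ 2 + v) ^ 4
  linarith

section rounding

variable {Ω : Type*} [MeasurableSpace Ω] {P : Measure Ω} {n : ℕ}
  {X : Fin n → Ω → ℝ} {m : Fin n → ℝ} {v : Fin n → NNReal}

theorem integrable_pow_of_hasLaw {X : Ω → ℝ} {m : ℝ} {v : NNReal}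
    (h : HasLaw X (gaussianReal m v) P) (k : ℕ) : Integrable (fun t => X t ^ k) P := by
  have := integrable_pow_gaussianReal m v k
  rw [← h.map_eq] at this
  exact this.comp_aemeasurable h.aemeasurable

theorem integral_pow_of_hasLaw {X : Ω → ℝ} {m : ℝ} {v : NNReal}
    (h : HasLaw X (gaussianReal m v) P) (k : ℕ) :
    ∫ t, X t ^ k ∂P = ∫ x, x ^ k ∂gaussianReal m v := by
  rw [← h.map_eq, integral_map h.aemeasurable (by fun_prop)]

/-- A family of Gaussian variables, not assumed independent. With constant probability the sum of
fourth powers is large and the sum of squares is not, compared with the second moments. -/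
theorem gaussian_fourth_moment [IsProbabilityMeasure P] (hX : ∀ u, Measurable (X u))
    (h : ∀ u, HasLaw (X u) (gaussianReal (m u) (v u)) P)
    (he : 0 < ∑ u, (m u ^ 2 + v u) ^ 2) :
    1 / (8 * gaussConst) ≤ P.real {t | (∑ u, (m u ^ 2 + v u) ^ 2) / 4 ≤ ∑ u, X u t ^ 4 ∧
      ∑ u, X u t ^ 2 ≤ 8 * gaussConst * ∑ u, (m u ^ 2 + v u)} := by
  set K := gaussConst
  have hK : 1 ≤ K := one_le_gaussConst
  set r : Fin n → ℝ := fun u => m u ^ 2 + v u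
  have hr : ∀ u, 0 ≤ r u := fun u => add_nonneg (sq_nonneg _) (v u).2
  set e := ∑ u, r u ^ 2
  set y := ∑ u, r u
  have hy : 0 < y := by
    refine (Finset.sum_nonneg fun u _ => hr u).lt_of_ne' fun h0 => he.ne' ?_
    rw [Finset.sum_eq_zero_iff_of_nonneg fun u _ => hr u] at h0
    exact Finset.sum_eq_zero fun u hu => by
      change r u ^ 2 = 0
      rw [h0 u hu, zero_pow two_ne_zero]
  set Z : Ω → ℝ := fun t => ∑ u, X u t ^ 4
  set Y : Ω → ℝ := fun t => ∑ u, X u t ^ 2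
  have hZm : Measurable Z := Finset.measurable_fun_sum _ fun u _ => (hX u).pow_const 4
  have hYm : Measurable Y := Finset.measurable_fun_sum _ fun u _ => (hX u).pow_const 2
  have hZ0 : ∀ t, 0 ≤ Z t := fun t =>
    Finset.sum_nonneg fun u _ => (show Even 4 by decide).pow_nonneg _
  have hY0 : ∀ t, 0 ≤ Y t := fun t => Finset.sum_nonneg fun u _ => sq_nonneg _
  have hZi : Integrable Z P := integrable_finsetSum _ fun u _ => integrable_pow_of_hasLaw (h u) 4
  have hYi : Integrable Y P := integrable_finsetSum _ fun u _ => integrable_pow_of_hasLaw (h u) 2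
  have hEZ : e ≤ ∫ t, Z t ∂P := by
    rw [integral_finsetSum _ fun u _ => integrable_pow_of_hasLaw (h u) 4]
    refine Finset.sum_le_sum fun u _ => ?_
    rw [integral_pow_of_hasLaw (h u)]
    exact integral_pow_four_gaussianReal_ge _ _
  have hEY : ∫ t, Y t ∂P = y := by
    rw [integral_finsetSum _ fun u _ => integrable_pow_of_hasLaw (h u) 2]
    refine Finset.sum_congr rfl fun u _ => ?_
    rw [integral_pow_of_hasLaw (h u), integral_sq_gaussianReal]
  have h8 : ∀ u, ∫ t, X u t ^ 8 ∂P ≤ K * r u ^ 4 := fun u => by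
    rw [integral_pow_of_hasLaw (h u)]; exact integral_pow_eight_gaussianReal_le _ _
  -- the square of `Z` is dominated by eighth powers, weighted by second moments
  set D : Ω → ℝ := fun t => e * ∑ u, X u t ^ 8 / r u ^ 2
  have hDi : Integrable D P := (integrable_finsetSum _ fun u _ =>
    (integrable_pow_of_hasLaw (h u) 8).div_const _).const_mul _
  have hZD : ∀ᵐ t ∂P, Z t ^ 2 ≤ D t := by
    have hz : ∀ u, ∀ᵐ t ∂P, r u = 0 → X u t = 0 := fun u => by
      by_cases h0 : r u = 0
      · have e1 : ∫ t, X u t ^ 8 ∂P = 0 := by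
          refine le_antisymm ((h8 u).trans_eq (by rw [h0]; ring))
            (integral_nonneg fun t => (show Even 8 by decide).pow_nonneg _)
        rw [integral_eq_zero_iff_of_nonneg
          (fun t => (show Even 8 by decide).pow_nonneg _) (integrable_pow_of_hasLaw (h u) 8)] at e1
        filter_upwards [e1] with t ht _
        exact pow_eq_zero_iff (by norm_num) |>.1 ht
      · exact .of_forall fun t h1 => absurd h1 h0
    filter_upwards [ae_all_iff.2 hz] with t ht
    have := Finset.sum_mul_sq_le_sq_mul_sq Finset.univ r fun u => X u t ^ 4 / r u
    have e1 : ∀ u, r u * (X u t ^ 4 / r u) = X u t ^ 4 := fun u => by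
      by_cases h0 : r u = 0
      · rw [h0, ht u h0]; norm_num
      · field_simp
    simp only [e1, div_pow, ← pow_mul] at this
    exact this
  have hED : ∫ t, D t ∂P ≤ K * e ^ 2 := by
    rw [integral_const_mul, integral_finsetSum _ fun u _ =>
      (integrable_pow_of_hasLaw (h u) 8).div_const _]
    have : ∑ u, ∫ t, X u t ^ 8 / r u ^ 2 ∂P ≤ ∑ u, K * r u ^ 2 := by
      refine Finset.sum_le_sum fun u _ => ?_
      rw [integral_div]
      rcases (hr u).eq_or_lt with h0 | h0
      · rw [← h0]; norm_num
      · rw [div_le_iff₀ (by positivity)]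
        exact (h8 u).trans_eq (by ring)
    rw [← Finset.mul_sum] at this
    calc _ ≤ e * (K * e) := mul_le_mul_of_nonneg_left this he.le
      _ = _ := by ring
  set S : Set Ω := {t | e / 4 ≤ Z t ∧ Y t ≤ 8 * K * y}
  have hS : MeasurableSet S :=
    (measurableSet_le measurable_const hZm).inter (measurableSet_le hYm measurable_const)
  set θ : ℝ := 1 / (4 * K * e)
  have hθ : 0 < θ := by positivity
  have hpt : ∀ᵐ t ∂P, Z t ≤ e / 4 + θ * D t + S.indicator (fun _ => 1 / (4 * θ)) t
      + 1 / (4 * θ) * (Y t / (8 * K * y)) := by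
    filter_upwards [hZD] with t ht
    have hD0 : 0 ≤ D t := (sq_nonneg _).trans ht
    have hr1 : 0 ≤ 1 / (4 * θ) * (Y t / (8 * K * y)) := by have := hY0 t; positivity
    have hr2 : 0 ≤ S.indicator (fun _ => 1 / (4 * θ)) t :=
      Set.indicator_nonneg (fun _ _ => by positivity) t
    have hr3 : 0 ≤ θ * D t := by positivity
    have hamgm : Z t ≤ θ * D t + 1 / (4 * θ) := by
      have h1 : Z t ≤ θ * Z t ^ 2 + 1 / (4 * θ) := by
        have : 0 ≤ (2 * θ * Z t - 1) ^ 2 / (4 * θ) := by positivity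
        have e2 : (2 * θ * Z t - 1) ^ 2 / (4 * θ) = θ * Z t ^ 2 - Z t + 1 / (4 * θ) := by
          field_simp; ring
        linarith
      exact h1.trans (by gcongr)
    by_cases h1 : Z t < e / 4
    · linarith
    · by_cases h2 : Y t ≤ 8 * K * y
      · rw [Set.indicator_of_mem (show t ∈ S from ⟨not_lt.1 h1, h2⟩)]
        linarith
      · have : 1 ≤ Y t / (8 * K * y) := by
          rw [le_div_iff₀ (by positivity)]; linarith
        have h3 : 1 / (4 * θ) ≤ 1 / (4 * θ) * (Y t / (8 * K * y)) :=
          le_mul_of_one_le_right (by positivity) this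
        linarith
  have hint := integral_mono_ae hZi ((((integrable_const _).add (hDi.const_mul θ)).add
    ((integrable_const _).indicator hS)).add ((hYi.div_const _).const_mul _)) hpt
  simp only [Pi.add_apply] at hint
  have hY' : ∫ t, 1 / (4 * θ) * (Y t / (8 * K * y)) ∂P = 1 / (4 * θ) * (y / (8 * K * y)) := by
    rw [integral_const_mul, integral_div, hEY]
  have hD' : ∫ t, θ * D t ∂P = θ * ∫ t, D t ∂P := integral_const_mul _ _
  rw [integral_add, integral_add, integral_add, hD', hY',
    integral_indicator_const _ hS] at hint
  · simp only [integral_const, probReal_univ, smul_eq_mul] at hint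
    have e1 : 1 / (4 * θ) = K * e := by simp only [θ]; field_simp
    have e2 : θ * (K * e ^ 2) = e / 4 := by simp only [θ]; field_simp
    have e3 : y / (8 * K * y) = 1 / (8 * K) := by field_simp
    have e4 : K * e * (1 / (8 * K)) = e / 8 := by field_simp
    rw [e1, e3, e4] at hint
    have e5 : θ * ∫ t, D t ∂P ≤ e / 4 := by rw [← e2]; gcongr
    have e6 : e * (1 / 8) ≤ e * (P.real S * K) := by linarith
    have e7 := le_of_mul_le_mul_left e6 he
    rw [div_le_iff₀ (by positivity)]
    linarith
  · exact integrable_const _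
  · exact hDi.const_mul θ
  · exact (integrable_const _).add (hDi.const_mul θ)
  · exact (integrable_const _).indicator hS
  · exact ((integrable_const _).add (hDi.const_mul θ)).add ((integrable_const _).indicator hS)
  · exact (hYi.div_const _).const_mul _

end rounding

end ASVP

namespace ASVP

open MvPolynomial Matrix MeasureTheory ProbabilityTheory

/-! ### Projections of Gaussian functions -/

theorem hasLaw_mulVec_multivariateGaussian {n : ℕ} (Q : Matrix (Fin n) (Fin n) ℝ)
    (m : EuclideanSpace ℝ (Fin n)) {S : Matrix (Fin n) (Fin n) ℝ} (hS : S.PosSemidef)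
    (u : Fin n) :
    HasLaw (fun t : EuclideanSpace ℝ (Fin n) => (Q *ᵥ t.ofLp) u)
      (gaussianReal ((Q *ᵥ m.ofLp) u) (Q.row u ⬝ᵥ S *ᵥ Q.row u).toNNReal)
      (multivariateGaussian m S) := by
  refine ⟨by simp only [mulVec, dotProduct]; fun_prop, ?_⟩
  set x : EuclideanSpace ℝ (Fin n) := WithLp.toLp 2 (Q.row u)
  have e : (fun t : EuclideanSpace ℝ (Fin n) => (Q *ᵥ t.ofLp) u) = innerSL ℝ x := by
    ext t
    simp [x, mulVec, dotProduct, PiLp.inner_apply, mul_comm]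
  have hm : ∫ t, innerSL ℝ x t ∂multivariateGaussian m S = innerSL ℝ x m := by
    rw [ContinuousLinearMap.integral_comp_id_comm IsGaussian.integrable_id,
      integral_id_multivariateGaussian]
  rw [e, IsGaussian.map_eq_gaussianReal, hm]
  congr 1
  · exact (congrFun e m).symm
  · congr 1
    have h := covarianceBilin_multivariateGaussian (μ := m) hS x x
    rw [covarianceBilin_apply_eq_cov IsGaussian.memLp_two_id, covariance_self] at h
    · exact h
    · fun_prop

theorem map_stdGaussianFun (n : ℕ) :
    (stdGaussianFun n).map (WithLp.toLp 2)
      = multivariateGaussian 0 ((n : ℝ) • (1 : Matrix (Fin n) (Fin n) ℝ)) := by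
  have hS : ((n : ℝ) • (1 : Matrix (Fin n) (Fin n) ℝ)).PosSemidef :=
    Matrix.PosSemidef.one.smul (Nat.cast_nonneg n)
  unfold stdGaussianFun
  apply Measure.ext_of_charFun (E := EuclideanSpace ℝ (Fin n))
  ext t
  rw [charFun_multivariateGaussian hS, charFun_pi]
  simp only [charFun_gaussianReal, ← Complex.exp_sum]
  congr 1
  simp [Matrix.smul_mulVec, dotProduct, Finset.sum_div, sq, mul_left_comm]

section goodness

variable {Ω : Type*} [MeasurableSpace Ω] {P : Measure Ω} [IsProbabilityMeasure P] {n : ℕ}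
  {Q : Matrix (Fin n) (Fin n) ℝ} {T : Ω → Fin n → ℝ} {m : Fin n → ℝ} {v : Fin n → NNReal}

/-- If the second moments of a projected Gaussian function are not flat, then it is good with
constant probability. -/
theorem gaussian_isGood (hT : ∀ u, Measurable fun t => (Q *ᵥ T t) u)
    (h : ∀ u, HasLaw (fun t => (Q *ᵥ T t) u) (gaussianReal (m u) (v u)) P) {C μ : ℝ}
    (hC : 0 ≤ C) (hμ : 0 ≤ μ)
    (hr : C * level μ Q * (∑ u, (m u ^ 2 + v u)) ^ 2 < ∑ u, (m u ^ 2 + v u) ^ 2) :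
    1 / (8 * gaussConst) ≤ P.real {t | IsGood (C / (256 * gaussConst ^ 2)) μ Q (Q *ᵥ T t)} := by
  have hl := level_nonneg hμ Q
  have hK := one_le_gaussConst
  have he : 0 < ∑ u, (m u ^ 2 + v u) ^ 2 := lt_of_le_of_lt (by positivity) hr
  refine (gaussian_fourth_moment hT h he).trans (measureReal_mono ?_ (measure_ne_top _ _))
  rintro t ⟨h1, h2⟩
  refine isGood_iff.2 ⟨fun h0 => ?_, ⟨_, rfl⟩, ?_⟩
  · have : ∑ u, (Q *ᵥ T t) u ^ 4 = 0 := Finset.sum_eq_zero fun u _ => by simp [h0]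
    linarith
  · have h0 : 0 ≤ ∑ u, (Q *ᵥ T t) u ^ 2 := Finset.sum_nonneg fun _ _ => sq_nonneg _
    have h3 := pow_le_pow_left₀ h0 h2 2
    have h4 : C / (256 * gaussConst ^ 2) * level μ Q * (∑ u, (Q *ᵥ T t) u ^ 2) ^ 2
        ≤ C / (256 * gaussConst ^ 2) * level μ Q
          * (8 * gaussConst * ∑ u, (m u ^ 2 + v u)) ^ 2 := by gcongr
    have h5 : C / (256 * gaussConst ^ 2) * level μ Q
          * (8 * gaussConst * ∑ u, (m u ^ 2 + v u)) ^ 2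
        = C * level μ Q * (∑ u, (m u ^ 2 + v u)) ^ 2 / 4 := by field_simp; ring
    linarith

end goodness

theorem sum_sq_diag_le_of_not_isGood {n : ℕ} {Q : Matrix (Fin n) (Fin n) ℝ}
    (hQ : IsProjector n Q) {C μ : ℝ} (hC : 0 ≤ C) (hμ : 0 ≤ μ)
    (h : ¬ 1 / (8 * gaussConst) ≤
      (stdGaussianFun n).real {t | IsGood (C / (256 * gaussConst ^ 2)) μ Q (Q *ᵥ t)}) :
    ∑ u, Q u u ^ 2 ≤ C * level μ Q * (∑ u, Q u u) ^ 2 := by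
  by_contra hc
  push Not at hc
  have hS : ((n : ℝ) • (1 : Matrix (Fin n) (Fin n) ℝ)).PosSemidef :=
    Matrix.PosSemidef.one.smul (Nat.cast_nonneg n)
  have hn : 0 < (n : ℝ) := by
    rcases Nat.eq_zero_or_pos n with rfl | hn
    · simp at hc
    · exact_mod_cast hn
  have : IsProbabilityMeasure (stdGaussianFun n) := by unfold stdGaussianFun; infer_instance
  refine h (gaussian_isGood (T := id) (m := 0)
    (v := fun u => (Q.row u ⬝ᵥ ((n : ℝ) • (1 : Matrix (Fin n) (Fin n) ℝ)) *ᵥ Q.row u).toNNReal)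
    (fun u => ?_) (fun u => ?_) hC hμ ?_)
  · simp only [mulVec, dotProduct, id]; fun_prop
  · have h1 := hasLaw_mulVec_multivariateGaussian Q 0 hS u
    rw [← map_stdGaussianFun] at h1
    have h2 : HasLaw (WithLp.toLp 2) ((stdGaussianFun n).map (WithLp.toLp 2))
      (stdGaussianFun n) := ⟨by fun_prop, rfl⟩
    simpa [Function.comp_def] using h1.comp h2
  · have e : ∀ u, (((Q.row u ⬝ᵥ ((n : ℝ) • (1 : Matrix (Fin n) (Fin n) ℝ)) *ᵥ Q.row u).toNNReal : NNReal)
        : ℝ) = n * Q u u := fun u => by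
      have e1 : Q.row u ⬝ᵥ ((n : ℝ) • (1 : Matrix (Fin n) (Fin n) ℝ)) *ᵥ Q.row u = n * Q u u := by
        rw [Matrix.smul_mulVec, Matrix.one_mulVec, dotProduct_smul, smul_eq_mul, ← hQ.sum_sq u]
        simp only [dotProduct, sq, Matrix.row_apply]
      rw [e1, Real.coe_toNNReal _ (mul_nonneg hn.le (hQ.diag_nonneg u))]
    simp only [e, Pi.zero_apply, zero_pow two_ne_zero, zero_add, mul_pow, ← Finset.mul_sum]
    have : 0 < (n : ℝ) ^ 2 := by positivity
    nlinarith

/-! ### Calculus of pseudoexpectations -/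

section pseudo

variable {σ : Type} {l : ℕ} {L : MvPolynomial σ ℝ →ₗ[ℝ] ℝ} {p q : MvPolynomial σ ℝ}

theorem IsPseudoExpectation.mul_eq_zero (hL : IsPseudoExpectation l L)
    (hp : 2 * p.totalDegree ≤ l) (hq : 2 * q.totalDegree ≤ l) (h : L (p ^ 2) = 0) :
    L (p * q) = 0 := by
  have key : ∀ s : ℝ, 0 ≤ L (q ^ 2) + 2 * s * L (p * q) := fun s => by
    have h1 := hL.2 (q + C s * p) (by
      have := totalDegree_add q (C s * p)
      have h2 : (C s * p).totalDegree ≤ p.totalDegree := totalDegree_C_mul_le s le_rfl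
      omega)
    have e : (q + C s * p) ^ 2 = q ^ 2 + (2 * s) • (p * q) + (s ^ 2) • p ^ 2 := by
      simp only [smul_eq_C_mul, map_mul, map_pow, map_ofNat]; ring
    rw [e, map_add, map_add, map_smul, map_smul, h] at h1
    simpa using h1
  by_contra h0
  have h1 := key (-(L (q ^ 2) + 1) / (2 * L (p * q)))
  have e : 2 * (-(L (q ^ 2) + 1) / (2 * L (p * q))) * L (p * q) = -(L (q ^ 2) + 1) := by
    field_simp
  linarith

theorem IsConsistent.mul_eq_zero (hL : IsPseudoExpectation l L) (hp : IsConsistent l L p)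
    (hq : 2 * q.totalDegree ≤ l) : L (p * q) = 0 :=
  hL.mul_eq_zero hp.1 hq hp.2

end pseudo

end ASVP

namespace ASVP

open MvPolynomial Matrix MeasureTheory ProbabilityTheory

/-! ### Rounding solutions of the relaxation -/

section solution

variable {n : ℕ} {Q : Matrix (Fin n) (Fin n) ℝ} {μ : ℝ} {L : MvPolynomial (Var n) ℝ →ₗ[ℝ] ℝ}

theorem IsFeasible.mul_eq_zero (hL : IsFeasible 40 (1 / 4) (1 / 256) (1 / 4) μ Q L)
    {p q : MvPolynomial (Var n) ℝ} (hp : Constraint (1 / 4) (1 / 256) (1 / 4) μ Q p)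
    (hq : q.totalDegree ≤ 20) : L (p * q) = 0 :=
  (hL.2 p hp).mul_eq_zero hL.1 (by omega)

theorem IsFeasible.sq_nonneg (hL : IsFeasible 40 (1 / 4) (1 / 256) (1 / 4) μ Q L)
    {p : MvPolynomial (Var n) ℝ} (hp : p.totalDegree ≤ 20) : 0 ≤ L (p ^ 2) :=
  hL.1.2 p (by omega)

theorem IsFeasible.pos (hμ : 0 < μ) (hL : IsFeasible 40 (1 / 4) (1 / 256) (1 / 4) μ Q L) :
    0 < (n : ℝ) := by
  rcases Nat.eq_zero_or_pos n with rfl | hn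
  · have h := hL.mul_eq_zero .measure (q := 1) (by simp)
    have e : (expectPoly (fun u => X (.val u)) - C μ : MvPolynomial (Var 0) ℝ) * 1
        = (-μ) • 1 := by simp [expectPoly, smul_eq_C_mul]
    rw [e, map_smul, hL.1.1] at h
    simp at h
    exact absurd h hμ.ne'
  · exact_mod_cast hn

theorem map_expectPoly_mul (hn : 0 < (n : ℝ)) (h : Fin n → MvPolynomial (Var n) ℝ)
    (q : MvPolynomial (Var n) ℝ) : (n : ℝ) * L (expectPoly h * q) = ∑ u, L (h u * q) := by
  rw [expectPoly, mul_assoc, ← smul_eq_C_mul, map_smul, Finset.sum_mul, map_sum, smul_eq_mul]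
  field_simp

theorem IsFeasible.sum_val_mul (hμ : 0 < μ)
    (hL : IsFeasible 40 (1 / 4) (1 / 256) (1 / 4) μ Q L)
    {q : MvPolynomial (Var n) ℝ} (hq : q.totalDegree ≤ 20) :
    ∑ u, L (X (.val u) * q) = n * μ * L q := by
  have h := hL.mul_eq_zero .measure hq
  rw [sub_mul, map_sub, ← smul_eq_C_mul, map_smul, sub_eq_zero] at h
  rw [← map_expectPoly_mul (hL.pos hμ), h, smul_eq_mul, mul_assoc]

theorem IsFeasible.val_sq_mul (hL : IsFeasible 40 (1 / 4) (1 / 256) (1 / 4) μ Q L)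
    {q : MvPolynomial (Var n) ℝ} (hq : q.totalDegree ≤ 20) (u : Fin n) :
    L (X (.val u) ^ 2 * q) = L (X (.val u) * q) := by
  have h := hL.mul_eq_zero (.boolean u) hq
  rwa [sub_mul, map_sub, sub_eq_zero] at h

theorem eval_projPoly (Q : Matrix (Fin n) (Fin n) ℝ) (x : Fin n → Var n) (y : Var n → ℝ)
    (u : Fin n) : eval y (projPoly Q x u) = (Q *ᵥ fun v => y (x v)) u := by
  simp [projPoly, mulVec, dotProduct]

/-- Under a solution of the relaxation, projecting does not increase the second moment. -/
theorem IsFeasible.sum_proj_sq_mul_le (hQ : IsProjector n Q) (hμ : 0 < μ)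
    (hL : IsFeasible 40 (1 / 4) (1 / 256) (1 / 4) μ Q L)
    {q : MvPolynomial (Var n) ℝ} (hq : q.totalDegree ≤ 10) :
    ∑ u, L (projPoly Q .val u ^ 2 * q ^ 2) ≤ n * μ * L (q ^ 2) := by
  have hq2 : (q ^ 2).totalDegree ≤ 20 := totalDegree_pow_le hq 2 (by norm_num)
  have e : ∑ u, projPoly Q .val u ^ 2
      = ∑ u, X (.val u) ^ 2 - ∑ u, (X (.val u) - projPoly Q .val u) ^ 2 := by
    refine MvPolynomial.funext fun y => ?_
    simp only [map_sub, map_sum, map_pow, eval_X, eval_projPoly]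
    have h1 := hQ.sum_sq_mulVec fun v => y (.val v)
    have h2 : ∀ u, (y (.val u) - (Q *ᵥ fun v => y (.val v)) u) ^ 2 = y (.val u) ^ 2
        - 2 * (y (.val u) * (Q *ᵥ fun v => y (.val v)) u)
        + (Q *ᵥ fun v => y (.val v)) u ^ 2 := fun u => by ring
    simp only [h2, Finset.sum_add_distrib, Finset.sum_sub_distrib, ← Finset.mul_sum]
    linarith
  have h1 : ∑ u, L (projPoly Q .val u ^ 2 * q ^ 2) = ∑ u, L (X (.val u) ^ 2 * q ^ 2)
      - ∑ u, L ((X (.val u) - projPoly Q .val u) ^ 2 * q ^ 2) := by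
    simp only [← map_sum, ← Finset.sum_mul]
    rw [e, sub_mul, map_sub]
  have h2 : 0 ≤ ∑ u, L ((X (.val u) - projPoly Q .val u) ^ 2 * q ^ 2) :=
    Finset.sum_nonneg fun u _ => by
      rw [← mul_pow]
      exact hL.sq_nonneg (totalDegree_mul_le (totalDegree_sub_le (totalDegree_X_le _ le_rfl)
        (totalDegree_projPoly_le _ _ _ le_rfl)) hq (by norm_num))
  rw [h1, Finset.sum_congr rfl fun u _ => hL.val_sq_mul hq2 u, hL.sum_val_mul hμ hq2]
  linarith

theorem IsFeasible.sum_proj_sq_mul_ge (hμ : 0 < μ)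
    (hL : IsFeasible 40 (1 / 4) (1 / 256) (1 / 4) μ Q L)
    {q : MvPolynomial (Var n) ℝ} (hq : q.totalDegree ≤ 10) :
    3 / 4 * (n * μ) * L (q ^ 2) ≤ ∑ u, L (projPoly Q .val u ^ 2 * q ^ 2) := by
  have hn := hL.pos hμ
  have h := hL.mul_eq_zero .normTwo (q := q ^ 2) (totalDegree_pow_le hq 2 (by norm_num))
  have h2 : 0 ≤ L (X .slackTwo ^ 2 * q ^ 2) := by
    rw [← mul_pow]
    exact hL.sq_nonneg (totalDegree_mul_le (totalDegree_X_le _ le_rfl) hq (by norm_num))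
  rw [sub_mul, sub_mul, map_sub, map_sub, ← smul_eq_C_mul, map_smul, smul_eq_mul] at h
  rw [← map_expectPoly_mul hn]
  have : 3 / 4 * (n * μ) * L (q ^ 2) = n * ((1 - 1 / 4) * μ * L (q ^ 2)) := by ring
  rw [this]
  gcongr
  linarith

theorem IsFeasible.sum_trunc_pow_four_ge (hμ : 0 < μ)
    (hL : IsFeasible 40 (1 / 4) (1 / 256) (1 / 4) μ Q L) :
    n * μ / 256 ≤ ∑ u, L (projPoly Q .trunc u ^ 4) := by
  have hn := hL.pos hμ
  have h := hL.mul_eq_zero .normFour (q := 1) (by simp)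
  have h2 : 0 ≤ L (X .slackFour ^ 2) := hL.sq_nonneg (totalDegree_X_le _ (by norm_num))
  have h3 := map_expectPoly_mul (L := L) hn (fun u => projPoly Q .trunc u ^ 4) 1
  simp only [mul_one] at h h3
  rw [map_sub, map_sub, show C (1 / 256 * μ) = (1 / 256 * μ) • (1 : MvPolynomial (Var n) ℝ) by
    rw [smul_eq_C_mul, mul_one], map_smul, hL.1.1, smul_eq_mul, mul_one] at h
  rw [← h3, show n * μ / 256 = n * (1 / 256 * μ) by ring]
  gcongr
  linarith

/-- The measure of a pseudo-distribution over nonzero Boolean functions is at least that of a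
point. -/
theorem IsFeasible.one_le (hμ : 0 < μ) (hL : IsFeasible 40 (1 / 4) (1 / 256) (1 / 4) μ Q L) :
    1 ≤ n * μ := by
  set x : Fin n → MvPolynomial (Var n) ℝ := fun u => X (Var.val u)
  have hX : ∀ u, (x u).totalDegree ≤ 1 := fun u => totalDegree_X_le _ le_rfl
  have hX' : ∀ u, (x u).totalDegree ≤ 20 := fun u => totalDegree_X_le _ (by norm_num)
  have hX2 : ∀ u, (x u ^ 2).totalDegree ≤ 20 := fun u =>
    totalDegree_pow_le (hX u) 2 (by norm_num)
  have hXX : ∀ u v, (x u * x v).totalDegree ≤ 20 := fun u v =>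
    totalDegree_mul_le (hX u) (hX v) (by norm_num)
  have hd1 : (1 : MvPolynomial (Var n) ℝ).totalDegree ≤ 20 := by simp
  have h1 : ∑ u, L (x u * 1) = n * μ * L 1 := hL.sum_val_mul hμ hd1
  simp only [mul_one, hL.1.1] at h1
  have h2 : ∀ v, L (x v) ≤ n * μ * L (x v) := fun v => by
    have h0 : ∑ u, L (x u * x v) = n * μ * L (x v) := hL.sum_val_mul hμ (hX' v)
    rw [← h0]
    have h3 : ∀ u, 0 ≤ L (x u * x v) := fun u => by
      have a1 : L (x u ^ 2 * x v) = L (x u * x v) := hL.val_sq_mul (hX' v) u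
      have a2 : L (x v ^ 2 * x u ^ 2) = L (x v * x u ^ 2) := hL.val_sq_mul (hX2 u) v
      have a3 := hL.sq_nonneg (hXX v u)
      rw [mul_pow, a2, mul_comm, a1] at a3
      exact a3
    have h4 : L (x v ^ 2 * 1) = L (x v * 1) := hL.val_sq_mul hd1 v
    simp only [mul_one] at h4
    rw [← h4, sq]
    exact Finset.single_le_sum (f := fun u => L (x u * x v))
      (fun u _ => h3 u) (Finset.mem_univ v)
  have h5 := Finset.sum_le_sum fun v (_ : v ∈ Finset.univ) => h2 v
  rw [← Finset.mul_sum, h1] at h5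
  have hk : 0 < n * μ := mul_pos (hL.pos hμ) hμ
  exact le_of_mul_le_mul_left (by linarith) hk

theorem IsFeasible.rank_pos (hQ : IsProjector n Q) (hμ : 0 < μ)
    (hL : IsFeasible 40 (1 / 4) (1 / 256) (1 / 4) μ Q L) : (1 : ℝ) ≤ Q.rank := by
  suffices h : Q.rank ≠ 0 by exact_mod_cast Nat.one_le_iff_ne_zero.2 h
  intro h0
  have h2 := hQ.apply_eq_zero_of_rank_eq_zero h0
  have h3 := hL.sum_proj_sq_mul_ge hμ (q := 1) (by simp)
  simp only [projPoly, h2, one_pow, mul_one, hL.1.1, map_zero, zero_mul, Finset.sum_const_zero,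
    zero_pow two_ne_zero] at h3
  have hk : 0 < n * μ := mul_pos (hL.pos hμ) hμ
  linarith

/-! #### The truncation under a pseudoexpectation -/

/-- The slack constraint of one sign: `(Q f) u ^ 2 ± t u / 4`, which is a square under every
solution of the relaxation. -/
noncomputable def slackPoly (Q : Matrix (Fin n) (Fin n) ℝ) (s : Bool) (u : Fin n) :
    MvPolynomial (Var n) ℝ :=
  if s then projPoly Q .val u ^ 2 + C (1 / 4) * X (.trunc u)
  else projPoly Q .val u ^ 2 - C (1 / 4) * X (.trunc u)

/-- The variable whose square is `slackPoly`. -/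
noncomputable def slackVar (s : Bool) (u : Fin n) : MvPolynomial (Var n) ℝ :=
  if s then X (.slackNeg u) else X (.slackPos u)

theorem totalDegree_slackPoly_le (s : Bool) (u : Fin n) : (slackPoly Q s u).totalDegree ≤ 2 := by
  have h1 : (projPoly Q .val u ^ 2).totalDegree ≤ 2 :=
    totalDegree_pow_le (totalDegree_projPoly_le _ _ _ le_rfl) 2 le_rfl
  have h2 : (C (1 / 4) * X (.trunc u) : MvPolynomial (Var n) ℝ).totalDegree ≤ 2 :=
    totalDegree_C_mul_le _ (totalDegree_X_le _ (by norm_num))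
  unfold slackPoly
  split_ifs
  exacts [totalDegree_add_le h1 h2, totalDegree_sub_le h1 h2]

theorem totalDegree_slackVar_le (s : Bool) (u : Fin n) :
    (slackVar s u : MvPolynomial (Var n) ℝ).totalDegree ≤ 1 := by
  unfold slackVar; split_ifs <;> exact totalDegree_X_le _ le_rfl

theorem IsFeasible.slackPoly_mul (hL : IsFeasible 40 (1 / 4) (1 / 256) (1 / 4) μ Q L)
    {q : MvPolynomial (Var n) ℝ} (hq : q.totalDegree ≤ 20) (s : Bool) (u : Fin n) :
    L (slackPoly Q s u * q) = L (slackVar s u ^ 2 * q) := by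
  rw [← sub_eq_zero, ← map_sub, ← sub_mul]
  cases s
  · exact hL.mul_eq_zero (.truncPos u) hq
  · exact hL.mul_eq_zero (.truncNeg u) hq

theorem IsFeasible.prod_slackPoly_nonneg (hL : IsFeasible 40 (1 / 4) (1 / 256) (1 / 4) μ Q L)
    (s : Fin 4 → Bool) (ω : Fin 4 → Fin n) : 0 ≤ L (∏ j, slackPoly Q (s j) (ω j)) := by
  have hp := fun j => totalDegree_slackPoly_le (Q := Q) (s j) (ω j)
  have hv : ∀ j, (slackVar (s j) (ω j) ^ 2 : MvPolynomial (Var n) ℝ).totalDegree ≤ 2 :=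
    fun j => totalDegree_pow_le (totalDegree_slackVar_le (s j) (ω j)) 2 (by norm_num)
  set p := fun j => slackPoly Q (s j) (ω j)
  set v : Fin 4 → MvPolynomial (Var n) ℝ := fun j => slackVar (s j) (ω j)
  have step : ∀ (j : Fin 4) (q : MvPolynomial (Var n) ℝ), q.totalDegree ≤ 20 →
      L (p j * q) = L (v j ^ 2 * q) := fun j q hq => hL.slackPoly_mul hq _ _
  have d3 : ∀ {a b c : MvPolynomial (Var n) ℝ}, a.totalDegree ≤ 2 → b.totalDegree ≤ 2 →
      c.totalDegree ≤ 2 → (a * (b * c)).totalDegree ≤ 20 := fun ha hb hc =>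
    totalDegree_mul_le ha (totalDegree_mul_le hb hc le_rfl) (by norm_num)
  have e : L (p 0 * (p 1 * (p 2 * p 3))) = L ((v 0 * v 1 * v 2 * v 3) ^ 2) := by
    rw [step 0 _ (d3 (hp 1) (hp 2) (hp 3)),
      show v 0 ^ 2 * (p 1 * (p 2 * p 3)) = p 1 * (p 2 * (p 3 * v 0 ^ 2)) by ring,
      step 1 _ (d3 (hp 2) (hp 3) (hv 0)),
      show v 1 ^ 2 * (p 2 * (p 3 * v 0 ^ 2)) = p 2 * (p 3 * (v 0 ^ 2 * v 1 ^ 2)) by ring,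
      step 2 _ (d3 (hp 3) (hv 0) (hv 1)),
      show v 2 ^ 2 * (p 3 * (v 0 ^ 2 * v 1 ^ 2)) = p 3 * (v 0 ^ 2 * (v 1 ^ 2 * v 2 ^ 2)) by ring,
      step 3 _ (d3 (hv 0) (hv 1) (hv 2))]
    congr 1; ring
  rw [Fin.prod_univ_four, mul_assoc, mul_assoc, e]
  have d := fun j => totalDegree_slackVar_le (n := n) (s j) (ω j)
  exact hL.sq_nonneg (totalDegree_mul_le (totalDegree_mul_le (totalDegree_mul_le (d 0) (d 1) le_rfl)
    (d 2) le_rfl) (d 3) (by norm_num))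

/-- The truncation is dominated by the square of the projection, also for products at four
points: with `p = F ^ 2 - t / 4` and `q = F ^ 2 + t / 4`, both
`∏ F ^ 2 ± ∏ (t / 4)` are nonnegative combinations of products of the `p` and `q`. -/
theorem IsFeasible.abs_prod_trunc_le (hL : IsFeasible 40 (1 / 4) (1 / 256) (1 / 4) μ Q L)
    (ω : Fin 4 → Fin n) :
    |L (∏ j, X (.trunc (ω j)))| ≤ 256 * L (weight Q ω) := by
  have h := fun a b c d => hL.prod_slackPoly_nonneg ![a, b, c, d] ω
  simp only [Fin.prod_univ_four, Matrix.cons_val_zero, Matrix.cons_val_one, Matrix.cons_val,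
    slackPoly] at h
  have e1 : ∀ x y : MvPolynomial (Var n) ℝ, L (x + y) = L x + L y := map_add L
  have hw : weight Q ω = projPoly Q .val (ω 0) ^ 2 * projPoly Q .val (ω 1) ^ 2
    * projPoly Q .val (ω 2) ^ 2 * projPoly Q .val (ω 3) ^ 2 := Fin.prod_univ_four _
  rw [hw, Fin.prod_univ_four]
  set x0 := projPoly Q .val (ω 0) ^ 2
  set x1 := projPoly Q .val (ω 1) ^ 2
  set x2 := projPoly Q .val (ω 2) ^ 2
  set x3 := projPoly Q .val (ω 3) ^ 2
  set t0 : MvPolynomial (Var n) ℝ := X (.trunc (ω 0))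
  set t1 : MvPolynomial (Var n) ℝ := X (.trunc (ω 1))
  set t2 : MvPolynomial (Var n) ℝ := X (.trunc (ω 2))
  set t3 : MvPolynomial (Var n) ℝ := X (.trunc (ω 3))
  set c : MvPolynomial (Var n) ℝ := C (1 / 4) with hc
  have hc4 : c ^ 4 = C (1 / 256) := by rw [hc, ← map_pow]; norm_num
  have ht : L (c ^ 4 * (t0 * t1 * t2 * t3)) = 1 / 256 * L (t0 * t1 * t2 * t3) := by
    rw [hc4, ← smul_eq_C_mul, map_smul, smul_eq_mul]
  have hpos : 0 ≤ L (x0 * x1 * x2 * x3) + L (c ^ 4 * (t0 * t1 * t2 * t3)) := by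
    have e : (8 : ℝ) • (x0 * x1 * x2 * x3 + c ^ 4 * (t0 * t1 * t2 * t3))
      = (x0 + c * t0) * (x1 + c * t1) * (x2 + c * t2) * (x3 + c * t3)
      + (x0 - c * t0) * (x1 - c * t1) * (x2 - c * t2) * (x3 - c * t3)
      + (x0 - c * t0) * (x1 - c * t1) * (x2 + c * t2) * (x3 + c * t3)
      + (x0 - c * t0) * (x1 + c * t1) * (x2 - c * t2) * (x3 + c * t3)
      + (x0 - c * t0) * (x1 + c * t1) * (x2 + c * t2) * (x3 - c * t3)
      + (x0 + c * t0) * (x1 - c * t1) * (x2 - c * t2) * (x3 + c * t3)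
      + (x0 + c * t0) * (x1 - c * t1) * (x2 + c * t2) * (x3 - c * t3)
      + (x0 + c * t0) * (x1 + c * t1) * (x2 - c * t2) * (x3 - c * t3) := by
      rw [smul_eq_C_mul, map_ofNat]; ring
    have e2 := congrArg L e
    rw [map_smul, smul_eq_mul] at e2
    simp only [e1] at e2
    have g1 := h true true true true
    have g2 := h false false false false
    have g3 := h false false true true
    have g4 := h false true false true
    have g5 := h false true true false
    have g6 := h true false false true
    have g7 := h true false true false
    have g8 := h true true false false
    simp only [if_true, Bool.false_eq_true, if_false] at g1 g2 g3 g4 g5 g6 g7 g8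
    linarith
  have hneg : 0 ≤ L (x0 * x1 * x2 * x3) - L (c ^ 4 * (t0 * t1 * t2 * t3)) := by
    have e : (8 : ℝ) • (x0 * x1 * x2 * x3 - c ^ 4 * (t0 * t1 * t2 * t3))
      = (x0 - c * t0) * (x1 + c * t1) * (x2 + c * t2) * (x3 + c * t3)
      + (x0 + c * t0) * (x1 - c * t1) * (x2 + c * t2) * (x3 + c * t3)
      + (x0 + c * t0) * (x1 + c * t1) * (x2 - c * t2) * (x3 + c * t3)
      + (x0 + c * t0) * (x1 + c * t1) * (x2 + c * t2) * (x3 - c * t3)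
      + (x0 + c * t0) * (x1 - c * t1) * (x2 - c * t2) * (x3 - c * t3)
      + (x0 - c * t0) * (x1 + c * t1) * (x2 - c * t2) * (x3 - c * t3)
      + (x0 - c * t0) * (x1 - c * t1) * (x2 + c * t2) * (x3 - c * t3)
      + (x0 - c * t0) * (x1 - c * t1) * (x2 - c * t2) * (x3 + c * t3) := by
      rw [smul_eq_C_mul, map_ofNat]; ring
    have e2 := congrArg L e
    rw [map_smul, smul_eq_mul, map_sub] at e2
    simp only [e1] at e2
    have g1 := h false true true true
    have g2 := h true false true true
    have g3 := h true true false true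
    have g4 := h true true true false
    have g5 := h true false false false
    have g6 := h false true false false
    have g7 := h false false true false
    have g8 := h false false false true
    simp only [if_true, Bool.false_eq_true, if_false] at g1 g2 g3 g4 g5 g6 g7 g8
    linarith
  rw [ht] at hpos hneg
  rw [abs_le]
  constructor <;> linarith

theorem IsFeasible.sum_weight_mul_quad_ge (hμ : 0 < μ)
    (hL : IsFeasible 40 (1 / 4) (1 / 256) (1 / 4) μ Q L) :
    n * μ / 4 ^ 8 ≤ ∑ ω, L (weight Q ω) * |quad Q ω| := by
  have h1 := hL.sum_trunc_pow_four_ge hμ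
  have e : ∑ u, projPoly Q .trunc u ^ 4
      = ∑ ω, C (quad Q ω) * ∏ j, X (.trunc (ω j)) := by
    refine MvPolynomial.funext fun y => ?_
    simp only [map_sum, map_pow, eval_projPoly, map_mul, map_prod, eval_X, eval_C]
    exact (sum_quad_mul Q _).symm
  rw [← map_sum, e, map_sum] at h1
  have h2 : ∑ ω, L (C (quad Q ω) * ∏ j, X (.trunc (ω j)))
      ≤ ∑ ω, 256 * (L (weight Q ω) * |quad Q ω|) := by
    refine Finset.sum_le_sum fun ω _ => ?_
    rw [← smul_eq_C_mul, map_smul, smul_eq_mul]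
    calc _ ≤ |quad Q ω * L (∏ j, X (.trunc (ω j)))| := le_abs_self _
      _ = |quad Q ω| * |L (∏ j, X (.trunc (ω j)))| := abs_mul _ _
      _ ≤ |quad Q ω| * (256 * L (weight Q ω)) := by
          gcongr; exact hL.abs_prod_trunc_le ω
      _ = _ := by ring
  rw [← Finset.mul_sum] at h2
  linarith

end solution

end ASVP

namespace ASVP

open MvPolynomial Matrix MeasureTheory ProbabilityTheory

/-! ### Reweighting at four points -/

section reweighting

variable {n : ℕ} {Q : Matrix (Fin n) (Fin n) ℝ} {μ : ℝ} {L : MvPolynomial (Var n) ℝ →ₗ[ℝ] ℝ}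

theorem weight_eq_sq (Q : Matrix (Fin n) (Fin n) ℝ) (ω : Fin 4 → Fin n) :
    weight Q ω = (∏ j, projPoly Q .val (ω j)) ^ 2 := Finset.prod_pow _ _ _

theorem totalDegree_prod_projPoly_le (Q : Matrix (Fin n) (Fin n) ℝ) (ω : Fin 4 → Fin n) :
    (∏ j, projPoly Q .val (ω j)).totalDegree ≤ 4 :=
  totalDegree_prod_le (fun _ => totalDegree_projPoly_le _ _ _ le_rfl) (by norm_num)

/-- The linear form with coefficients `x` in the values of the function. -/
noncomputable def linPoly (x : Fin n → ℝ) : MvPolynomial (Var n) ℝ :=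
  ∑ v, C (x v) * X (Var.val v)

/-- The covariance matrix of the reweighted pseudoexpectation. -/
noncomputable def covMatrix (L : MvPolynomial (Var n) ℝ →ₗ[ℝ] ℝ) (w : MvPolynomial (Var n) ℝ) :
    Matrix (Fin n) (Fin n) ℝ :=
  Matrix.of fun u v => reweighted L w (X (.val u) * X (.val v)) -
      reweighted L w (X (.val u)) * reweighted L w (X (.val v))

theorem sum_mul_reweighted (L : MvPolynomial (Var n) ℝ →ₗ[ℝ] ℝ) (w : MvPolynomial (Var n) ℝ)
    (x : Fin n → ℝ) :
    ∑ u, x u * reweighted L w (X (.val u)) = reweighted L w (linPoly x) := by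
  simp only [reweighted, linPoly, Finset.mul_sum, map_sum, Finset.sum_div]
  refine Finset.sum_congr rfl fun u _ => ?_
  rw [mul_left_comm w, ← smul_eq_C_mul, map_smul, smul_eq_mul, mul_div_assoc]

theorem dotProduct_covMatrix_mulVec (L : MvPolynomial (Var n) ℝ →ₗ[ℝ] ℝ)
    (w : MvPolynomial (Var n) ℝ) (x : Fin n → ℝ) :
    x ⬝ᵥ covMatrix L w *ᵥ x
      = reweighted L w (linPoly x ^ 2) - reweighted L w (linPoly x) ^ 2 := by
  have e1 : reweighted L w (linPoly x ^ 2)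
      = ∑ u, ∑ v, x u * (reweighted L w (X (.val u) * X (.val v)) * x v) := by
    rw [sq, linPoly, Finset.sum_mul_sum]
    simp only [reweighted, Finset.mul_sum, map_sum, Finset.sum_div]
    refine Finset.sum_congr rfl fun u _ => Finset.sum_congr rfl fun v _ => ?_
    rw [show w * (C (x u) * X (Var.val u) * (C (x v) * X (Var.val v)))
      = C (x u * x v) * (w * (X (Var.val u) * X (Var.val v))) by rw [map_mul]; ring,
      ← smul_eq_C_mul, map_smul, smul_eq_mul]
    ring
  rw [e1, ← sum_mul_reweighted, sq, Finset.sum_mul_sum, ← Finset.sum_sub_distrib]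
  simp only [dotProduct, mulVec, covMatrix, Matrix.of_apply, Finset.mul_sum]
  refine Finset.sum_congr rfl fun u _ => ?_
  rw [← Finset.sum_sub_distrib]
  exact Finset.sum_congr rfl fun v _ => by ring

theorem IsFeasible.posSemidef_covMatrix (hL : IsFeasible 40 (1 / 4) (1 / 256) (1 / 4) μ Q L)
    {ω : Fin 4 → Fin n} (hω : 0 < L (weight Q ω)) : (covMatrix L (weight Q ω)).PosSemidef := by
  refine Matrix.PosSemidef.of_dotProduct_mulVec_nonneg ?_ fun x => ?_
  · ext u v
    simp only [covMatrix, conjTranspose_apply, of_apply, star_trivial]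
    rw [mul_comm (X (Var.val v) : MvPolynomial (Var n) ℝ),
      mul_comm (reweighted L _ (X (Var.val v)))]
  · rw [star_trivial, dotProduct_covMatrix_mulVec]
    set w := weight Q ω with hw
    set m := reweighted L w (linPoly x) with hm
    have hlin : (linPoly x).totalDegree ≤ 1 :=
      totalDegree_sum_le _ fun _ _ => totalDegree_C_mul_le _ (totalDegree_X_le _ le_rfl)
    have h := hL.sq_nonneg (p := (∏ j, projPoly Q .val (ω j)) * (linPoly x - C m))
      (totalDegree_mul_le (totalDegree_prod_projPoly_le Q ω)
        (totalDegree_sub_le hlin (totalDegree_C_le _)) (by norm_num))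
    rw [mul_pow, ← weight_eq_sq, ← hw] at h
    have e : w * (linPoly x - C m) ^ 2
        = w * linPoly x ^ 2 - (2 * m) • (w * linPoly x) + (m ^ 2) • w := by
      simp only [smul_eq_C_mul, map_mul, map_pow, map_ofNat]; ring
    have hm' : L (w * linPoly x) = m * L w := by
      rw [hm, reweighted]; field_simp
    rw [e, map_add, map_sub, map_smul, map_smul, smul_eq_mul, smul_eq_mul, hm'] at h
    rw [reweighted, sub_nonneg, le_div_iff₀ hω]
    linarith

theorem reweighted_moments (hL : IsFeasible 40 (1 / 4) (1 / 256) (1 / 4) μ Q L)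
    {ω : Fin 4 → Fin n} (hω : 0 < L (weight Q ω)) (u : Fin n) :
    (Q *ᵥ fun v => reweighted L (weight Q ω) (X (.val v))) u ^ 2
      + ((Q.row u ⬝ᵥ covMatrix L (weight Q ω) *ᵥ Q.row u).toNNReal : ℝ)
      = L (weight Q ω * projPoly Q .val u ^ 2) / L (weight Q ω) := by
  have h0 := (hL.posSemidef_covMatrix hω).dotProduct_mulVec_nonneg (Q.row u)
  rw [star_trivial] at h0
  rw [Real.coe_toNNReal _ h0, dotProduct_covMatrix_mulVec]
  have : (Q *ᵥ fun v => reweighted L (weight Q ω) (X (.val v))) u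
      = reweighted L (weight Q ω) (linPoly (Q.row u)) := sum_mul_reweighted L _ (Q.row u)
  rw [this]
  simp only [reweighted]
  exact add_sub_cancel _ _

/-- If the reweighting at `ω` does not produce a good function, then the second moments after the
reweighting are flat. -/
theorem IsFeasible.sum_sq_le_of_not_isGood
    (hL : IsFeasible 40 (1 / 4) (1 / 256) (1 / 4) μ Q L) (hμ : 0 ≤ μ) {C : ℝ} (hC : 0 ≤ C)
    {ω : Fin 4 → Fin n}
    (h : 0 < L (weight Q ω) → ¬ 1 / (8 * gaussConst) ≤ (matchingGaussian L (weight Q ω)).real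
      {t | IsGood (C / (256 * gaussConst ^ 2)) μ Q (Q *ᵥ t.ofLp)}) :
    ∑ u, L (weight Q ω * projPoly Q .val u ^ 2) ^ 2
      ≤ C * level μ Q * (∑ u, L (weight Q ω * projPoly Q .val u ^ 2)) ^ 2 := by
  have hl := level_nonneg hμ Q
  have hd := totalDegree_prod_projPoly_le Q ω
  have h0 : 0 ≤ L (weight Q ω) := by
    rw [weight_eq_sq]; exact hL.sq_nonneg (hd.trans (by norm_num))
  rcases h0.eq_or_lt with hz | hω
  · have hz' : ∀ u, L (weight Q ω * projPoly Q .val u ^ 2) = 0 := fun u => by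
      rw [weight_eq_sq] at hz ⊢
      have hq : ((∏ j, projPoly Q .val (ω j)) * projPoly Q .val u ^ 2).totalDegree ≤ 20 :=
        totalDegree_mul_le hd (totalDegree_pow_le (totalDegree_projPoly_le _ _ _ le_rfl) 2 le_rfl)
          (by norm_num)
      have := hL.1.mul_eq_zero (p := ∏ j, projPoly Q .val (ω j)) (by omega) (by omega) hz.symm
        (q := (∏ j, projPoly Q .val (ω j)) * projPoly Q .val u ^ 2)
      rwa [← mul_assoc, ← sq] at this
    simp only [hz', zero_pow two_ne_zero, Finset.sum_const_zero]
    positivity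
  · by_contra hc
    push Not at hc
    refine h hω ?_
    have hS := hL.posSemidef_covMatrix hω
    have hP : IsProbabilityMeasure (matchingGaussian L (weight Q ω)) := by
      unfold matchingGaussian; infer_instance
    refine gaussian_isGood (P := matchingGaussian L (weight Q ω)) (T := fun t => t.ofLp)
      (fun u => ?_)
      (fun u => hasLaw_mulVec_multivariateGaussian Q _ hS u) hC hμ ?_
    · simp only [mulVec, dotProduct]; fun_prop
    · simp only [reweighted_moments hL hω, ← Finset.sum_div, div_pow]
      rw [mul_div_assoc', div_lt_div_iff_of_pos_right (by positivity)]
      exact hc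

/-- The pseudo-moments of the squared projection at a tuple of points. -/
noncomputable def momentTensor (Q : Matrix (Fin n) (Fin n) ℝ)
    (L : MvPolynomial (Var n) ℝ →ₗ[ℝ] ℝ) (l : List (Fin n)) : ℝ :=
  L (l.map fun u => projPoly Q .val u ^ 2).prod

theorem prod_map_sq (Q : Matrix (Fin n) (Fin n) ℝ) (l : List (Fin n)) :
    (l.map fun u => projPoly Q .val u ^ 2).prod = (l.map (projPoly Q .val)).prod ^ 2 := by
  induction l with
  | nil => simp
  | cons a l ih => rw [List.map_cons, List.prod_cons, ih, List.map_cons, List.prod_cons, mul_pow]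

theorem totalDegree_prod_map_le (Q : Matrix (Fin n) (Fin n) ℝ) (l : List (Fin n)) :
    (l.map (projPoly Q .val)).prod.totalDegree ≤ l.length := by
  induction l with
  | nil => simp
  | cons a l ih =>
    rw [List.map_cons, List.prod_cons]
    exact totalDegree_mul_le (totalDegree_projPoly_le _ _ _ le_rfl) ih
      (by rw [List.length_cons, add_comm])

theorem momentTensor_ofFn_append (Q : Matrix (Fin n) (Fin n) ℝ)
    (L : MvPolynomial (Var n) ℝ →ₗ[ℝ] ℝ) (ω : Fin 4 → Fin n) (u : Fin n) :
    momentTensor Q L (List.ofFn ω ++ [u]) = L (weight Q ω * projPoly Q .val u ^ 2) := by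
  rw [momentTensor, List.map_append, List.prod_append, List.map_ofFn, List.prod_ofFn]
  simp [weight]

theorem IsFeasible.posSemidef_momentTensor
    (hL : IsFeasible 40 (1 / 4) (1 / 256) (1 / 4) μ Q L) (l : List (Fin n)) (hl : l.length = 3) :
    (Matrix.of fun x u => momentTensor Q L (l ++ [x, u])).PosSemidef := by
  have hW : ∀ x u, momentTensor Q L (l ++ [x, u])
      = L ((l.map (projPoly Q .val)).prod ^ 2 * (projPoly Q .val x ^ 2 * projPoly Q .val u ^ 2)) :=
    fun x u => by rw [momentTensor, List.map_append, List.prod_append, prod_map_sq]; simp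
  refine Matrix.PosSemidef.of_dotProduct_mulVec_nonneg ?_ fun y => ?_
  · ext x u
    simp only [conjTranspose_apply, of_apply, star_trivial, hW]
    rw [mul_comm (projPoly Q .val u ^ 2)]
  · have hd := totalDegree_prod_map_le Q l
    rw [hl] at hd
    have h := hL.sq_nonneg
      (p := (l.map (projPoly Q .val)).prod * ∑ u, C (y u) * projPoly Q .val u ^ 2)
      (totalDegree_mul_le hd (totalDegree_sum_le _ fun u _ => totalDegree_C_mul_le _
        (totalDegree_pow_le (totalDegree_projPoly_le _ _ _ le_rfl) 2 le_rfl)) (by norm_num))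
    refine h.trans_eq ?_
    rw [mul_pow, sq (∑ u, _), Finset.sum_mul_sum, Finset.mul_sum, map_sum]
    simp only [star_trivial, dotProduct, mulVec, of_apply, hW, Finset.mul_sum, map_sum]
    refine Finset.sum_congr rfl fun x _ => Finset.sum_congr rfl fun u _ => ?_
    rw [show (l.map (projPoly Q .val)).prod ^ 2
        * (C (y x) * projPoly Q .val x ^ 2 * (C (y u) * projPoly Q .val u ^ 2))
      = C (y x * y u) * ((l.map (projPoly Q .val)).prod ^ 2
        * (projPoly Q .val x ^ 2 * projPoly Q .val u ^ 2)) by rw [map_mul]; ring,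
      ← smul_eq_C_mul, map_smul, smul_eq_mul]
    ring

theorem IsFeasible.momentTensor_nonneg
    (hL : IsFeasible 40 (1 / 4) (1 / 256) (1 / 4) μ Q L) {l : List (Fin n)} (hl : l.length ≤ 5) :
    0 ≤ momentTensor Q L l := by
  rw [momentTensor, prod_map_sq]
  exact hL.sq_nonneg ((totalDegree_prod_map_le Q l).trans (by omega))

theorem IsFeasible.sum_momentTensor_le (hQ : IsProjector n Q) (hμ : 0 < μ)
    (hL : IsFeasible 40 (1 / 4) (1 / 256) (1 / 4) μ Q L) (k : ℕ) (hk : k ≤ 5) :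
    ∑ v : Fin k → Fin n, momentTensor Q L (List.ofFn v) ≤ (n * μ) ^ k := by
  have hkμ : 0 ≤ n * μ := mul_nonneg (Nat.cast_nonneg n) hμ.le
  induction k with
  | zero => simp [momentTensor, hL.1.1]
  | succ k ih =>
    rw [← (Fin.consEquiv fun _ : Fin (k + 1) => Fin n).sum_comp, Fintype.sum_prod_type,
      Finset.sum_comm]
    have h : ∀ v : Fin k → Fin n,
        ∑ x, momentTensor Q L (List.ofFn (Fin.consEquiv (fun _ : Fin (k + 1) => Fin n) (x, v)))
          ≤ n * μ * momentTensor Q L (List.ofFn v) := fun v => by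
      have := hL.sum_proj_sq_mul_le hQ hμ (q := ((List.ofFn v).map (projPoly Q .val)).prod)
        ((totalDegree_prod_map_le Q _).trans (by rw [List.length_ofFn]; omega))
      refine le_trans (le_of_eq ?_) (this.trans_eq ?_)
      · refine Finset.sum_congr rfl fun x _ => ?_
        rw [momentTensor, ← prod_map_sq]
        simp [Fin.consEquiv]
      · rw [momentTensor, prod_map_sq]
    refine (Finset.sum_le_sum fun v _ => h v).trans ?_
    rw [← Finset.mul_sum, pow_succ']
    exact mul_le_mul_of_nonneg_left (ih (by omega)) hkμ

/-- Every solution of the relaxation is rounded successfully: otherwise all second moments are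
flat, so that the moment tensor correlates too little with `quad Q`. -/
theorem IsFeasible.roundingSucceeds (hQ : IsProjector n Q) (hμ : 0 < μ)
    (hL : IsFeasible 40 (1 / 4) (1 / 256) (1 / 4) μ Q L) :
    RoundingSucceeds (1 / (8 * gaussConst)) (1 / 64 / (256 * gaussConst ^ 2)) μ Q L := by
  by_contra hfail
  simp only [RoundingSucceeds, not_or, not_exists, not_and] at hfail
  obtain ⟨h1, h2, h3⟩ := hfail
  have hK := one_le_gaussConst
  have hl := level_nonneg hμ.le Q
  have hk := hL.one_le hμ
  have hd := hL.rank_pos hQ hμ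
  have hl1 : level μ Q ≤ 1 := by
    rw [level, div_le_one (by positivity)]
    have : 1 ≤ (Q.rank : ℝ) ^ (1 / 3 : ℝ) := Real.one_le_rpow hd (by norm_num)
    nlinarith
  set A := 1 / 64 * level μ Q with hA
  have hA0 : 0 ≤ A := by positivity
  have hA1 : A ≤ 1 := by linarith
  have hcol : ∀ u, ∑ v, Q u v ^ 4 ≤ A * Q u u ^ 2 := fun u => by
    have hg : ∀ v, (Q *ᵥ delta u) v = n * Q u v := fun v => by
      rw [delta, Matrix.mulVec_single, Pi.smul_apply, Matrix.col_apply, hQ.symm u v]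
      simp [mul_comm]
    have hn := hL.pos hμ
    by_cases h0 : Q *ᵥ delta u = 0
    · have hz : ∀ v, Q u v = 0 := fun v => by
        have := hg v
        rw [h0, Pi.zero_apply] at this
        simpa [hn.ne'] using this.symm
      simp [hz]
    · have := h1 u
      rw [isGood_iff] at this
      have h4 := not_le.1 fun hc => this ⟨h0, ⟨_, rfl⟩, hc⟩
      simp only [hg, mul_pow, ← Finset.mul_sum, hQ.sum_sq] at h4
      have e : 1 / 64 / (256 * gaussConst ^ 2) * level μ Q * ((n ^ 2) ^ 2 * Q u u ^ 2)
          = n ^ 4 * (1 / (256 * gaussConst ^ 2) * (A * Q u u ^ 2)) := by rw [hA]; ring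
      rw [e] at h4
      have h5 := (lt_of_mul_lt_mul_left h4 (by positivity)).le
      refine h5.trans (mul_le_of_le_one_left (by positivity) ?_)
      rw [div_le_one (by positivity)]
      nlinarith
  have hdiag : ∑ u, Q u u ^ 2 ≤ A * (∑ u, Q u u) ^ 2 :=
    sum_sq_diag_le_of_not_isGood hQ (by norm_num) hμ.le h2
  have hrow : ∀ l : List (Fin n), l.length = 4 →
      nrm (fun x => momentTensor Q L (l ++ [x]))
        ≤ √A * ∑ x, momentTensor Q L (l ++ [x]) + 0 := fun l hl4 => by
    obtain ⟨ω, rfl⟩ : ∃ ω : Fin 4 → Fin n, l = List.ofFn ω :=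
      ⟨fun j => l.get (j.cast hl4.symm), by
        exact List.ext_getElem (by rw [List.length_ofFn, hl4]) fun i h1 h2 => by
          rw [List.getElem_ofFn]; rfl⟩
    have h4 := hL.sum_sq_le_of_not_isGood hμ.le (by norm_num : (0 : ℝ) ≤ 1 / 64) (h3 ω)
    have hs : 0 ≤ ∑ x, momentTensor Q L (List.ofFn ω ++ [x]) :=
      Finset.sum_nonneg fun x _ => hL.momentTensor_nonneg (by simp)
    simp only [momentTensor_ofFn_append] at hs ⊢
    rw [add_zero]
    refine nrm_le_of_sq_le (by positivity) ?_
    rw [mul_pow, Real.sq_sqrt hA0]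
    exact h4
  have hmain := sum_mul_abs_quad_le hQ hA0 hA1 le_rfl le_rfl hdiag hcol
    hL.posSemidef_momentTensor (fun l x _ => by
      rw [momentTensor, momentTensor, List.map_append, List.prod_append, List.map_cons,
        List.prod_cons]
      simp [mul_comm]) hrow
  have hW0 : 0 ≤ ∑ v : Fin 5 → Fin n, momentTensor Q L (List.ofFn v) :=
    Finset.sum_nonneg fun v _ => hL.momentTensor_nonneg (by simp)
  rw [abs_of_nonneg hW0, add_zero, mul_zero, add_zero] at hmain
  have hW := hL.sum_momentTensor_le hQ hμ 5 le_rfl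
  have hlow : 3 / 4 * (n * μ) * (n * μ / 4 ^ 8)
      ≤ ∑ ω : Fin 4 → Fin n, (∑ u, momentTensor Q L (List.ofFn ω ++ [u])) * |quad Q ω| := by
    have h5 := hL.sum_weight_mul_quad_ge hμ
    have h6 : ∑ ω, 3 / 4 * (n * μ) * (L (weight Q ω) * |quad Q ω|)
        ≤ ∑ ω : Fin 4 → Fin n,
          (∑ u, momentTensor Q L (List.ofFn ω ++ [u])) * |quad Q ω| := by
      refine Finset.sum_le_sum fun ω _ => ?_
      rw [← mul_assoc]
      refine mul_le_mul_of_nonneg_right ?_ (abs_nonneg _)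
      have h7 := hL.sum_proj_sq_mul_ge hμ (q := ∏ j, projPoly Q .val (ω j))
        ((totalDegree_prod_projPoly_le Q ω).trans (by norm_num))
      rw [← weight_eq_sq] at h7
      refine h7.trans_eq (Finset.sum_congr rfl fun u _ => ?_)
      rw [momentTensor_ofFn_append, mul_comm]
    rw [← Finset.mul_sum] at h6
    refine le_trans ?_ h6
    gcongr
  have hup : A ^ 3 * Q.rank * (n * μ) ^ 5 = 1 / 64 ^ 3 * (n * μ) ^ 2 := by
    have : (n * μ) ^ 3 * (Q.rank : ℝ) ≠ 0 := by positivity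
    rw [hA, mul_pow, level_pow_three]
    field_simp
  have h8 : A ^ 3 * Q.rank * ∑ v : Fin 5 → Fin n, momentTensor Q L (List.ofFn v)
      ≤ A ^ 3 * Q.rank * (n * μ) ^ 5 := by gcongr
  have h9 : 0 < (n * μ) ^ 2 := by positivity
  rw [hup] at h8
  nlinarith

end reweighting

end ASVP

namespace ASVP

open Matrix

/-! ### The power method and a drift inequality on the spectraplex -/

section Spectraplex

theorem sq_le_diag_mul_diag {J : Type*} {M : Matrix J J ℝ} (hM : M.PosSemidef) (a b : J) :
    M a b ^ 2 ≤ M a a * M b b := by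
  have h := (hM.submatrix ![a, b]).det_nonneg
  have hs : M b a = M a b := by simpa using hM.1.apply a b
  simp only [det_fin_two, submatrix_apply, cons_val_zero, cons_val_one, hs] at h
  nlinarith

variable {J : Type*} [Fintype J]

theorem sum_sq_le_trace_sq {M : Matrix J J ℝ} (hM : M.PosSemidef) :
    ∑ p : J × J, M p.1 p.2 ^ 2 ≤ M.trace ^ 2 := by
  rw [Fintype.sum_prod_type, sq, Matrix.trace, Finset.sum_mul_sum]
  exact Finset.sum_le_sum fun a _ => Finset.sum_le_sum fun b _ => sq_le_diag_mul_diag hM a b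

theorem abs_apply_le_trace {M : Matrix J J ℝ} (hM : M.PosSemidef) (a b : J) :
    |M a b| ≤ M.trace := by
  refine abs_le_of_sq_le_sq ?_ hM.trace_nonneg
  exact (Finset.single_le_sum (f := fun p : J × J => M p.1 p.2 ^ 2) (fun _ _ => sq_nonneg _)
    (Finset.mem_univ (a, b))).trans (sum_sq_le_trace_sq hM)

/-- A diagonalization: the traces of the powers are the power sums of numbers `x i ≥ 0`, the
largest of which is at least every Rayleigh quotient. -/
theorem exists_powerSums [DecidableEq J] {M : Matrix J J ℝ} (hM : M.PosSemidef) {φ : J → ℝ} {l : ℝ}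
    (hφ : φ ≠ 0) (h : l * (φ ⬝ᵥ φ) ≤ φ ⬝ᵥ M *ᵥ φ) :
    ∃ x : J → ℝ, (∀ i, 0 ≤ x i) ∧ (∀ N, (M ^ N).trace = ∑ i, x i ^ N) ∧ ∃ i, l ≤ x i := by
  set U : Matrix J J ℝ := (hM.1.eigenvectorUnitary : Matrix J J ℝ) with hU
  set x := hM.1.eigenvalues with hx
  have hUU : U * star U = 1 := Unitary.mul_star_self_of_mem hM.1.eigenvectorUnitary.2
  have hUU' : star U * U = 1 := Unitary.star_mul_self_of_mem hM.1.eigenvectorUnitary.2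
  have hMU : M = U * diagonal x * star U := by
    have := hM.1.spectral_theorem
    rw [Unitary.conjStarAlgAut_apply] at this
    exact this
  refine ⟨x, hM.eigenvalues_nonneg, fun N => ?_, ?_⟩
  · have hp : M ^ N = U * diagonal (x ^ N) * star U := by
      induction N with
      | zero => rw [pow_zero, pow_zero]; simpa using hUU.symm
      | succ N ih =>
        have hd : diagonal (x ^ (N + 1)) = diagonal (x ^ N) * diagonal x := by
          rw [diagonal_mul_diagonal, pow_succ]; rfl
        rw [pow_succ, ih, hMU, hd]
        calc U * diagonal (x ^ N) * star U * (U * diagonal x * star U)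
            = U * diagonal (x ^ N) * (star U * U) * diagonal x * star U := by
              simp only [Matrix.mul_assoc]
          _ = _ := by rw [hUU', Matrix.mul_one]; simp only [Matrix.mul_assoc]
    rw [hp, trace_mul_comm, ← Matrix.mul_assoc, hUU', Matrix.one_mul, trace_diagonal]
    rfl
  · by_contra! hc
    set c := star U *ᵥ φ with hcdef
    have hstar : ∀ (A : Matrix J J ℝ) (v w : J → ℝ), v ⬝ᵥ A *ᵥ w = (star A *ᵥ v) ⬝ᵥ w :=
      fun A v w => by
        rw [dotProduct_mulVec, star_eq_conjTranspose, conjTranspose_eq_transpose_of_trivial,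
          mulVec_transpose]
    have h1 : φ ⬝ᵥ M *ᵥ φ = ∑ i, x i * c i ^ 2 := by
      rw [hMU, ← mulVec_mulVec, ← mulVec_mulVec, hstar, ← hcdef]
      simp only [dotProduct, mulVec_diagonal]
      exact Finset.sum_congr rfl fun i _ => by ring
    have h2 : φ ⬝ᵥ φ = ∑ i, c i ^ 2 := by
      have : φ = U *ᵥ c := by rw [hcdef, mulVec_mulVec, hUU, one_mulVec]
      calc φ ⬝ᵥ φ = φ ⬝ᵥ U *ᵥ c := by rw [← this]
        _ = _ := by
          rw [hstar, ← hcdef]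
          exact Finset.sum_congr rfl fun i _ => by ring
    rw [h1, h2, Finset.mul_sum] at h
    have hc0 : ∀ i, c i = 0 := by
      have hle : ∀ i ∈ Finset.univ, x i * c i ^ 2 ≤ l * c i ^ 2 := fun i _ =>
        mul_le_mul_of_nonneg_right (hc i).le (sq_nonneg _)
      have heq := (Finset.sum_eq_sum_iff_of_le hle).1 (le_antisymm (Finset.sum_le_sum hle) h)
      intro i
      have := heq i (Finset.mem_univ i)
      by_contra hne
      exact (hc i).ne (mul_right_cancel₀ (pow_ne_zero 2 hne) this)
    exact hφ (dotProduct_self_eq_zero.1 (by rw [h2]; simp [hc0]))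

/-- The normalized high power of a positive semidefinite matrix almost attains the largest
eigenvalue: for `y = l - 1 > 0`, Bernoulli gives `l ^ N ≥ y ^ N * (N / y)`, which outweighs the
terms `x ^ N * (x - y) ≥ - y ^ (N + 1)` of the small eigenvalues. -/
theorem trace_pow_succ_ge [DecidableEq J] {M : Matrix J J ℝ} (hM : M.PosSemidef) {φ : J → ℝ}
    {l b : ℝ} (hφ : φ ≠ 0) (h : l * (φ ⬝ᵥ φ) ≤ φ ⬝ᵥ M *ᵥ φ) (hl : 0 < l) (hb : l ≤ b) {N : ℕ}
    (hN : Fintype.card J * b ^ 2 ≤ N) :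
    0 < (M ^ N).trace ∧ (l - 1) * (M ^ N).trace ≤ (M ^ (N + 1)).trace := by
  obtain ⟨x, hx0, hx, i, hi⟩ := exists_powerSums hM hφ h
  rw [hx, hx]
  refine ⟨Finset.sum_pos' (fun j _ => pow_nonneg (hx0 j) _)
    ⟨i, Finset.mem_univ i, pow_pos (hl.trans_le hi) _⟩, ?_⟩
  rw [Finset.mul_sum]
  rcases le_or_gt l 1 with h1 | h1
  · refine Finset.sum_le_sum fun j _ => ?_
    exact (mul_nonpos_of_nonpos_of_nonneg (by linarith) (pow_nonneg (hx0 j) _)).trans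
      (pow_nonneg (hx0 j) _)
  set y := l - 1 with hy
  have hy0 : 0 < y := by linarith
  have hsmall : ∀ j, x j ^ N * (y - x j) ≤ y ^ (N + 1) := fun j => by
    rcases le_or_gt (x j) y with hj | hj
    · rw [pow_succ]
      exact mul_le_mul (pow_le_pow_left₀ (hx0 j) hj _) (by linarith [hx0 j]) (by linarith)
        (by positivity)
    · exact (mul_nonpos_of_nonneg_of_nonpos (pow_nonneg (hx0 j) _) (by linarith)).trans
        (by positivity)
  have hbig : x i ^ N * (y - x i) ≤ -(Fintype.card J * y ^ (N + 1)) := by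
    have hB : 1 + N * (1 / y) ≤ (1 + 1 / y) ^ N :=
      one_add_mul_le_pow (by have : 0 < 1 / y := by positivity
                             linarith) N
    have hlN : l ^ N = y ^ N * (1 + 1 / y) ^ N := by
      rw [← mul_pow]
      congr 1
      field_simp
      linarith
    have hNy : Fintype.card J * y ≤ N * (1 / y) := by
      rw [mul_one_div, le_div_iff₀ hy0]
      refine le_trans ?_ hN
      rw [mul_assoc, ← sq]
      exact mul_le_mul_of_nonneg_left (pow_le_pow_left₀ hy0.le (by linarith) 2)
        (Nat.cast_nonneg _)
    have h3 : Fintype.card J * y ^ (N + 1) ≤ l ^ N := by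
      rw [hlN, pow_succ]
      calc Fintype.card J * (y ^ N * y) = y ^ N * (Fintype.card J * y) := by ring
        _ ≤ y ^ N * (1 + 1 / y) ^ N := by gcongr; linarith
    have h4 : l ^ N ≤ x i ^ N := pow_le_pow_left₀ hl.le hi _
    have h5 : x i ^ N * (y - x i) ≤ x i ^ N * (-1) :=
      mul_le_mul_of_nonneg_left (by linarith) (pow_nonneg (hx0 i) _)
    linarith
  have hsum : ∑ j, x j ^ N * (y - x j) ≤ 0 := by
    rw [← Finset.add_sum_erase _ _ (Finset.mem_univ i)]
    have h6 : ∑ j ∈ Finset.univ.erase i, x j ^ N * (y - x j)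
        ≤ (Finset.univ.erase i).card • y ^ (N + 1) := Finset.sum_le_card_nsmul _ _ _ fun j _ => hsmall j
    have h7 : ((Finset.univ.erase i).card : ℝ) ≤ Fintype.card J := by
      exact_mod_cast Finset.card_le_univ _
    rw [nsmul_eq_mul] at h6
    have := mul_le_mul_of_nonneg_right h7 (by positivity : 0 ≤ y ^ (N + 1))
    linarith
  have : ∑ j, x j ^ N * (y - x j) = ∑ j, y * x j ^ N - ∑ j, x j ^ (N + 1) := by
    rw [← Finset.sum_sub_distrib]
    exact Finset.sum_congr rfl fun j _ => by ring
  linarith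

end Spectraplex

end ASVP

namespace ASVP

open Matrix

/-! ### The drift-plus-penalty iteration -/

section Drift

variable {J ι : Type*}

/-- The violation of the symmetry `S ∘ τ = S` at a pair of indices. -/
def dev (τ : Equiv.Perm (J × J)) (S : Matrix J J ℝ) (p : J × J) : ℝ :=
  S p.1 p.2 - S (τ p).1 (τ p).2

theorem dev_add (τ : Equiv.Perm (J × J)) (S X : Matrix J J ℝ) (p : J × J) :
    dev τ (S + X) p = dev τ S p + dev τ X p := by
  simp only [dev, Matrix.add_apply]
  ring

variable [Fintype ι]

/-- Half the gradient of the penalty `S ↦ ∑ i, ∑ p, dev (τ i) S p ^ 2`. -/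
def penaltyGrad (τ : ι → Equiv.Perm (J × J)) (S : Matrix J J ℝ) : Matrix J J ℝ :=
  of fun a b => ∑ i, (2 * S a b - S (τ i (a, b)).1 (τ i (a, b)).2
    - S ((τ i).symm (a, b)).1 ((τ i).symm (a, b)).2)

theorem abs_penaltyGrad_le (τ : ι → Equiv.Perm (J × J)) {S : Matrix J J ℝ} {s : ℝ}
    (hS : ∀ a b, |S a b| ≤ s) (a b : J) :
    |penaltyGrad τ S a b| ≤ 4 * Fintype.card ι * s := by
  rw [penaltyGrad, of_apply]
  refine (Finset.abs_sum_le_sum_abs _ _).trans ?_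
  refine (Finset.sum_le_card_nsmul _ _ (4 * s) fun i _ => ?_).trans (le_of_eq ?_)
  · have h1 := abs_le.1 (hS a b)
    have h2 := abs_le.1 (hS (τ i (a, b)).1 (τ i (a, b)).2)
    have h3 := abs_le.1 (hS ((τ i).symm (a, b)).1 ((τ i).symm (a, b)).2)
    rw [abs_le]
    constructor <;> linarith
  · rw [nsmul_eq_mul, Finset.card_univ]
    ring

variable [Fintype J]

theorem sum_penaltyGrad_mul (τ : ι → Equiv.Perm (J × J)) (S X : Matrix J J ℝ) :
    ∑ p : J × J, penaltyGrad τ S p.1 p.2 * X p.1 p.2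
      = ∑ i, ∑ p, dev (τ i) S p * dev (τ i) X p := by
  simp only [penaltyGrad, of_apply, Finset.sum_mul]
  rw [Finset.sum_comm]
  refine Finset.sum_congr rfl fun i _ => ?_
  have h1 := Equiv.sum_comp (τ i) fun p => S p.1 p.2 * X p.1 p.2
  have h2 := Equiv.sum_comp (τ i)
    fun p => S ((τ i).symm p).1 ((τ i).symm p).2 * X p.1 p.2
  simp only [Equiv.symm_apply_apply] at h2
  simp only [dev, sub_mul, mul_sub, Finset.sum_sub_distrib, Prod.mk.eta, two_mul,
    add_mul, Finset.sum_add_distrib]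
  rw [h1, h2]
  ring

theorem sum_dev_sq_le (τ : Equiv.Perm (J × J)) {X : Matrix J J ℝ} (hX : X.PosSemidef) :
    ∑ p, dev τ X p ^ 2 ≤ 4 * X.trace ^ 2 := by
  have h1 := Equiv.sum_comp τ fun p => X p.1 p.2 ^ 2
  have h2 := sum_sq_le_trace_sq hX
  calc ∑ p, dev τ X p ^ 2 ≤ ∑ p, (2 * X p.1 p.2 ^ 2 + 2 * X (τ p).1 (τ p).2 ^ 2) :=
        Finset.sum_le_sum fun p _ => by
          rw [dev]
          nlinarith [sq_nonneg (X p.1 p.2 + X (τ p).1 (τ p).2)]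
    _ = 4 * ∑ p : J × J, X p.1 p.2 ^ 2 := by
        rw [Finset.sum_add_distrib, ← Finset.mul_sum, ← Finset.mul_sum, h1]
        ring
    _ ≤ _ := by linarith

theorem dotProduct_mulVec_eq_sum (M : Matrix J J ℝ) (x : J → ℝ) :
    x ⬝ᵥ M *ᵥ x = ∑ p : J × J, M p.1 p.2 * (x p.1 * x p.2) := by
  rw [Fintype.sum_prod_type]
  simp only [dotProduct, mulVec, Finset.mul_sum]
  exact Finset.sum_congr rfl fun a _ => Finset.sum_congr rfl fun b _ => by ring

variable [DecidableEq J]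

/-- The gradient of `V` times the objective `∑ a, κ a * S a a` minus half the penalty, shifted by
`ρ`. -/
def shiftedGrad (τ : ι → Equiv.Perm (J × J)) (κ : J → ℝ) (V ρ : ℝ) (S : Matrix J J ℝ) :
    Matrix J J ℝ :=
  ρ • (1 : Matrix J J ℝ) + V • diagonal κ - penaltyGrad τ S

/-- One iteration: the normalized `N`-th power of the compressed gradient is added to the
accumulator. -/
noncomputable def driftStep (τ : ι → Equiv.Perm (J × J)) (κ : J → ℝ) (R : Matrix J J ℝ) (V ρ : ℝ)
    (N : ℕ) (S : Matrix J J ℝ) : Matrix J J ℝ :=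
  S + (((R * shiftedGrad τ κ V ρ S * R) ^ N).trace)⁻¹ • (R * shiftedGrad τ κ V ρ S * R) ^ N

/-- What is known of the accumulator after `t` iterations. The last field bounds the penalty by the
surplus of the objective over `opt`. -/
structure DriftInvariant (τ : ι → Equiv.Perm (J × J)) (κ : J → ℝ) (R : Matrix J J ℝ)
    (V opt : ℝ) (t : ℕ) (S : Matrix J J ℝ) : Prop where
  posSemidef : S.PosSemidef
  trace_eq : S.trace = t
  mul_eq : R * S = S
  penalty_le : ∑ i, ∑ p, dev (τ i) S p ^ 2
    ≤ 2 * V * (∑ a, κ a * S a a) - t * (2 * V * opt - (2 + 4 * Fintype.card ι))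

theorem driftInvariant_zero (τ : ι → Equiv.Perm (J × J)) (κ : J → ℝ) (R : Matrix J J ℝ)
    (V opt : ℝ) : DriftInvariant τ κ R V opt 0 0 where
  posSemidef := .zero
  trace_eq := by simp
  mul_eq := by simp
  penalty_le := by simp [dev]

theorem sum_shiftedGrad_mul (τ : ι → Equiv.Perm (J × J)) (κ : J → ℝ) (V ρ : ℝ)
    (S X : Matrix J J ℝ) :
    ∑ p : J × J, shiftedGrad τ κ V ρ S p.1 p.2 * X p.1 p.2
      = ρ * X.trace + V * (∑ a, κ a * X a a) - ∑ i, ∑ p, dev (τ i) S p * dev (τ i) X p := by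
  rw [← sum_penaltyGrad_mul]
  simp only [shiftedGrad, Matrix.sub_apply, Matrix.add_apply, Matrix.smul_apply, smul_eq_mul,
    sub_mul, add_mul,
    Finset.sum_sub_distrib, Finset.sum_add_distrib]
  congr 2
  · rw [Fintype.sum_prod_type, Matrix.trace, Finset.mul_sum]
    refine Finset.sum_congr rfl fun a _ => ?_
    simp [one_apply]
  · rw [Fintype.sum_prod_type, Finset.mul_sum]
    refine Finset.sum_congr rfl fun a _ => ?_
    simp [diagonal_apply, mul_assoc]

theorem posSemidef_shiftedGrad {τ : ι → Equiv.Perm (J × J)} {κ : J → ℝ} {V ρ s : ℝ}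
    {S : Matrix J J ℝ} (hκ : ∀ a, 0 ≤ κ a) (hV : 0 ≤ V) (hsym : (penaltyGrad τ S).IsHermitian)
    (hS : ∀ a b, |S a b| ≤ s) (hρ : 4 * Fintype.card ι * s * Fintype.card J ≤ ρ) :
    (shiftedGrad τ κ V ρ S).PosSemidef := by
  refine .of_dotProduct_mulVec_nonneg ?_ fun x => ?_
  · refine ((IsHermitian.ext fun a b => ?_).add (IsHermitian.ext fun a b => ?_)).sub hsym
    · simp [one_apply, eq_comm]
    · simp only [Matrix.smul_apply, diagonal_apply, star_trivial]
      by_cases h : a = b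
      · subst h; rfl
      · simp [h, Ne.symm h]
  rw [star_trivial, shiftedGrad, sub_mulVec, add_mulVec, dotProduct_sub, dotProduct_add,
    smul_mulVec, smul_mulVec, one_mulVec, dotProduct_smul, dotProduct_smul, smul_eq_mul,
    smul_eq_mul]
  have h1 : 0 ≤ x ⬝ᵥ diagonal κ *ᵥ x := by
    simp only [dotProduct, mulVec_diagonal]
    exact Finset.sum_nonneg fun a _ => by nlinarith [mul_nonneg (hκ a) (sq_nonneg (x a))]
  have hg0 : ∀ a : J, 0 ≤ 4 * Fintype.card ι * s := fun a =>
    (abs_nonneg _).trans (abs_penaltyGrad_le τ hS a a)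
  have h2 : x ⬝ᵥ penaltyGrad τ S *ᵥ x ≤ ρ * (x ⬝ᵥ x) := by
    rcases isEmpty_or_nonempty J with hJ | ⟨⟨a⟩⟩
    · simp [dotProduct]
    rw [dotProduct_mulVec_eq_sum]
    calc ∑ p : J × J, penaltyGrad τ S p.1 p.2 * (x p.1 * x p.2)
        ≤ ∑ p : J × J, 4 * Fintype.card ι * s * (|x p.1| * |x p.2|) :=
          Finset.sum_le_sum fun p _ => by
            rw [← abs_mul]
            refine (le_abs_self _).trans ?_
            rw [abs_mul]
            exact mul_le_mul_of_nonneg_right (abs_penaltyGrad_le τ hS _ _) (abs_nonneg _)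
      _ = 4 * Fintype.card ι * s * (∑ a, |x a|) ^ 2 := by
          rw [← Finset.mul_sum, Fintype.sum_prod_type, sq, Finset.sum_mul_sum]
      _ ≤ 4 * Fintype.card ι * s * (Fintype.card J * ∑ a, |x a| ^ 2) :=
          mul_le_mul_of_nonneg_left (by
            simpa using sq_sum_le_card_mul_sum_sq (s := Finset.univ) (f := fun a => |x a|))
            (hg0 a)
      _ = 4 * Fintype.card ι * s * Fintype.card J * (x ⬝ᵥ x) := by
          simp only [sq_abs, dotProduct, ← sq]
          ring
      _ ≤ ρ * (x ⬝ᵥ x) := mul_le_mul_of_nonneg_right hρ (dotProduct_self_star_nonneg x)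
  have := mul_nonneg hV h1
  linarith

/-- A feasible rank one matrix `φ φᵀ` with objective `opt` keeps the invariant going. -/
theorem DriftInvariant.step {τ : ι → Equiv.Perm (J × J)} {κ : J → ℝ} {R : Matrix J J ℝ}
    {V opt ρ K : ℝ} {t T N : ℕ} {S : Matrix J J ℝ} (h : DriftInvariant τ κ R V opt t S)
    (hsym : ∀ S : Matrix J J ℝ, S.IsHermitian → (penaltyGrad τ S).IsHermitian)
    (hR : Rᵀ = R) (hRR : R * R = R) (hκ : ∀ a, 0 ≤ κ a) (hκK : ∀ a, κ a ≤ K) (hV : 0 ≤ V)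
    (hopt : 0 ≤ opt) {φ : J → ℝ} (hφ : φ ≠ 0) (hRφ : R *ᵥ φ = φ)
    (hφτ : ∀ i p, φ (τ i p).1 * φ (τ i p).2 = φ p.1 * φ p.2)
    (hφκ : opt * ∑ a, φ a ^ 2 ≤ ∑ a, κ a * φ a ^ 2) (ht : t ≤ T) (hρ0 : 0 < ρ)
    (hρ : 4 * Fintype.card ι * T * Fintype.card J ≤ ρ) (hN0 : N ≠ 0)
    (hN : Fintype.card J * (ρ + V * K) ^ 2 ≤ N) :
    DriftInvariant τ κ R V opt (t + 1) (driftStep τ κ R V ρ N S) := by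
  have hS : ∀ a b, |S a b| ≤ T := fun a b =>
    (abs_apply_le_trace h.posSemidef a b).trans (by rw [h.trace_eq]; exact_mod_cast ht)
  set M₀ := shiftedGrad τ κ V ρ S with hM₀
  have hM₀psd : M₀.PosSemidef :=
    posSemidef_shiftedGrad hκ hV (hsym S h.posSemidef.1) hS hρ
  set M := R * M₀ * R with hM
  have hMpsd : M.PosSemidef := by
    have := hM₀psd.mul_mul_conjTranspose_same R
    rwa [conjTranspose_eq_transpose_of_trivial, hR] at this
  have hφφ : φ ⬝ᵥ φ = ∑ a, φ a ^ 2 := Finset.sum_congr rfl fun a _ => (sq _).symm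
  have hφpos : 0 < ∑ a, φ a ^ 2 := by
    refine lt_of_le_of_ne (Finset.sum_nonneg fun a _ => sq_nonneg _) fun h0 => hφ ?_
    exact dotProduct_self_eq_zero.1 (hφφ.trans h0.symm)
  have hray : (ρ + V * opt) * (φ ⬝ᵥ φ) ≤ φ ⬝ᵥ M *ᵥ φ := by
    have h1 : φ ⬝ᵥ M *ᵥ φ = φ ⬝ᵥ M₀ *ᵥ φ := by
      rw [hM, ← mulVec_mulVec, hRφ, ← mulVec_mulVec, dotProduct_mulVec, ← mulVec_transpose, hR,
        hRφ]
    have h2 := sum_shiftedGrad_mul τ κ V ρ S (vecMulVec φ φ)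
    have h3 : ∀ i p, dev (τ i) (vecMulVec φ φ) p = 0 := fun i p => by
      rw [dev, vecMulVec_apply, vecMulVec_apply, hφτ, sub_self]
    simp only [h3, mul_zero, Finset.sum_const_zero, sub_zero, vecMulVec_apply, Matrix.trace,
      diag_apply, ← sq] at h2
    rw [h1, dotProduct_mulVec_eq_sum, h2, hφφ, add_mul, mul_assoc V]
    gcongr
  have hoptK : opt ≤ K := by
    refine le_of_mul_le_mul_right (hφκ.trans ?_) hφpos
    rw [Finset.mul_sum]
    exact Finset.sum_le_sum fun a _ => mul_le_mul_of_nonneg_right (hκK a) (sq_nonneg _)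
  obtain ⟨htr, hpow⟩ := trace_pow_succ_ge hMpsd hφ hray (by positivity)
    (b := ρ + V * K) (by gcongr) hN
  set X := ((M ^ N).trace)⁻¹ • M ^ N with hX
  have hstep : driftStep τ κ R V ρ N S = S + X := rfl
  have hXpsd : X.PosSemidef := (hMpsd.pow N).smul (inv_nonneg.2 htr.le)
  have hXtr : X.trace = 1 := by rw [hX, trace_smul, smul_eq_mul, inv_mul_cancel₀ htr.ne']
  obtain ⟨N', rfl⟩ := Nat.exists_eq_succ_of_ne_zero hN0
  have hRX : R * X = X := by
    rw [hX, Matrix.mul_smul, Nat.succ_eq_add_one, pow_succ', ← Matrix.mul_assoc, hM,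
      ← Matrix.mul_assoc R, ← Matrix.mul_assoc R, hRR]
  have hXR : X * R = X := by
    rw [hX, Matrix.smul_mul, Nat.succ_eq_add_one, pow_succ, Matrix.mul_assoc]
    congr 2
    rw [hM, Matrix.mul_assoc, hRR]
  have hgain : ρ + V * opt - 1 ≤ ∑ p : J × J, M₀ p.1 p.2 * X p.1 p.2 := by
    have h1 : ∑ p : J × J, M₀ p.1 p.2 * X p.1 p.2 = (M₀ * X).trace := by
      rw [Fintype.sum_prod_type]
      simp only [Matrix.trace, diag_apply, mul_apply]
      refine Finset.sum_congr rfl fun a _ => Finset.sum_congr rfl fun b _ => ?_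
      rw [show X b a = X a b by simpa using hXpsd.1.apply a b]
    have h2 : (M₀ * X).trace = (M * X).trace := by
      conv_lhs => rw [← hRX, ← hXR]
      rw [hM, Matrix.mul_assoc R, Matrix.mul_assoc R, trace_mul_comm R]
      simp only [Matrix.mul_assoc]
    rw [h1, h2, hX, Matrix.mul_smul, trace_smul, smul_eq_mul, ← pow_succ', inv_mul_eq_div,
      le_div_iff₀ htr]
    exact hpow
  rw [sum_shiftedGrad_mul, hXtr, mul_one] at hgain
  refine ⟨?_, ?_, ?_, ?_⟩
  · rw [hstep]; exact h.posSemidef.add hXpsd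
  · rw [hstep, trace_add, h.trace_eq, hXtr]; push_cast; ring
  · rw [hstep, Matrix.mul_add, h.mul_eq, hRX]
  · rw [hstep]
    have h1 : ∑ i, ∑ p, dev (τ i) (S + X) p ^ 2 = ∑ i, ∑ p, dev (τ i) S p ^ 2
        + 2 * ∑ i, ∑ p, dev (τ i) S p * dev (τ i) X p + ∑ i, ∑ p, dev (τ i) X p ^ 2 := by
      simp only [dev_add, Finset.mul_sum, ← Finset.sum_add_distrib]
      exact Finset.sum_congr rfl fun i _ => Finset.sum_congr rfl fun p _ => by ring
    have h2 : ∑ i, ∑ p, dev (τ i) X p ^ 2 ≤ 4 * Fintype.card ι := by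
      refine (Finset.sum_le_card_nsmul _ _ 4 fun i _ => ?_).trans (le_of_eq ?_)
      · have := sum_dev_sq_le (τ i) hXpsd
        rwa [hXtr, one_pow, mul_one] at this
      · rw [nsmul_eq_mul, Finset.card_univ]; ring
    have h3 := h.penalty_le
    rw [h1]
    simp only [Matrix.add_apply, mul_add, Finset.sum_add_distrib]
    push_cast
    linarith

end Drift

end ASVP

namespace ASVP

open Matrix

/-! ### The symmetries of a moment matrix of degree ten -/

/-- The indices of the rows and columns of the moment matrix: five points. -/
abbrev Tuple (n : ℕ) : Type := Fin 5 → Fin n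

section Tuple

variable {n : ℕ}

theorem tuple_eta (a : Tuple n) : ![a 0, a 1, a 2, a 3, a 4] = a := by
  ext i; fin_cases i <;> rfl

theorem sum_tuple (f : Tuple n → ℝ) :
    ∑ a, f a = ∑ ω : Fin 4 → Fin n, ∑ x, f ![ω 0, ω 1, ω 2, ω 3, x] := by
  rw [← (Fin.snocEquiv fun _ : Fin 5 => Fin n).sum_comp, Fintype.sum_prod_type, Finset.sum_comm]
  refine Finset.sum_congr rfl fun ω _ => Finset.sum_congr rfl fun x _ => congrArg f ?_
  ext i; fin_cases i <;> rfl

/-- The cyclic shift of both row and column indices. -/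
def cycPerm (n : ℕ) : Equiv.Perm (Tuple n × Tuple n) where
  toFun p := (![p.1 4, p.1 0, p.1 1, p.1 2, p.1 3], ![p.2 4, p.2 0, p.2 1, p.2 2, p.2 3])
  invFun p := (![p.1 1, p.1 2, p.1 3, p.1 4, p.1 0], ![p.2 1, p.2 2, p.2 3, p.2 4, p.2 0])
  left_inv p := Prod.ext (tuple_eta p.1) (tuple_eta p.2)
  right_inv p := Prod.ext (tuple_eta p.1) (tuple_eta p.2)

/-- The exchange of the last row index with the last but one column index. -/
def swapPerm (n : ℕ) : Equiv.Perm (Tuple n × Tuple n) where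
  toFun p := (![p.1 0, p.1 1, p.1 2, p.1 3, p.2 3], ![p.2 0, p.2 1, p.2 2, p.1 4, p.2 4])
  invFun p := (![p.1 0, p.1 1, p.1 2, p.1 3, p.2 3], ![p.2 0, p.2 1, p.2 2, p.1 4, p.2 4])
  left_inv p := Prod.ext (tuple_eta p.1) (tuple_eta p.2)
  right_inv p := Prod.ext (tuple_eta p.1) (tuple_eta p.2)

/-- The exchange of the last but one row index with the last column index. -/
def swapPerm' (n : ℕ) : Equiv.Perm (Tuple n × Tuple n) where
  toFun p := (![p.1 0, p.1 1, p.1 2, p.2 4, p.1 4], ![p.2 0, p.2 1, p.2 2, p.2 3, p.1 3])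
  invFun p := (![p.1 0, p.1 1, p.1 2, p.2 4, p.1 4], ![p.2 0, p.2 1, p.2 2, p.2 3, p.1 3])
  left_inv p := Prod.ext (tuple_eta p.1) (tuple_eta p.2)
  right_inv p := Prod.ext (tuple_eta p.1) (tuple_eta p.2)

/-- The symmetries that are imposed on the moment matrix. The third is the second conjugated by
transposition, so that the gradient of the penalty is symmetric. -/
def momentSymm (n : ℕ) : Fin 3 → Equiv.Perm (Tuple n × Tuple n) :=
  ![cycPerm n, swapPerm n, swapPerm' n]

theorem penaltyGrad_momentSymm (S : Matrix (Tuple n) (Tuple n) ℝ) (a b : Tuple n) :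
    penaltyGrad (momentSymm n) S a b = 6 * S a b
      - S ![a 4, a 0, a 1, a 2, a 3] ![b 4, b 0, b 1, b 2, b 3]
      - S ![a 1, a 2, a 3, a 4, a 0] ![b 1, b 2, b 3, b 4, b 0]
      - 2 * S ![a 0, a 1, a 2, a 3, b 3] ![b 0, b 1, b 2, a 4, b 4]
      - 2 * S ![a 0, a 1, a 2, b 4, a 4] ![b 0, b 1, b 2, b 3, a 3] := by
  rw [penaltyGrad, of_apply, Fin.sum_univ_three]
  change 2 * S a b - S ![a 4, a 0, a 1, a 2, a 3] ![b 4, b 0, b 1, b 2, b 3]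
      - S ![a 1, a 2, a 3, a 4, a 0] ![b 1, b 2, b 3, b 4, b 0]
      + (2 * S a b - S ![a 0, a 1, a 2, a 3, b 3] ![b 0, b 1, b 2, a 4, b 4]
        - S ![a 0, a 1, a 2, a 3, b 3] ![b 0, b 1, b 2, a 4, b 4])
      + (2 * S a b - S ![a 0, a 1, a 2, b 4, a 4] ![b 0, b 1, b 2, b 3, a 3]
        - S ![a 0, a 1, a 2, b 4, a 4] ![b 0, b 1, b 2, b 3, a 3]) = _
  ring

theorem isHermitian_penaltyGrad_momentSymm {S : Matrix (Tuple n) (Tuple n) ℝ}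
    (hS : S.IsHermitian) : (penaltyGrad (momentSymm n) S).IsHermitian := by
  have h : ∀ a b, S a b = S b a := fun a b => by simpa using hS.apply b a
  refine IsHermitian.ext fun a b => ?_
  rw [star_trivial, penaltyGrad_momentSymm, penaltyGrad_momentSymm, h b a,
    h ![b 4, b 0, b 1, b 2, b 3], h ![b 1, b 2, b 3, b 4, b 0], h ![b 0, b 1, b 2, b 3, a 3],
    h ![b 0, b 1, b 2, a 4, b 4]]
  ring

/-- The projector `Q` acting on the last of five points. -/
def lastProj (Q : Matrix (Fin n) (Fin n) ℝ) : Matrix (Tuple n) (Tuple n) ℝ :=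
  of fun a b => if a 0 = b 0 ∧ a 1 = b 1 ∧ a 2 = b 2 ∧ a 3 = b 3 then Q (a 4) (b 4) else 0

theorem sum_lastProj_mul (Q : Matrix (Fin n) (Fin n) ℝ) (a : Tuple n) (f : Tuple n → ℝ) :
    ∑ c, lastProj Q a c * f c = ∑ x, Q (a 4) x * f ![a 0, a 1, a 2, a 3, x] := by
  rw [sum_tuple, Finset.sum_eq_single (![a 0, a 1, a 2, a 3] : Fin 4 → Fin n)]
  · exact Finset.sum_congr rfl fun x _ => by simp [lastProj]
  · intro ω _ hω
    refine Finset.sum_eq_zero fun x _ => ?_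
    rw [lastProj, of_apply, if_neg, zero_mul]
    rintro ⟨h0, h1, h2, h3⟩
    refine hω (funext fun i => ?_)
    fin_cases i
    exacts [h0.symm, h1.symm, h2.symm, h3.symm]
  · exact fun h => absurd (Finset.mem_univ _) h

theorem transpose_lastProj {Q : Matrix (Fin n) (Fin n) ℝ} (hQ : IsProjector n Q) :
    (lastProj Q)ᵀ = lastProj Q := by
  ext a b
  simp only [transpose_apply, lastProj, of_apply, hQ.symm (b 4) (a 4), eq_comm (a := b _)]

theorem lastProj_mul_apply (Q : Matrix (Fin n) (Fin n) ℝ) (M : Matrix (Tuple n) (Tuple n) ℝ)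
    (a b : Tuple n) :
    (lastProj Q * M) a b = ∑ x, Q (a 4) x * M ![a 0, a 1, a 2, a 3, x] b := by
  rw [mul_apply]
  exact sum_lastProj_mul Q a fun c => M c b

theorem mul_lastProj_apply {Q : Matrix (Fin n) (Fin n) ℝ} (hQ : IsProjector n Q)
    (M : Matrix (Tuple n) (Tuple n) ℝ) (a b : Tuple n) :
    (M * lastProj Q) a b = ∑ x, M a ![b 0, b 1, b 2, b 3, x] * Q x (b 4) := by
  have h : ∀ c, lastProj Q c b = lastProj Q b c := fun c =>
    congrFun (congrFun (transpose_lastProj hQ) b) c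
  simp only [mul_apply, h, mul_comm (M a _)]
  rw [sum_lastProj_mul Q b fun c => M a c]
  exact Finset.sum_congr rfl fun x _ => by rw [hQ.symm, mul_comm]

theorem lastProj_mul_self {Q : Matrix (Fin n) (Fin n) ℝ} (hQ : IsProjector n Q) :
    lastProj Q * lastProj Q = lastProj Q := by
  ext a b
  rw [lastProj_mul_apply]
  simp only [lastProj, of_apply]
  by_cases h : a 0 = b 0 ∧ a 1 = b 1 ∧ a 2 = b 2 ∧ a 3 = b 3
  · simp only [cons_val, h, and_self, if_true]
    rw [← mul_apply, hQ.2]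
  · rw [if_neg h]
    refine Finset.sum_eq_zero fun x _ => ?_
    simp only [cons_val]
    exact (congrArg _ (if_neg h)).trans (mul_zero _)

/-- The fifth tensor power of a function. -/
def tensorFive (F : Fin n → ℝ) (a : Tuple n) : ℝ :=
  F (a 0) * F (a 1) * F (a 2) * F (a 3) * F (a 4)

theorem lastProj_mulVec_tensorFive {Q : Matrix (Fin n) (Fin n) ℝ} {F : Fin n → ℝ}
    (hF : Q *ᵥ F = F) : lastProj Q *ᵥ tensorFive F = tensorFive F := by
  ext a
  change ∑ c, lastProj Q a c * tensorFive F c = _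
  rw [sum_lastProj_mul]
  have : ∑ x, Q (a 4) x * F x = F (a 4) := congrFun hF (a 4)
  rw [tensorFive, ← this, Finset.mul_sum]
  refine Finset.sum_congr rfl fun x _ => ?_
  simp only [tensorFive, cons_val]
  ring

theorem tensorFive_momentSymm (F : Fin n → ℝ) (i : Fin 3) (p : Tuple n × Tuple n) :
    tensorFive F (momentSymm n i p).1 * tensorFive F (momentSymm n i p).2
      = tensorFive F p.1 * tensorFive F p.2 := by
  fin_cases i
  · change tensorFive F ![p.1 4, p.1 0, p.1 1, p.1 2, p.1 3]
      * tensorFive F ![p.2 4, p.2 0, p.2 1, p.2 2, p.2 3] = _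
    simp only [tensorFive, cons_val]; ring
  · change tensorFive F ![p.1 0, p.1 1, p.1 2, p.1 3, p.2 3]
      * tensorFive F ![p.2 0, p.2 1, p.2 2, p.1 4, p.2 4] = _
    simp only [tensorFive, cons_val]; ring
  · change tensorFive F ![p.1 0, p.1 1, p.1 2, p.2 4, p.1 4]
      * tensorFive F ![p.2 0, p.2 1, p.2 2, p.2 3, p.1 3] = _
    simp only [tensorFive, cons_val]; ring

/-- The objective: the absolute value of the tensor `quad` on the first four points. -/
noncomputable def quadObjective (Q : Matrix (Fin n) (Fin n) ℝ) (a : Tuple n) : ℝ :=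
  |quad Q ![a 0, a 1, a 2, a 3]|

theorem vec_four_eta (ω : Fin 4 → Fin n) : ![ω 0, ω 1, ω 2, ω 3] = ω := by
  ext i; fin_cases i <;> rfl

theorem sum_quadObjective_mul (Q : Matrix (Fin n) (Fin n) ℝ) (p : Tuple n → ℝ) :
    ∑ a, quadObjective Q a * p a = ∑ ω, |quad Q ω| * ∑ x, p ![ω 0, ω 1, ω 2, ω 3, x] := by
  rw [sum_tuple]
  simp only [Finset.mul_sum, quadObjective, cons_val, vec_four_eta]

theorem sum_tensorFive_sq (F : Fin n → ℝ) : ∑ a, tensorFive F a ^ 2 = (∑ u, F u ^ 2) ^ 5 := by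
  rw [Fintype.sum_pow]
  refine Fintype.sum_congr _ _ fun a => ?_
  rw [Fin.prod_univ_five, tensorFive]
  ring

theorem sum_quadObjective_mul_tensorFive_sq (Q : Matrix (Fin n) (Fin n) ℝ) (F : Fin n → ℝ) :
    ∑ a, quadObjective Q a * tensorFive F a ^ 2
      = (∑ ω, |quad Q ω| * ∏ j, F (ω j) ^ 2) * ∑ u, F u ^ 2 := by
  rw [sum_quadObjective_mul Q fun a => tensorFive F a ^ 2, Finset.sum_mul]
  refine Finset.sum_congr rfl fun ω _ => ?_
  rw [mul_assoc]
  congr 1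
  rw [Finset.mul_sum]
  refine Finset.sum_congr rfl fun x _ => ?_
  simp only [tensorFive, cons_val, Fin.prod_univ_four]
  ring

/-- The accumulator after `t` iterations on the input `Q`. -/
noncomputable def accumulator (Q : Matrix (Fin n) (Fin n) ℝ) (V ρ : ℝ) (N t : ℕ) :
    Matrix (Tuple n) (Tuple n) ℝ :=
  (driftStep (momentSymm n) (quadObjective Q) (lastProj Q) V ρ N)^[t] 0

theorem driftInvariant_accumulator {Q : Matrix (Fin n) (Fin n) ℝ} (hQ : IsProjector n Q)
    {f : Fin n → ℝ} (hf : IsNearlyIn (1 / 4) Q f) {V ρ : ℝ} {N T : ℕ} (hV : 0 ≤ V) (hρ0 : 0 < ρ)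
    (hρ : 12 * T * n ^ 5 ≤ ρ) (hN0 : N ≠ 0) (hN : n ^ 5 * (ρ + V * n) ^ 2 ≤ N) {t : ℕ}
    (ht : t ≤ T) :
    DriftInvariant (momentSymm n) (quadObjective Q) (lastProj Q) V
      (1 / (4 ^ 8 * (∑ u, f u) ^ 3)) t (accumulator Q V ρ N t) := by
  set k := ∑ u, f u with hk
  set F := Q *ᵥ f with hF
  have hk0 : 0 < k := hf.sum_pos
  have hs0 : 0 < ∑ u, F u ^ 2 := lt_of_lt_of_le (by positivity) hf.sum_sq_ge
  have hsk : ∑ u, F u ^ 2 ≤ k := (hQ.sum_sq_mulVec_le f).trans (le_of_eq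
    (Finset.sum_congr rfl fun u _ => hf.1.sq_eq u))
  have hcard : (Fintype.card (Tuple n) : ℝ) = n ^ 5 := by simp
  induction t with
  | zero => exact driftInvariant_zero _ _ _ _ _
  | succ t ih =>
    rw [accumulator, Function.iterate_succ_apply']
    refine (ih (by omega)).step (K := n) (T := T) (φ := tensorFive F)
      (fun S hS => isHermitian_penaltyGrad_momentSymm hS) (transpose_lastProj hQ)
      (lastProj_mul_self hQ) (fun a => abs_nonneg _) (fun a => abs_quad_le hQ _) hV (by positivity)
      ?_ (lastProj_mulVec_tensorFive (hQ.mulVec_mulVec f)) (tensorFive_momentSymm F) ?_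
      (by omega) hρ0 ?_ hN0 (by rw [hcard]; exact hN)
    · intro h0
      have := sum_tensorFive_sq F
      rw [h0] at this
      simp only [Pi.zero_apply, ne_eq, OfNat.ofNat_ne_zero, not_false_eq_true, zero_pow,
        Finset.sum_const_zero] at this
      exact (pow_pos hs0 5).ne this
    · rw [sum_tensorFive_sq, sum_quadObjective_mul_tensorFive_sq]
      have h1 := hf.sum_abs_quad_ge hQ
      have h2 := pow_le_pow_left₀ hs0.le hsk 4
      refine le_trans ?_ (mul_le_mul_of_nonneg_right h1 hs0.le)
      rw [one_div, inv_mul_eq_div, div_le_iff₀ (by positivity)]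
      calc (∑ u, F u ^ 2) ^ 5 = (∑ u, F u ^ 2) ^ 4 * ∑ u, F u ^ 2 := by ring
        _ ≤ k ^ 4 * ∑ u, F u ^ 2 := by gcongr
        _ = _ := by rw [← hk]; field_simp
    · rw [hcard, Fintype.card_fin]
      refine le_trans (le_of_eq ?_) hρ
      push_cast
      ring

/-- The moments `E[F(v₁)² ⋯ F(v₅)²]` read off from a moment matrix, in a way that makes the slices
in the last two arguments positive semidefinite. -/
def squareMoment (Z : Matrix (Tuple n) (Tuple n) ℝ) : List (Fin n) → ℝ
  | [v₁, v₂, v₃, x, u] => Z ![v₁, v₂, v₃, x, x] ![v₁, v₂, v₃, u, u]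
  | _ => 0

theorem posSemidef_squareMoment {Z : Matrix (Tuple n) (Tuple n) ℝ} (hZ : Z.PosSemidef)
    (l : List (Fin n)) (hl : l.length = 3) :
    (Matrix.of fun x u => squareMoment Z (l ++ [x, u])).PosSemidef := by
  obtain ⟨v₁, v₂, v₃, rfl⟩ := List.length_eq_three.1 hl
  exact hZ.submatrix fun x : Fin n => (![v₁, v₂, v₃, x, x] : Tuple n)

end Tuple

end ASVP

namespace ASVP

open Matrix

/-! ### Extraction of an analytically sparse matrix from the accumulator -/

section Extraction

variable {n : ℕ} {Q : Matrix (Fin n) (Fin n) ℝ}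

/-- If no candidate is analytically sparse, an almost symmetric moment matrix of trace one has a
small objective. -/
theorem sum_quadObjective_mul_le (hQ : IsProjector n Q) {A η : ℝ} (hA : 0 ≤ A) (hA1 : A ≤ 1)
    (hη : 0 ≤ η) (hdiag : ∑ u, Q u u ^ 2 ≤ A * (∑ u, Q u u) ^ 2)
    (hcol : ∀ u, ∑ v, Q u v ^ 4 ≤ A * Q u u ^ 2)
    {Z : Matrix (Tuple n) (Tuple n) ℝ} (hZ : Z.PosSemidef) (htr : Z.trace = 1)
    (hdev : ∀ i p, |dev (momentSymm n i) Z p| ≤ η)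
    (hrow : ∀ ω : Fin 4 → Fin n, ∑ x, Z ![ω 0, ω 1, ω 2, ω 3, x] ![ω 0, ω 1, ω 2, ω 3, x] ^ 2
      ≤ A * (∑ x, Z ![ω 0, ω 1, ω 2, ω 3, x] ![ω 0, ω 1, ω 2, ω 3, x]) ^ 2) :
    ∑ a, quadObjective Q a * Z a a
      ≤ A ^ 3 * Q.rank * (1 + n ^ 5 * η) + 301 * n ^ 9 * (2 * n * η + 3 * η) + n ^ 6 * η := by
  set W := squareMoment Z with hW
  have hswap : ∀ v₁ v₂ v₃ x u : Fin n,
      |W [v₁, v₂, v₃, x, u] - Z ![v₁, v₂, v₃, x, u] ![v₁, v₂, v₃, x, u]| ≤ η :=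
    fun v₁ v₂ v₃ x u => by
      rw [abs_sub_comm]
      exact hdev 1 (![v₁, v₂, v₃, x, u], ![v₁, v₂, v₃, x, u])
  have hcyc : ∀ (l : List (Fin n)) (x : Fin n), l.length = 4 →
      |W (l ++ [x]) - W (x :: l)| ≤ 3 * η := fun l x hl => by
    obtain ⟨v₁, v₂, v₃, v₄, rfl⟩ : ∃ v₁ v₂ v₃ v₄, l = [v₁, v₂, v₃, v₄] := by
      match l, hl with
      | [a, b, c, d], _ => exact ⟨a, b, c, d, rfl⟩
    have h1 := abs_le.1 (hswap v₁ v₂ v₃ v₄ x)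
    have h2 := abs_le.1 (hswap x v₁ v₂ v₃ v₄)
    have h3 : |Z ![v₁, v₂, v₃, v₄, x] ![v₁, v₂, v₃, v₄, x]
      - Z ![x, v₁, v₂, v₃, v₄] ![x, v₁, v₂, v₃, v₄]| ≤ η :=
      hdev 0 (![v₁, v₂, v₃, v₄, x], ![v₁, v₂, v₃, v₄, x])
    have h3 := abs_le.1 h3
    change |W [v₁, v₂, v₃, v₄, x] - W [x, v₁, v₂, v₃, v₄]| ≤ _
    rw [abs_le]
    constructor <;> linarith
  have hA' : √A ≤ 1 := Real.sqrt_le_one.2 hA1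
  have hrow' : ∀ l : List (Fin n), l.length = 4 →
      nrm (fun x => W (l ++ [x])) ≤ √A * ∑ x, W (l ++ [x]) + 2 * n * η := fun l hl => by
    obtain ⟨v₁, v₂, v₃, v₄, rfl⟩ : ∃ v₁ v₂ v₃ v₄, l = [v₁, v₂, v₃, v₄] := by
      match l, hl with
      | [a, b, c, d], _ => exact ⟨a, b, c, d, rfl⟩
    have h1 := nrm_le_add_of_abs_sub_le hη fun x => hswap v₁ v₂ v₃ v₄ x
    have h2 := abs_le.1 (abs_sum_sub_sum_le fun x => hswap v₁ v₂ v₃ v₄ x)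
    rw [Fintype.card_fin] at h1 h2
    have h3 : nrm (fun x => Z ![v₁, v₂, v₃, v₄, x] ![v₁, v₂, v₃, v₄, x])
        ≤ √A * ∑ x, Z ![v₁, v₂, v₃, v₄, x] ![v₁, v₂, v₃, v₄, x] := by
      refine nrm_le_of_sq_le (mul_nonneg (Real.sqrt_nonneg _)
        (Finset.sum_nonneg fun x _ => hZ.diag_nonneg)) ?_
      rw [mul_pow, Real.sq_sqrt hA]
      exact hrow ![v₁, v₂, v₃, v₄]
    have h4 := mul_le_mul_of_nonneg_left h2.1 (Real.sqrt_nonneg A)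
    have h5 : √A * (n * η) ≤ 1 * (n * η) := by gcongr
    change nrm (fun x => W [v₁, v₂, v₃, v₄, x]) ≤ √A * ∑ x, W [v₁, v₂, v₃, v₄, x] + _
    linarith
  have hmain := sum_mul_abs_quad_le hQ hA hA1 (by positivity : 0 ≤ 2 * n * η)
    (by positivity : 0 ≤ 3 * η) hdiag hcol (posSemidef_squareMoment hZ) hcyc hrow'
  have htuple : ∀ a : Tuple n, |W (List.ofFn a) - Z a a| ≤ η := fun a => by
    have := hswap (a 0) (a 1) (a 2) (a 3) (a 4)
    rwa [tuple_eta] at this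
  have hcard : (Fintype.card (Tuple n) : ℝ) = n ^ 5 := by simp
  have hmass : |∑ a : Tuple n, W (List.ofFn a)| ≤ 1 + n ^ 5 * η := by
    have h1 := abs_le.1 (abs_sum_sub_sum_le htuple)
    have h2 : ∑ a, Z a a = 1 := htr
    have h3 : (0 : ℝ) ≤ n ^ 5 * η := by positivity
    rw [h2, hcard] at h1
    rw [abs_le]
    constructor <;> linarith
  have hobj : ∑ a, quadObjective Q a * Z a a
      ≤ ∑ ω : Fin 4 → Fin n, (∑ u, W (List.ofFn ω ++ [u])) * |quad Q ω| + n ^ 6 * η := by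
    have h1 : ∑ ω : Fin 4 → Fin n, (∑ u, W (List.ofFn ω ++ [u])) * |quad Q ω|
        = ∑ a, quadObjective Q a * W (List.ofFn a) := by
      rw [sum_quadObjective_mul Q fun a => W (List.ofFn a)]
      exact Finset.sum_congr rfl fun ω _ => mul_comm _ _
    have h2 : ∑ a : Tuple n, (n : ℝ) * η = n ^ 6 * η := by
      rw [Finset.sum_const, Finset.card_univ, nsmul_eq_mul, hcard]; ring
    rw [h1, ← h2, ← Finset.sum_add_distrib]
    refine Finset.sum_le_sum fun a _ => ?_
    have h3 := abs_le.1 (htuple a)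
    have h4 : quadObjective Q a ≤ n := abs_quad_le hQ _
    have h5 : 0 ≤ quadObjective Q a := abs_nonneg _
    have h6 := mul_le_mul_of_nonneg_left (by linarith : Z a a ≤ W (List.ofFn a) + η) h5
    have h7 := mul_le_mul_of_nonneg_right h4 hη
    linarith
  have h8 := mul_le_mul_of_nonneg_left hmass
    (by positivity : (0 : ℝ) ≤ A ^ 3 * Q.rank)
  linarith

theorem apply_lastProj_mul {Z : Matrix (Tuple n) (Tuple n) ℝ} (h : lastProj Q * Z = Z)
    (v₁ v₂ v₃ v₄ : Fin n) (b : Tuple n) :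
    Q *ᵥ (fun x => Z ![v₁, v₂, v₃, v₄, x] b) = fun x => Z ![v₁, v₂, v₃, v₄, x] b := by
  ext x
  conv_rhs => rw [← h]
  rw [lastProj_mul_apply]
  rfl

/-- The parameters of the algorithm are powers of `n + 2`. -/
theorem driftInvariant_accumulator_pow (hQ : IsProjector n Q) {f : Fin n → ℝ}
    (hf : IsNearlyIn (1 / 4) Q f) {m : ℝ} (hm : m = n + 2) {T N : ℕ} (hT : (T : ℝ) = m ^ 110)
    (hN : m ^ 250 ≤ N) :
    DriftInvariant (momentSymm n) (quadObjective Q) (lastProj Q) (m ^ 20)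
      (1 / (4 ^ 8 * (∑ u, f u) ^ 3)) T (accumulator Q (m ^ 20) (m ^ 120) N T) := by
  have hn1 : (1 : ℝ) ≤ n := by exact_mod_cast hf.pos
  have hm3 : 3 ≤ m := by linarith
  have hm1 : 1 ≤ m := by linarith
  have hnm : (n : ℝ) ≤ m := by linarith
  have hpow : ∀ {i j : ℕ}, i ≤ j → m ^ i ≤ m ^ j := fun h => pow_le_pow_right₀ hm1 h
  have h3pow : ∀ i : ℕ, (3 : ℝ) ^ i ≤ m ^ i := fun i => pow_le_pow_left₀ (by norm_num) hm3 i
  have hn5 : (n : ℝ) ^ 5 ≤ m ^ 5 := pow_le_pow_left₀ (by linarith) hnm 5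
  refine driftInvariant_accumulator hQ hf (by positivity) (by positivity) ?_ ?_ ?_ le_rfl
  · rw [hT]
    calc 12 * m ^ 110 * n ^ 5 ≤ m ^ 5 * m ^ 110 * m ^ 5 := by
          gcongr
          linarith [h3pow 5]
      _ = m ^ 120 := by ring
  · rintro rfl
    have : 0 < m ^ 250 := by positivity
    simp at hN
    linarith
  · refine le_trans ?_ hN
    have h1 : m ^ 20 * n ≤ m ^ 120 := by
      calc m ^ 20 * n ≤ m ^ 20 * m ^ 100 := by
            gcongr
            exact hnm.trans (by simpa using hpow (show 1 ≤ 100 by norm_num))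
        _ = m ^ 120 := by ring
    calc (n : ℝ) ^ 5 * (m ^ 120 + m ^ 20 * n) ^ 2 ≤ m ^ 5 * (m ^ 120 + m ^ 120) ^ 2 := by gcongr
      _ = 4 * m ^ 245 := by ring
      _ ≤ m ^ 5 * m ^ 245 := by gcongr; linarith [h3pow 5]
      _ = m ^ 250 := by ring

/-- For a nearly contained Boolean function, one of the candidates produced from the input and
the final accumulator is analytically sparse. -/
theorem exists_candidate (hQ : IsProjector n Q) {f : Fin n → ℝ} (hf : IsNearlyIn (1 / 4) Q f)
    {m : ℝ} (hm : m = n + 2) {T N : ℕ} (hT : (T : ℝ) = m ^ 110) (hN : m ^ 250 ≤ N)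
    {A : ℝ} (hA : A = 1 / 64 * level (expect f) Q) :
    A * (∑ u, Q u u) ^ 2 < ∑ u, Q u u ^ 2 ∨ (∃ u, A * Q u u ^ 2 < ∑ v, Q u v ^ 4) ∨
    ∃ ω : Fin 4 → Fin n,
      A * (∑ x, accumulator Q (m ^ 20) (m ^ 120) N T
        ![ω 0, ω 1, ω 2, ω 3, x] ![ω 0, ω 1, ω 2, ω 3, x]) ^ 2
      < ∑ x, accumulator Q (m ^ 20) (m ^ 120) N T
        ![ω 0, ω 1, ω 2, ω 3, x] ![ω 0, ω 1, ω 2, ω 3, x] ^ 2 := by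
  by_contra! hcon
  obtain ⟨hdiag, hcol, hrow⟩ := hcon
  set S := accumulator Q (m ^ 20) (m ^ 120) N T with hS
  set k := ∑ u, f u with hk
  have hn1 : (1 : ℝ) ≤ n := by exact_mod_cast hf.pos
  have hm3 : 3 ≤ m := by linarith
  have hm1 : 1 ≤ m := by linarith
  have hnm : (n : ℝ) ≤ m := by linarith
  have hpow : ∀ {i j : ℕ}, i ≤ j → m ^ i ≤ m ^ j := fun h => pow_le_pow_right₀ hm1 h
  have h3pow : ∀ i : ℕ, (3 : ℝ) ^ i ≤ m ^ i := fun i => pow_le_pow_left₀ (by norm_num) hm3 i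
  have hinv : DriftInvariant (momentSymm n) (quadObjective Q) (lastProj Q) (m ^ 20)
      (1 / (4 ^ 8 * k ^ 3)) T S := driftInvariant_accumulator_pow hQ hf hm hT hN
  have hT0 : (0 : ℝ) < T := by rw [hT]; positivity
  have hk0 : 0 < k := hf.sum_pos
  have hkn : k ≤ n := by
    calc k ≤ ∑ _u : Fin n, (1 : ℝ) := Finset.sum_le_sum fun u _ => by
          rcases hf.1 u with h | h <;> simp [h]
      _ = n := by simp
  have hk1 : 1 ≤ k := by
    obtain ⟨u, hu⟩ : ∃ u, f u ≠ 0 := Function.ne_iff.1 hf.2.1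
    have := Finset.single_le_sum (f := f) (fun v _ => hf.1.nonneg v) (Finset.mem_univ u)
    rwa [(hf.1 u).resolve_left hu] at this
  have hnk : n * expect f = k := by
    rw [expect, ← hk]; field_simp
  have hobjS : ∑ a, quadObjective Q a * S a a ≤ n * T := by
    rw [← hinv.trace_eq, Matrix.trace, Finset.mul_sum]
    exact Finset.sum_le_sum fun a _ =>
      mul_le_mul_of_nonneg_right (abs_quad_le hQ _) hinv.posSemidef.diag_nonneg
  have hpen := hinv.penalty_le
  rw [Fintype.card_fin] at hpen
  set pen := ∑ i, ∑ p, dev (momentSymm n i) S p ^ 2 with hpendef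
  have hpen0 : 0 ≤ pen := Finset.sum_nonneg fun i _ => Finset.sum_nonneg fun p _ => sq_nonneg _
  set opt := 1 / (4 ^ 8 * k ^ 3) with hopt
  have hopt0 : 0 < opt := by positivity
  set Z : Matrix (Tuple n) (Tuple n) ℝ := (T : ℝ)⁻¹ • S with hZ
  have hZpsd : Z.PosSemidef := hinv.posSemidef.smul (inv_nonneg.2 hT0.le)
  have hZtr : Z.trace = 1 := by
    rw [hZ, trace_smul, hinv.trace_eq, smul_eq_mul, inv_mul_cancel₀ hT0.ne']
  set η := 1 / m ^ 40 with hη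
  have hη0 : 0 ≤ η := by positivity
  have hdev : ∀ i p, |dev (momentSymm n i) Z p| ≤ η := fun i p => by
    have h1 : dev (momentSymm n i) S p ^ 2 ≤ pen :=
      (Finset.single_le_sum (f := fun p => dev (momentSymm n i) S p ^ 2)
        (fun _ _ => sq_nonneg _) (Finset.mem_univ p)).trans
      (Finset.single_le_sum (f := fun i => ∑ p, dev (momentSymm n i) S p ^ 2)
        (fun _ _ => Finset.sum_nonneg fun _ _ => sq_nonneg _) (Finset.mem_univ i))
    have h2 : dev (momentSymm n i) Z p = dev (momentSymm n i) S p / T := by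
      simp only [dev, hZ, Matrix.smul_apply, smul_eq_mul]
      field_simp
    have h3 : pen ≤ m ^ 30 * T := by
      have h4 : 2 * m ^ 20 * (∑ a, quadObjective Q a * S a a) ≤ 2 * m ^ 20 * (m * T) := by
        gcongr
        exact hobjS.trans (by gcongr)
      have h5 : 0 ≤ T * (2 * m ^ 20 * opt) := by positivity
      have h6 : 2 * m ^ 21 + 14 ≤ m ^ 30 := by
        have h7 : (14 : ℝ) ≤ 14 * m ^ 21 := by
          linarith [one_le_pow₀ (n := 21) hm1]
        calc 2 * m ^ 21 + 14 ≤ m ^ 21 * 16 := by linarith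
          _ ≤ m ^ 21 * m ^ 9 := by gcongr; linarith [h3pow 9]
          _ = m ^ 30 := by ring
      have h8 := mul_le_mul_of_nonneg_right h6 hT0.le
      push_cast at hpen
      linarith
    refine abs_le_of_sq_le_sq ?_ hη0
    rw [h2, div_pow, hη, div_pow, one_pow, div_le_div_iff₀ (by positivity) (by positivity), one_mul]
    calc dev (momentSymm n i) S p ^ 2 * (m ^ 40) ^ 2 ≤ m ^ 30 * T * (m ^ 40) ^ 2 := by
          gcongr; linarith
      _ = m ^ 110 * T := by ring
      _ = (T : ℝ) ^ 2 := by rw [← hT]; ring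
  have hrk : (1 : ℝ) ≤ Q.rank := by
    have h1 : Q.rank ≠ 0 := fun h0 => by
      have h2 := hf.sum_sq_ge
      simp only [mulVec, dotProduct, hQ.apply_eq_zero_of_rank_eq_zero h0, zero_mul,
        Finset.sum_const_zero, zero_pow two_ne_zero] at h2
      linarith
    exact_mod_cast Nat.one_le_iff_ne_zero.2 h1
  have hlev0 : 0 ≤ level (expect f) Q := by
    rw [level, hnk]; positivity
  have hA0 : 0 ≤ A := by rw [hA]; positivity
  have hA3 : A ^ 3 * Q.rank = opt / 4 := by
    rw [hA, mul_pow, level_pow_three, hnk, hopt]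
    field_simp
    norm_num
  have hA1 : A ≤ 1 := by
    have h1 : level (expect f) Q ≤ 1 := by
      rw [level, hnk, div_le_one (by positivity)]
      exact one_le_mul_of_one_le_of_one_le hk1 (Real.one_le_rpow hrk (by norm_num))
    rw [hA]; linarith
  have hmain := sum_quadObjective_mul_le hQ hA0 hA1 hη0 hdiag hcol hZpsd hZtr hdev fun ω => by
    simp only [hZ, Matrix.smul_apply, smul_eq_mul, mul_pow, ← Finset.mul_sum]
    have := mul_le_mul_of_nonneg_left (hrow ω) (sq_nonneg (T : ℝ)⁻¹)
    linarith
  have hobjZ : opt - 7 / m ^ 20 ≤ ∑ a, quadObjective Q a * Z a a := by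
    have h1 : ∑ a, quadObjective Q a * Z a a = (∑ a, quadObjective Q a * S a a) / T := by
      rw [Finset.sum_div]
      refine Finset.sum_congr rfl fun a _ => ?_
      rw [hZ, Matrix.smul_apply, smul_eq_mul]
      field_simp
    rw [h1, le_div_iff₀ hT0]
    have h2 : 0 ≤ m ^ 20 * ((∑ a, quadObjective Q a * S a a) - (opt - 7 / m ^ 20) * T) := by
      have : m ^ 20 * ((∑ a, quadObjective Q a * S a a) - (opt - 7 / m ^ 20) * T)
          = m ^ 20 * (∑ a, quadObjective Q a * S a a) - T * (m ^ 20 * opt - 7) := by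
        field_simp
      rw [this]
      push_cast at hpen
      linarith
    have := nonneg_of_mul_nonneg_right h2 (by positivity)
    linarith
  rw [hA3] at hmain
  -- the error terms, with `opt ≥ 1 / (4 ^ 8 * m ^ 3)`
  have hopt1 : 1 / (4 ^ 8 * m ^ 3) ≤ opt := by
    rw [hopt]
    gcongr
    linarith
  have hopt2 : opt ≤ 1 := by
    rw [hopt, div_le_one (by positivity)]
    have := one_le_pow₀ (n := 3) hk1
    linarith
  have herr : ∀ i ≤ 10, (n : ℝ) ^ i * η ≤ m ^ 10 * η := fun i hi => by
    gcongr
    exact (pow_le_pow_left₀ (by linarith) hnm i).trans (hpow hi)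
  have e1 : 7 / m ^ 20 ≤ 1 / 4 * (1 / (4 ^ 8 * m ^ 3)) := by
    have h1 : (7 : ℝ) * 4 ^ 9 ≤ m ^ 17 := le_trans (by norm_num) (h3pow 17)
    rw [← mul_div_assoc, mul_one, div_div, div_le_div_iff₀ (by positivity) (by positivity)]
    calc 7 * (4 * (4 ^ 8 * m ^ 3)) = 7 * 4 ^ 9 * m ^ 3 := by ring
      _ ≤ m ^ 17 * m ^ 3 := by gcongr
      _ = 1 * m ^ 20 := by ring
  have e2 : 1507 * (m ^ 10 * η) ≤ 1 / 4 * (1 / (4 ^ 8 * m ^ 3)) := by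
    have h1 : (1507 : ℝ) * 4 ^ 9 ≤ m ^ 27 := le_trans (by norm_num) (h3pow 27)
    rw [hη, ← mul_div_assoc, ← mul_div_assoc, ← mul_div_assoc, mul_one, mul_one, div_div,
      div_le_div_iff₀ (by positivity) (by positivity)]
    calc 1507 * m ^ 10 * (4 * (4 ^ 8 * m ^ 3)) = 1507 * 4 ^ 9 * m ^ 13 := by ring
      _ ≤ m ^ 27 * m ^ 13 := by gcongr
      _ = 1 * m ^ 40 := by ring
  have e3 := herr 5 (by norm_num)
  have e4 := herr 9 (by norm_num)
  have e5 := herr 10 (by norm_num)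
  have e6 := herr 6 (by norm_num)
  have e7 : opt / 4 * (n ^ 5 * η) ≤ 1 * (n ^ 5 * η) := by gcongr; linarith
  have e8 : 301 * (n : ℝ) ^ 9 * (2 * n * η + 3 * η) = 602 * (n ^ 10 * η) + 903 * (n ^ 9 * η) := by
    ring
  have e9 : 0 < 1 / (4 ^ 8 * m ^ 3) := by positivity
  rw [e8] at hmain
  linarith

end Extraction

end ASVP

namespace ASVP

open Matrix

/-! ### Derandomized rounding of a positive semidefinite matrix -/

section Rounding

variable {n : ℕ}

/-- The pessimistic estimator of the rounding: the conditional expectation of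
`∑ u, G u ^ 4 - κ * (∑ u, G u ^ 2) ^ 2` for a Gaussian function `G` with mean `g` and covariance
`C`, up to an upper bound for the subtracted term. -/
noncomputable def roundPotential (κ : ℝ) (g : Fin n → ℝ) (C : Matrix (Fin n) (Fin n) ℝ) : ℝ :=
  ∑ u, (g u ^ 4 + 6 * (g u ^ 2 * C u u) + C u u ^ 2)
    - κ * ((∑ u, g u ^ 2) ^ 2 + 6 * ((∑ u, g u ^ 2) * ∑ u, C u u) + 3 * (∑ u, C u u) ^ 2)

/-- The function split off from the covariance `C` at the pivot `i`. It vanishes if the pivot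
does, by the convention for division by zero. -/
noncomputable def pivotFun (C : Matrix (Fin n) (Fin n) ℝ) (i u : Fin n) : ℝ := C u i / √(C i i)

/-- The covariance that remains. -/
noncomputable def pivotRest (C : Matrix (Fin n) (Fin n) ℝ) (i : Fin n) :
    Matrix (Fin n) (Fin n) ℝ :=
  of fun u v => C u v - pivotFun C i u * pivotFun C i v

/-- One step of the rounding: the function at the pivot is added with the better sign. -/
noncomputable def roundStep (κ : ℝ) (s : Matrix (Fin n) (Fin n) ℝ × (Fin n → ℝ)) (i : Fin n) :
    Matrix (Fin n) (Fin n) ℝ × (Fin n → ℝ) :=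
  (pivotRest s.1 i,
    if roundPotential κ (fun u => s.2 u - pivotFun s.1 i u) (pivotRest s.1 i)
      < roundPotential κ (fun u => s.2 u + pivotFun s.1 i u) (pivotRest s.1 i)
    then fun u => s.2 u + pivotFun s.1 i u else fun u => s.2 u - pivotFun s.1 i u)

/-- The ratio between the variance of the fourth powers and the square of the total variance. -/
noncomputable def sparsityRatio (P : Matrix (Fin n) (Fin n) ℝ) : ℝ :=
  (∑ u, P u u ^ 2) / (6 * (∑ u, P u u) ^ 2)

/-- The function obtained by rounding a positive semidefinite matrix. -/
noncomputable def signRound (P : Matrix (Fin n) (Fin n) ℝ) : Fin n → ℝ :=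
  ((List.finRange n).foldl (roundStep (sparsityRatio P)) (P, fun _ => 0)).2

theorem pivotFun_mul_self_mul {C : Matrix (Fin n) (Fin n) ℝ} (hC : C.PosSemidef) (i u v : Fin n) :
    pivotFun C i u * pivotFun C i v = C u i * C v i / C i i := by
  rw [pivotFun, pivotFun, div_mul_div_comm, Real.mul_self_sqrt hC.diag_nonneg]

theorem posSemidef_pivotRest {C : Matrix (Fin n) (Fin n) ℝ} (hC : C.PosSemidef) (i : Fin n) :
    (pivotRest C i).PosSemidef := by
  have hsym : ∀ u v, C u v = C v u := fun u v => by simpa using hC.1.apply v u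
  refine .of_dotProduct_mulVec_nonneg (IsHermitian.ext fun u v => ?_) fun x => ?_
  · rw [star_trivial, pivotRest, of_apply, of_apply, hsym u v]
    ring
  rw [star_trivial]
  set r := ∑ u, C u i * x u with hr
  have h1 : x ⬝ᵥ pivotRest C i *ᵥ x = x ⬝ᵥ C *ᵥ x - r ^ 2 / C i i := by
    rw [dotProduct_mulVec_eq_sum, dotProduct_mulVec_eq_sum, hr, sq, Finset.sum_mul_sum,
      ← Fintype.sum_prod_type', Finset.sum_div, ← Finset.sum_sub_distrib]
    refine Finset.sum_congr rfl fun p _ => ?_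
    rw [pivotRest, of_apply, pivotFun_mul_self_mul hC]
    ring
  rw [h1]
  rcases hC.diag_nonneg.eq_or_lt with h0 | h0
  · rw [← h0, div_zero, sub_zero]
    exact hC.dotProduct_mulVec_nonneg x
  -- the value of the quadratic form of `C` after clearing the `i`-th coordinate
  have h2 := hC.dotProduct_mulVec_nonneg (x - Pi.single i (r / C i i))
  rw [star_trivial, mulVec_sub, sub_dotProduct, dotProduct_sub, dotProduct_sub] at h2
  have h3 : (Pi.single i (r / C i i) : Fin n → ℝ) ⬝ᵥ C *ᵥ x = r / C i i * r := by
    rw [single_dotProduct, hr]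
    congr 1
    change ∑ u, C i u * x u = _
    exact Finset.sum_congr rfl fun u _ => by rw [hsym i u]
  have h4 : x ⬝ᵥ C *ᵥ Pi.single i (r / C i i) = r / C i i * r := by
    rw [← h3, dotProduct_mulVec, ← mulVec_transpose, dotProduct_comm]
    congr 2
    ext u v; exact hsym v u
  have h5 : (Pi.single i (r / C i i) : Fin n → ℝ) ⬝ᵥ C *ᵥ Pi.single i (r / C i i)
      = r / C i i * r := by
    rw [single_dotProduct, mulVec_single]
    simp only [Pi.smul_apply, col_apply, MulOpposite.smul_eq_mul_unop, MulOpposite.unop_op]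
    field_simp
  rw [h3, h4, h5] at h2
  have : r / C i i * r = r ^ 2 / C i i := by ring
  linarith

theorem pivotRest_apply_self {C : Matrix (Fin n) (Fin n) ℝ} (hC : C.PosSemidef) (i u : Fin n) :
    pivotRest C i u i = 0 := by
  rw [pivotRest, of_apply, pivotFun_mul_self_mul hC]
  rcases (hC.diag_nonneg (i := i)).eq_or_lt with h0 | h0
  · have := sq_le_diag_mul_diag hC u i
    rw [← h0, mul_zero] at this
    rw [← h0, div_zero, sub_zero]
    exact pow_eq_zero_iff two_ne_zero |>.1 (le_antisymm this (sq_nonneg _))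
  · rw [mul_div_assoc, div_self h0.ne', mul_one, sub_self]

theorem pivotRest_apply_eq_zero {C : Matrix (Fin n) (Fin n) ℝ} (hC : C.PosSemidef) (i : Fin n)
    {j : Fin n} (hj : ∀ u, C u j = 0) (u : Fin n) : pivotRest C i u j = 0 := by
  have : C j i = 0 := by rw [← hj i]; simpa using hC.1.apply i j
  rw [pivotRest, of_apply, hj, pivotFun, pivotFun, this]
  ring

/-- One of the two signs does not decrease the estimator, since their average does not. -/
theorem roundPotential_le_max {κ : ℝ} (hκ : 0 ≤ κ) (g q : Fin n → ℝ)
    {C C' : Matrix (Fin n) (Fin n) ℝ} (hC' : ∀ u, C' u u = C u u - q u ^ 2)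
    (h0 : ∀ u, 0 ≤ C' u u) :
    roundPotential κ g C ≤ max (roundPotential κ (fun u => g u + q u) C')
      (roundPotential κ (fun u => g u - q u) C') := by
  suffices h : 2 * roundPotential κ g C ≤ roundPotential κ (fun u => g u + q u) C'
      + roundPotential κ (fun u => g u - q u) C' by
    rcases le_total (roundPotential κ (fun u => g u + q u) C')
      (roundPotential κ (fun u => g u - q u) C') with h1 | h1
    · exact le_max_of_le_right (by linarith)
    · exact le_max_of_le_left (by linarith)
  simp only [roundPotential]
  set s := ∑ u, g u ^ 2 with hs
  set t := ∑ u, q u ^ 2 with ht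
  set r := ∑ u, g u * q u with hr
  set τ := ∑ u, C u u with hτ
  have e1 : ∑ u, (g u + q u) ^ 2 = s + 2 * r + t := by
    rw [hs, ht, hr, Finset.mul_sum, ← Finset.sum_add_distrib, ← Finset.sum_add_distrib]
    exact Finset.sum_congr rfl fun u _ => by ring
  have e2 : ∑ u, (g u - q u) ^ 2 = s - 2 * r + t := by
    rw [hs, ht, hr, Finset.mul_sum, ← Finset.sum_sub_distrib, ← Finset.sum_add_distrib]
    exact Finset.sum_congr rfl fun u _ => by ring
  have e3 : ∑ u, C' u u = τ - t := by
    rw [hτ, ht, ← Finset.sum_sub_distrib]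
    exact Finset.sum_congr rfl fun u _ => hC' u
  have hcs : r ^ 2 ≤ s * t := Finset.sum_mul_sq_le_sq_mul_sq _ _ _
  have hquart : 2 * ∑ u, (g u ^ 4 + 6 * (g u ^ 2 * C u u) + C u u ^ 2)
      ≤ ∑ u, ((g u + q u) ^ 4 + 6 * ((g u + q u) ^ 2 * C' u u) + C' u u ^ 2)
        + ∑ u, ((g u - q u) ^ 4 + 6 * ((g u - q u) ^ 2 * C' u u) + C' u u ^ 2) := by
    rw [← Finset.sum_add_distrib, Finset.mul_sum]
    refine Finset.sum_le_sum fun u _ => ?_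
    have h1 := mul_nonneg (sq_nonneg (q u)) (h0 u)
    have h2 : C u u = C' u u + q u ^ 2 := by rw [hC']; ring
    rw [h2]
    nlinarith
  have hsq : (s + 2 * r + t) ^ 2 + 6 * ((s + 2 * r + t) * (τ - t)) + 3 * (τ - t) ^ 2
      + ((s - 2 * r + t) ^ 2 + 6 * ((s - 2 * r + t) * (τ - t)) + 3 * (τ - t) ^ 2)
      ≤ 2 * (s ^ 2 + 6 * (s * τ) + 3 * τ ^ 2) := by
    nlinarith [sq_nonneg t]
  have := mul_le_mul_of_nonneg_left hsq hκ
  rw [e1, e2, e3]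
  linarith

theorem roundPotential_le_roundStep {κ : ℝ} (hκ : 0 ≤ κ)
    {s : Matrix (Fin n) (Fin n) ℝ × (Fin n → ℝ)} (hs : s.1.PosSemidef) (i : Fin n) :
    roundPotential κ s.2 s.1 ≤ roundPotential κ (roundStep κ s i).2 (roundStep κ s i).1 := by
  have h := roundPotential_le_max hκ s.2 (pivotFun s.1 i) (C := s.1) (C' := pivotRest s.1 i)
    (fun u => by rw [pivotRest, of_apply, sq]) fun u => (posSemidef_pivotRest hs i).diag_nonneg
  rw [roundStep]
  split_ifs with hlt
  · rwa [max_eq_left hlt.le] at h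
  · rwa [max_eq_right (not_lt.1 hlt)] at h

theorem mulVec_pivotFun {Q C : Matrix (Fin n) (Fin n) ℝ}
    (hC : ∀ j, Q *ᵥ (fun u => C u j) = fun u => C u j) (i : Fin n) :
    Q *ᵥ pivotFun C i = pivotFun C i := by
  have h : pivotFun C i = (√(C i i))⁻¹ • fun u => C u i := by
    ext u; rw [pivotFun, Pi.smul_apply, smul_eq_mul, inv_mul_eq_div]
  rw [h, mulVec_smul, hC]

theorem mulVec_pivotRest {Q C : Matrix (Fin n) (Fin n) ℝ}
    (hC : ∀ j, Q *ᵥ (fun u => C u j) = fun u => C u j) (i j : Fin n) :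
    Q *ᵥ (fun u => pivotRest C i u j) = fun u => pivotRest C i u j := by
  have h : (fun u => pivotRest C i u j) = (fun u => C u j) - pivotFun C i j • pivotFun C i := by
    ext u
    rw [pivotRest, of_apply, Pi.sub_apply, Pi.smul_apply, smul_eq_mul, mul_comm]
  rw [h, mulVec_sub, mulVec_smul, hC, mulVec_pivotFun hC]

theorem mulVec_roundStep {Q : Matrix (Fin n) (Fin n) ℝ} {κ : ℝ}
    {s : Matrix (Fin n) (Fin n) ℝ × (Fin n → ℝ)}
    (hC : ∀ j, Q *ᵥ (fun u => s.1 u j) = fun u => s.1 u j) (hg : Q *ᵥ s.2 = s.2) (i : Fin n) :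
    Q *ᵥ (roundStep κ s i).2 = (roundStep κ s i).2 := by
  have h := mulVec_pivotFun hC i
  rw [roundStep]
  split_ifs
  · change Q *ᵥ (s.2 + pivotFun s.1 i) = s.2 + pivotFun s.1 i
    rw [mulVec_add, h, hg]
  · change Q *ᵥ (s.2 - pivotFun s.1 i) = s.2 - pivotFun s.1 i
    rw [mulVec_sub, h, hg]

theorem foldl_roundStep {Q P : Matrix (Fin n) (Fin n) ℝ} (hP : P.PosSemidef)
    (hQP : ∀ j, Q *ᵥ (fun u => P u j) = fun u => P u j) {κ : ℝ} (hκ : 0 ≤ κ) (l : List (Fin n)) :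
    let s := l.foldl (roundStep κ) (P, fun _ => 0)
    s.1.PosSemidef ∧ (∀ j, Q *ᵥ (fun u => s.1 u j) = fun u => s.1 u j) ∧ Q *ᵥ s.2 = s.2 ∧
      (∀ j ∈ l, ∀ u, s.1 u j = 0) ∧
      roundPotential κ (fun _ => 0) P ≤ roundPotential κ s.2 s.1 := by
  induction l using List.reverseRecOn with
  | nil => exact ⟨hP, hQP, mulVec_zero Q, by simp, le_rfl⟩
  | append_singleton l i ih =>
    rw [List.foldl_append, List.foldl_cons, List.foldl_nil]
    obtain ⟨h1, h2, h3, h4, h5⟩ := ih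
    refine ⟨posSemidef_pivotRest h1 i, mulVec_pivotRest h2 i, mulVec_roundStep h2 h3 i,
      fun j hj u => ?_, h5.trans (roundPotential_le_roundStep hκ h1 i)⟩
    rcases List.mem_append.1 hj with hj | hj
    · exact pivotRest_apply_eq_zero h1 i (h4 j hj) u
    · rw [List.mem_singleton.1 hj]
      exact pivotRest_apply_self h1 i u

theorem mulVec_signRound {Q P : Matrix (Fin n) (Fin n) ℝ} (hP : P.PosSemidef)
    (hQP : ∀ j, Q *ᵥ (fun u => P u j) = fun u => P u j) : Q *ᵥ signRound P = signRound P :=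
  (foldl_roundStep hP hQP (κ := sparsityRatio P) (by unfold sparsityRatio; positivity) _).2.2.1

/-- The rounding of an analytically sparse matrix is analytically sparse. -/
theorem lt_sum_signRound_pow_four {P : Matrix (Fin n) (Fin n) ℝ} (hP : P.PosSemidef) {A : ℝ}
    (hA : A * (∑ u, P u u) ^ 2 < ∑ u, P u u ^ 2) (hA0 : 0 ≤ A) :
    A / 6 * (∑ u, signRound P u ^ 2) ^ 2 < ∑ u, signRound P u ^ 4 := by
  have hpos : 0 < ∑ u, P u u ^ 2 := lt_of_le_of_lt (by positivity) hA
  have hτ : 0 < ∑ u, P u u := by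
    refine (Finset.sum_nonneg fun u _ => hP.diag_nonneg).lt_of_ne' fun h0 => hpos.ne' ?_
    rw [Finset.sum_eq_zero_iff_of_nonneg fun u _ => hP.diag_nonneg] at h0
    exact Finset.sum_eq_zero fun u hu => by rw [h0 u hu, zero_pow two_ne_zero]
  have hκ : A / 6 ≤ sparsityRatio P := by
    rw [sparsityRatio, le_div_iff₀ (by positivity)]
    linarith
  have hκ0 : 0 ≤ sparsityRatio P := by unfold sparsityRatio; positivity
  obtain ⟨-, -, -, h4, h5⟩ := foldl_roundStep (Q := 1) hP (fun j => one_mulVec _) hκ0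
    (List.finRange n)
  have hend : ∀ u, ((List.finRange n).foldl (roundStep (sparsityRatio P)) (P, fun _ => 0)).1 u u
      = 0 := fun u => h4 u (List.mem_finRange u) u
  have hstart : roundPotential (sparsityRatio P) (fun _ => 0) P = (∑ u, P u u ^ 2) / 2 := by
    simp only [roundPotential, sparsityRatio]
    have := hτ.ne'
    simp
    field_simp
    ring
  rw [hstart] at h5
  simp only [roundPotential, hend, mul_zero, add_zero, Finset.sum_const_zero, ne_eq,
    OfNat.ofNat_ne_zero, not_false_eq_true, zero_pow] at h5
  change _ ≤ ∑ u, signRound P u ^ 4 - sparsityRatio P * (∑ u, signRound P u ^ 2) ^ 2 at h5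
  have := mul_le_mul_of_nonneg_right hκ (sq_nonneg (∑ u, signRound P u ^ 2))
  linarith

end Rounding

end ASVP

namespace RealRAM

/-! ### Programs without arithmetic on registers run in polynomial time -/

/-- The program contains no instruction that writes a natural-number register, except for the
loop counters. -/
def Prog.NatFree : Prog → Prop
  | .natConst _ _ => False
  | .natAdd _ _ _ => False
  | .natSub _ _ _ => False
  | .seq p q => p.NatFree ∧ q.NatFree
  | .ifNatLt _ _ p q => p.NatFree ∧ q.NatFree
  | .ifRealLt _ _ p q => p.NatFree ∧ q.NatFree
  | .loop _ _ p => p.NatFree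
  | _ => True

/-- The registers stay below their initial bound, since loop counters stay below the loop bounds.
Hence so does the number of iterations of every loop. -/
theorem Prog.NatFree.exists_clock_le {p : Prog} (h : p.NatFree) :
    ∃ q : Polynomial ℕ, ∀ (s : State) (B : ℕ), (∀ x, s.nat x ≤ B) →
      (∀ x, (run p s).nat x ≤ B) ∧ (run p s).clock ≤ s.clock + q.eval B := by
  induction p with
  | natConst => exact h.elim
  | natAdd => exact h.elim
  | natSub => exact h.elim
  | seq p₁ p₂ ih₁ ih₂ =>
    obtain ⟨q₁, h₁⟩ := ih₁ h.1
    obtain ⟨q₂, h₂⟩ := ih₂ h.2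
    refine ⟨q₁ + q₂, fun s B hB => ?_⟩
    obtain ⟨a₁, b₁⟩ := h₁ s B hB
    obtain ⟨a₂, b₂⟩ := h₂ (run p₁ s) B a₁
    rw [run, Polynomial.eval_add]
    exact ⟨a₂, by omega⟩
  | ifNatLt x y p₁ p₂ ih₁ ih₂ =>
    obtain ⟨q₁, h₁⟩ := ih₁ h.1
    obtain ⟨q₂, h₂⟩ := ih₂ h.2
    refine ⟨1 + q₁ + q₂, fun s B hB => ?_⟩
    obtain ⟨a₁, b₁⟩ := h₁ s.tick B hB
    obtain ⟨a₂, b₂⟩ := h₂ s.tick B hB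
    simp only [State.tick] at b₁ b₂
    rw [run, Polynomial.eval_add, Polynomial.eval_add, Polynomial.eval_one]
    split_ifs
    · exact ⟨a₁, by simp only [State.tick]; omega⟩
    · exact ⟨a₂, by simp only [State.tick]; omega⟩
  | ifRealLt x y p₁ p₂ ih₁ ih₂ =>
    obtain ⟨q₁, h₁⟩ := ih₁ h.1
    obtain ⟨q₂, h₂⟩ := ih₂ h.2
    refine ⟨1 + q₁ + q₂, fun s B hB => ?_⟩
    obtain ⟨a₁, b₁⟩ := h₁ s.tick B hB
    obtain ⟨a₂, b₂⟩ := h₂ s.tick B hB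
    simp only [State.tick] at b₁ b₂
    rw [run, Polynomial.eval_add, Polynomial.eval_add, Polynomial.eval_one]
    split_ifs
    · exact ⟨a₁, by simp only [State.tick]; omega⟩
    · exact ⟨a₂, by simp only [State.tick]; omega⟩
  | loop x y p ih =>
    obtain ⟨q, hq⟩ := ih h
    refine ⟨1 + Polynomial.X * (1 + q), fun s B hB => ?_⟩
    have key : ∀ N ≤ B, (∀ z, ((List.range N).foldl
          (fun r i => run p (r.setNat x i).tick) s.tick).nat z ≤ B) ∧
        ((List.range N).foldl (fun r i => run p (r.setNat x i).tick) s.tick).clock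
          ≤ s.clock + 1 + N * (1 + q.eval B) := by
      intro N
      induction N with
      | zero => exact fun _ => ⟨hB, by simp [State.tick]⟩
      | succ N ihN =>
        intro hN
        obtain ⟨a, b⟩ := ihN (by omega)
        rw [List.range_succ, List.foldl_append, List.foldl_cons, List.foldl_nil]
        set r := (List.range N).foldl (fun r i => run p (r.setNat x i).tick) s.tick
        have h1 : ∀ z, ((r.setNat x N).tick).nat z ≤ B := fun z => by
          simp only [State.tick, State.setNat, Function.update_apply]
          split_ifs
          · omega
          · exact a z
        obtain ⟨a', b'⟩ := hq _ B h1
        refine ⟨a', b'.trans ?_⟩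
        simp only [State.tick, State.setNat]
        linarith
    obtain ⟨a, b⟩ := key (s.nat y) (hB y)
    rw [run]
    refine ⟨a, b.trans ?_⟩
    simp only [Polynomial.eval_add, Polynomial.eval_mul, Polynomial.eval_one, Polynomial.eval_X]
    have := Nat.mul_le_mul_right (1 + q.eval B) (hB y)
    omega
  | _ =>
    exact ⟨1, fun s B hB => ⟨hB, by simp [run, State.tick, State.set, State.draw]⟩⟩

/-! ### Expressions with sums -/

/-- Real expressions in the entries of arrays. Registers are numbered by nesting depth: at level
`r`, the registers below `r` can be read, and `sum` binds the register `r`, which ranges over the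
numbers below the value of register `0`. -/
inductive Exp where
  | cell (a : ℕ) (idx : List ℕ)
  | reg (x : ℕ)
  | eq (x y : ℕ)
  | add (e f : Exp)
  | sub (e f : Exp)
  | mul (e f : Exp)
  | div (e f : Exp)
  | sqrt (e : Exp)
  | sum (e : Exp)

namespace Exp

/-- The value at level `r`, with registers `ν` and arrays `A`. -/
noncomputable def eval : Exp → ℕ → (ℕ → ℕ) → (ℕ → List ℕ → ℝ) → ℝ
  | cell a idx, _, ν, A => A a (idx.map ν)
  | reg x, _, ν, _ => ν x
  | eq x y, _, ν, _ => if ν x = ν y then 1 else 0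
  | add e f, r, ν, A => e.eval r ν A + f.eval r ν A
  | sub e f, r, ν, A => e.eval r ν A - f.eval r ν A
  | mul e f, r, ν, A => e.eval r ν A * f.eval r ν A
  | div e f, r, ν, A => e.eval r ν A / f.eval r ν A
  | sqrt e, r, ν, A => √(e.eval r ν A)
  | sum e, r, ν, A => ∑ i ∈ Finset.range (ν 0), e.eval (r + 1) (Function.update ν r i) A

/-- Only registers below the level and arrays from `ok` are read. -/
def WF (ok : ℕ → Bool) : Exp → ℕ → Bool
  | cell a idx, r => ok a && idx.all (· < r)
  | reg x, r => x < r
  | eq x y, r => x < r && y < r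
  | add e f, r => e.WF ok r && f.WF ok r
  | sub e f, r => e.WF ok r && f.WF ok r
  | mul e f, r => e.WF ok r && f.WF ok r
  | div e f, r => e.WF ok r && f.WF ok r
  | sqrt e, r => e.WF ok r
  | sum e, r => e.WF ok (r + 1)

theorem eval_congr {ok : ℕ → Bool} {e : Exp} {r : ℕ} (he : e.WF ok r) (hr : 0 < r) {ν ν' : ℕ → ℕ}
    {A A' : ℕ → List ℕ → ℝ} (hν : ∀ x < r, ν x = ν' x) (hA : ∀ a, ok a → A a = A' a) :
    e.eval r ν A = e.eval r ν' A' := by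
  induction e generalizing r ν ν' with
  | cell a idx =>
    simp only [WF, Bool.and_eq_true, List.all_eq_true, decide_eq_true_eq] at he
    rw [eval, eval, hA a he.1, List.map_congr_left fun x hx => hν x (he.2 x hx)]
  | reg x => rw [eval, eval, hν x (by simpa [WF] using he)]
  | eq x y =>
    simp only [WF, Bool.and_eq_true, decide_eq_true_eq] at he
    rw [eval, eval, hν x he.1, hν y he.2]
  | sqrt e ih => rw [eval, eval, ih he hr hν]
  | sum e ih =>
    rw [eval, eval, hν 0 hr]
    refine Finset.sum_congr rfl fun i _ => ih he (by omega) fun x hx => ?_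
    simp only [Function.update_apply]
    split_ifs with h
    · rfl
    · exact hν x (by omega)
  | _ e f ihe ihf =>
    simp only [WF, Bool.and_eq_true] at he
    rw [eval, eval, ihe he.1 hr hν, ihf he.2 hr hν]

/-- The single cell of the array `t` is divided by that of the array `t + 1`. If the divisor
vanishes, the division is not carried out, and the result is zero, in agreement with the
convention for division by zero. -/
def guardedDiv (t : ℕ) : Prog :=
  .seq (.sub ⟨t + 2, []⟩ ⟨t + 2, []⟩ ⟨t + 2, []⟩)
    (.ifRealLt ⟨t + 1, []⟩ ⟨t + 2, []⟩ (.div ⟨t, []⟩ ⟨t, []⟩ ⟨t + 1, []⟩)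
      (.ifRealLt ⟨t + 2, []⟩ ⟨t + 1, []⟩ (.div ⟨t, []⟩ ⟨t, []⟩ ⟨t + 1, []⟩)
        (.copy ⟨t, []⟩ ⟨t + 2, []⟩)))

/-- The program that puts the value of an expression into the single cell of the array `t`, using
the arrays from `t` on as temporary storage. -/
def compile : Exp → ℕ → ℕ → Prog
  | cell a idx, _, t => .copy ⟨t, []⟩ ⟨a, idx⟩
  | reg x, _, t => .cast ⟨t, []⟩ x
  | eq x y, _, t =>
    .ifNatLt x y (.sub ⟨t, []⟩ ⟨t, []⟩ ⟨t, []⟩) (.ifNatLt y x (.sub ⟨t, []⟩ ⟨t, []⟩ ⟨t, []⟩)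
      (.seq (.cast ⟨t, []⟩ 1) (.div ⟨t, []⟩ ⟨t, []⟩ ⟨t, []⟩)))
  | add e f, r, t =>
    .seq (e.compile r t) (.seq (f.compile r (t + 1)) (.add ⟨t, []⟩ ⟨t, []⟩ ⟨t + 1, []⟩))
  | sub e f, r, t =>
    .seq (e.compile r t) (.seq (f.compile r (t + 1)) (.sub ⟨t, []⟩ ⟨t, []⟩ ⟨t + 1, []⟩))
  | mul e f, r, t =>
    .seq (e.compile r t) (.seq (f.compile r (t + 1)) (.mul ⟨t, []⟩ ⟨t, []⟩ ⟨t + 1, []⟩))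
  | div e f, r, t =>
    .seq (e.compile r t) (.seq (f.compile r (t + 1)) (guardedDiv t))
  | sqrt e, r, t => .seq (e.compile r t) (.sqrt ⟨t, []⟩ ⟨t, []⟩)
  | sum e, r, t =>
    .seq (.sub ⟨t, []⟩ ⟨t, []⟩ ⟨t, []⟩)
      (.loop r 0 (.seq (e.compile (r + 1) (t + 1)) (.add ⟨t, []⟩ ⟨t, []⟩ ⟨t + 1, []⟩)))

theorem natFree_compile (e : Exp) (r t : ℕ) : (e.compile r t).NatFree := by
  induction e generalizing r t with
  | cell => trivial
  | reg => trivial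
  | eq => exact ⟨trivial, trivial, trivial, trivial⟩
  | sqrt e ih => exact ⟨ih _ _, trivial⟩
  | sum e ih => exact ⟨trivial, ih _ _, trivial⟩
  | div e f ihe ihf => exact ⟨ihe _ _, ihf _ _, trivial, trivial, trivial, trivial⟩
  | _ e f ihe ihf => exact ⟨ihe _ _, ihf _ _, trivial⟩

/-- Correctness of compiled expressions. -/
structure Computes (e : Exp) (r t : ℕ) (s s' : State) : Prop where
  nat : ∀ x < r, s'.nat x = s.nat x
  real : ∀ a < t, s'.real a = s.real a
  val : s'.real t [] = e.eval r s.nat s.real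

theorem get_scalar (s : State) (t : ℕ) : s.get ⟨t, []⟩ = s.real t [] := rfl

theorem set_scalar_real_self (s : State) (t : ℕ) (v : ℝ) : (s.set ⟨t, []⟩ v).real t [] = v := by
  simp [State.set]

theorem set_scalar_real_of_ne (s : State) {t a : ℕ} (h : a ≠ t) (v : ℝ) :
    (s.set ⟨t, []⟩ v).real a = s.real a := by
  simp [State.set, h]

theorem run_guardedDiv (t : ℕ) (s : State) :
    (run (guardedDiv t) s).nat = s.nat ∧
      (∀ a < t, (run (guardedDiv t) s).real a = s.real a) ∧
      (run (guardedDiv t) s).real t [] = s.get ⟨t, []⟩ / s.get ⟨t + 1, []⟩ := by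
  rw [guardedDiv, run]
  set s₁ := run (.sub ⟨t + 2, []⟩ ⟨t + 2, []⟩ ⟨t + 2, []⟩) s with hs₁
  have h0 : s₁.get ⟨t + 2, []⟩ = 0 := (set_scalar_real_self _ _ _).trans (sub_self _)
  have hne : ∀ a ≠ t + 2, s₁.real a = s.real a := fun a ha => set_scalar_real_of_ne _ ha _
  have h1 : s₁.get ⟨t + 1, []⟩ = s.get ⟨t + 1, []⟩ := congrFun (hne (t + 1) (by omega)) []
  have h2 : s₁.get ⟨t, []⟩ = s.get ⟨t, []⟩ := congrFun (hne t (by omega)) []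
  have hlow : ∀ (v : ℝ), ∀ a < t, (s₁.set ⟨t, []⟩ v).real a = s.real a := fun v a ha =>
    (set_scalar_real_of_ne _ ha.ne _).trans (hne a (by omega))
  have hdiv : s₁.get ⟨t, []⟩ / s₁.get ⟨t + 1, []⟩ = s.get ⟨t, []⟩ / s.get ⟨t + 1, []⟩ := by
    rw [h1, h2]
  rw [run]
  split_ifs with c1
  · exact ⟨rfl, hlow _, (set_scalar_real_self _ _ _).trans hdiv⟩
  rw [run]
  split_ifs with c2
  · exact ⟨rfl, hlow _, (set_scalar_real_self _ _ _).trans hdiv⟩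
  · refine ⟨rfl, hlow _, (set_scalar_real_self _ _ _).trans ?_⟩
    have h3 : s₁.get ⟨t + 1, []⟩ = 0 := by
      rw [h0] at c1
      exact le_antisymm (not_lt.1 fun h => c2 (by rw [← h0] at h; exact h)) (not_lt.1 c1)
    rw [← hdiv, h3, div_zero]
    exact h0

/-- The common part of the compilation of the binary operations. -/
theorem computes_binary {ok : ℕ → Bool} {e f : Exp} {r t : ℕ} (hr : 0 < r) (hok : ∀ a, ok a → a < t)
    (hf : f.WF ok r) {s s₁ s₂ : State}
    (h₁ : Computes e r t s s₁) (h₂ : Computes f r (t + 1) s₁ s₂) (op : ℝ → ℝ → ℝ) :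
    let s' := (s₂.set ⟨t, []⟩ (op (s₂.get ⟨t, []⟩) (s₂.get ⟨t + 1, []⟩))).tick
    (∀ x < r, s'.nat x = s.nat x) ∧ (∀ a < t, s'.real a = s.real a) ∧
      s'.real t [] = op (e.eval r s.nat s.real) (f.eval r s.nat s.real) := by
  refine ⟨fun x hx => (h₂.nat x hx).trans (h₁.nat x hx), fun a ha => ?_, ?_⟩
  · exact (set_scalar_real_of_ne _ ha.ne _).trans
      ((h₂.real a (by omega)).trans (h₁.real a ha))
  · refine (set_scalar_real_self _ _ _).trans ?_
    rw [get_scalar, get_scalar, h₂.val, h₂.real t (by omega), h₁.val]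
    congr 1
    exact eval_congr hf hr h₁.nat fun a ha => h₁.real a (hok a ha)

theorem computes_compile {ok : ℕ → Bool} (e : Exp) {r t : ℕ} (he : e.WF ok r)
    (hok : ∀ a, ok a → a < t) (hr : 2 ≤ r) (s : State) (hs : s.nat 1 ≠ 0) :
    Computes e r t s (run (e.compile r t) s) := by
  induction e generalizing r t s with
  | cell a idx =>
    exact ⟨fun _ _ => rfl, fun a ha => set_scalar_real_of_ne _ ha.ne _, set_scalar_real_self _ _ _⟩
  | reg x =>
    exact ⟨fun _ _ => rfl, fun a ha => set_scalar_real_of_ne _ ha.ne _, set_scalar_real_self _ _ _⟩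
  | eq x y =>
    rw [compile, run]
    split_ifs with h1
    · refine ⟨fun _ _ => rfl, fun a ha => set_scalar_real_of_ne _ ha.ne _, ?_⟩
      refine (set_scalar_real_self _ _ _).trans ?_
      rw [eval, if_neg h1.ne, sub_self]
    rw [run]
    split_ifs with h2
    · refine ⟨fun _ _ => rfl, fun a ha => set_scalar_real_of_ne _ ha.ne _, ?_⟩
      refine (set_scalar_real_self _ _ _).trans ?_
      rw [eval, if_neg (show s.nat y < s.nat x from h2).ne', sub_self]
    · have h3 : s.nat x = s.nat y := le_antisymm (not_lt.1 h2) (not_lt.1 h1)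
      rw [run, run, run]
      refine ⟨fun _ _ => rfl, fun a ha => (set_scalar_real_of_ne _ ha.ne _).trans
        (set_scalar_real_of_ne _ ha.ne _), (set_scalar_real_self _ _ _).trans ?_⟩
      rw [eval, if_pos h3, get_scalar]
      change (State.set _ _ _).real t [] / (State.set _ _ _).real t [] = 1
      rw [set_scalar_real_self]
      exact div_self (show ((s.nat 1 : ℕ) : ℝ) ≠ 0 from Nat.cast_ne_zero.2 hs)
  | add e f ihe ihf =>
    simp only [WF, Bool.and_eq_true] at he
    have h₁ := ihe he.1 hok hr s hs
    have h₂ := ihf he.2 (fun a ha => (hok a ha).trans (Nat.lt_succ_self t)) hr _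
      (by rw [h₁.nat 1 (by omega)]; exact hs)
    obtain ⟨a, b, c⟩ := computes_binary (by omega) hok he.2 h₁ h₂ (· + ·)
    exact ⟨a, b, c⟩
  | sub e f ihe ihf =>
    simp only [WF, Bool.and_eq_true] at he
    have h₁ := ihe he.1 hok hr s hs
    have h₂ := ihf he.2 (fun a ha => (hok a ha).trans (Nat.lt_succ_self t)) hr _
      (by rw [h₁.nat 1 (by omega)]; exact hs)
    obtain ⟨a, b, c⟩ := computes_binary (by omega) hok he.2 h₁ h₂ (· - ·)
    exact ⟨a, b, c⟩
  | mul e f ihe ihf =>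
    simp only [WF, Bool.and_eq_true] at he
    have h₁ := ihe he.1 hok hr s hs
    have h₂ := ihf he.2 (fun a ha => (hok a ha).trans (Nat.lt_succ_self t)) hr _
      (by rw [h₁.nat 1 (by omega)]; exact hs)
    obtain ⟨a, b, c⟩ := computes_binary (by omega) hok he.2 h₁ h₂ (· * ·)
    exact ⟨a, b, c⟩
  | div e f ihe ihf =>
    simp only [WF, Bool.and_eq_true] at he
    have h₁ := ihe he.1 hok hr s hs
    have h₂ := ihf he.2 (fun a ha => (hok a ha).trans (Nat.lt_succ_self t)) hr _
      (by rw [h₁.nat 1 (by omega)]; exact hs)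
    obtain ⟨a, b, c⟩ := computes_binary (by omega) hok he.2 h₁ h₂ (· / ·)
    obtain ⟨a', b', c'⟩ := run_guardedDiv t (run (f.compile r (t + 1)) (run (e.compile r t) s))
    refine ⟨fun x hx => (congrFun a' x).trans (a x hx), fun k hk => ?_, ?_⟩
    · exact (b' k hk).trans ((set_scalar_real_of_ne _ hk.ne _).symm.trans (b k hk))
    · exact c'.trans ((set_scalar_real_self _ _ _).symm.trans c)
  | sqrt e ih =>
    have h₁ := ih he hok hr s hs
    refine ⟨h₁.nat, fun a ha => (set_scalar_real_of_ne _ ha.ne _).trans (h₁.real a ha),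
      (set_scalar_real_self _ _ _).trans ?_⟩
    rw [get_scalar, h₁.val, eval]
  | sum e ih =>
    rw [compile, run, run, run]
    set s₀ := (s.set ⟨t, []⟩ (s.get ⟨t, []⟩ - s.get ⟨t, []⟩)).tick with hs₀
    set body := fun (q : State) (i : ℕ) => run (.seq (e.compile (r + 1) (t + 1))
      (.add ⟨t, []⟩ ⟨t, []⟩ ⟨t + 1, []⟩)) (q.setNat r i).tick with hbody
    have key : ∀ N, (∀ x < r, ((List.range N).foldl body s₀.tick).nat x = s.nat x) ∧
        (∀ a < t, ((List.range N).foldl body s₀.tick).real a = s.real a) ∧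
        ((List.range N).foldl body s₀.tick).real t []
          = ∑ i ∈ Finset.range N, e.eval (r + 1) (Function.update s.nat r i) s.real := by
      intro N
      induction N with
      | zero =>
        refine ⟨fun _ _ => rfl, fun a ha => set_scalar_real_of_ne _ ha.ne _, ?_⟩
        rw [Finset.sum_range_zero]
        exact (set_scalar_real_self _ _ _).trans (sub_self _)
      | succ N ihN =>
        obtain ⟨a₁, b₁, c₁⟩ := ihN
        rw [List.range_succ, List.foldl_append, List.foldl_cons, List.foldl_nil,
          Finset.sum_range_succ]
        set q := (List.range N).foldl body s₀.tick
        have h₁ := ih (r := r + 1) (t := t + 1) he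
          (fun a ha => (hok a ha).trans (Nat.lt_succ_self t)) (by omega)
          (q.setNat r N).tick (by
            change Function.update q.nat r N 1 ≠ 0
            rw [Function.update_of_ne (by omega), a₁ 1 (by omega)]
            exact hs)
        set q' := run (e.compile (r + 1) (t + 1)) (q.setNat r N).tick with hq'
        have hb : body q N = (q'.set ⟨t, []⟩ (q'.get ⟨t, []⟩ + q'.get ⟨t + 1, []⟩)).tick := rfl
        rw [hb]
        refine ⟨fun x hx => ?_, fun a ha => ?_, ?_⟩
        · refine (h₁.nat x (by omega)).trans ?_
          change Function.update q.nat r N x = _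
          rw [Function.update_of_ne hx.ne, a₁ x hx]
        · exact (set_scalar_real_of_ne _ ha.ne _).trans ((h₁.real a (by omega)).trans (b₁ a ha))
        · refine (set_scalar_real_self _ _ _).trans ?_
          rw [get_scalar, get_scalar, h₁.real t (by omega), h₁.val]
          change q.real t [] + _ = _
          rw [c₁]
          congr 1
          refine eval_congr (e := e) (r := r + 1) he (by omega) (fun x hx => ?_)
            fun a ha => b₁ a (hok a ha)
          change Function.update q.nat r N x = _
          simp only [Function.update_apply]
          split_ifs with h
          · rfl
          · exact a₁ x (by omega)
    obtain ⟨a, b, c⟩ := key (s₀.nat 0)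
    exact ⟨a, b, c⟩

end Exp

end RealRAM

namespace RealRAM

/-! ### Structured programs -/

/-- Structured programs. At level `r`, the registers below `r` can be read. `asg a m e` assigns the
value of `e` to all entries of the array `a` with `m` indices, which are available to `e` in the
registers from `r` on; `e` must not read `a`. In `loop p`, the register `r` ranges over the numbers
below the value of register `0`; `rep k p` executes `p` as often as the `k`-th power of the value of
register `1`. -/
inductive Stmt where
  | asg (a m : ℕ) (e : Exp)
  | seq (p q : Stmt)
  | loop (p : Stmt)
  | rep (k : ℕ) (p : Stmt)
  | ifLt (e f : Exp) (p q : Stmt)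

/-- The registers from `r` on are replaced by the entries of the list. -/
def extend (ν : ℕ → ℕ) (r : ℕ) (l : List ℕ) (x : ℕ) : ℕ := if x < r then ν x else l.getD (x - r) 0

theorem extend_of_lt {ν : ℕ → ℕ} {r : ℕ} {l : List ℕ} {x : ℕ} (h : x < r) : extend ν r l x = ν x :=
  if_pos h

theorem extend_congr {ν ν' : ℕ → ℕ} {r : ℕ} (h : ∀ x < r, ν x = ν' x) (l : List ℕ) :
    extend ν r l = extend ν' r l := by
  funext x
  unfold extend
  split_ifs with hx
  · exact h x hx
  · rfl

theorem extend_map_range' (ν : ℕ → ℕ) (r m : ℕ) {x : ℕ} (h : x < r + m) :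
    extend ν r ((List.range' r m).map ν) x = ν x := by
  unfold extend
  split_ifs with hx
  · rfl
  · have h1 : x - r < m := by omega
    rw [List.getD_eq_getElem _ _ (by simpa using h1), List.getElem_map, List.getElem_range']
    congr 1
    omega

namespace Stmt

open Classical in
/-- The arrays after the execution at level `r`, with registers `ν` and arrays `A`. -/
noncomputable def eval : Stmt → ℕ → (ℕ → ℕ) → (ℕ → List ℕ → ℝ) → ℕ → List ℕ → ℝ
  | asg a m e, r, ν, A => Function.update A a fun l =>
      if l.length = m ∧ ∀ x ∈ l, x < ν 0 then e.eval (r + m) (extend ν r l) A else A a l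
  | seq p q, r, ν, A => q.eval r ν (p.eval r ν A)
  | loop p, r, ν, A =>
      (List.range (ν 0)).foldl (fun A i => p.eval (r + 1) (Function.update ν r i) A) A
  | rep k p, r, ν, A => (p.eval r ν)^[ν 1 ^ k] A
  | ifLt e f p q, r, ν, A =>
      if e.eval r ν A < f.eval r ν A then p.eval r ν A else q.eval r ν A

/-- Only registers below the level and arrays below `t` are used. -/
def WF (t : ℕ) : Stmt → ℕ → Bool
  | asg a m e, r => a < t && e.WF (fun b => b < t && b != a) (r + m)
  | seq p q, r => p.WF t r && q.WF t r
  | loop p, r => p.WF t (r + 1)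
  | rep _ p, r => p.WF t r
  | ifLt e f p q, r => e.WF (· < t) r && f.WF (· < t) r && p.WF t r && q.WF t r

/-- `m` nested loops, with the loop counters in the registers from `r` on. -/
def nest : ℕ → ℕ → Prog → Prog
  | _, 0, p => p
  | r, m + 1, p => .loop r 0 (nest (r + 1) m p)

/-- The translation, which uses the arrays from `t` on as temporary storage. -/
def compile (t : ℕ) : Stmt → ℕ → Prog
  | asg a m e, r =>
    nest r m (.seq (e.compile (r + m) t) (.copy ⟨a, List.range' r m⟩ ⟨t, []⟩))
  | seq p q, r => .seq (p.compile t r) (q.compile t r)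
  | loop p, r => .loop r 0 (p.compile t (r + 1))
  | rep k p, r => (Prog.loop r 1)^[k] (p.compile t r)
  | ifLt e f p q, r => .seq (e.compile r t) (.seq (f.compile r (t + 1))
      (.ifRealLt ⟨t, []⟩ ⟨t + 1, []⟩ (p.compile t r) (q.compile t r)))

theorem natFree_nest (r m : ℕ) {p : Prog} (hp : p.NatFree) : (nest r m p).NatFree := by
  induction m generalizing r with
  | zero => exact hp
  | succ m ih => exact ih _

theorem natFree_compile (t : ℕ) (p : Stmt) (r : ℕ) : (p.compile t r).NatFree := by
  induction p generalizing r with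
  | asg a m e => exact natFree_nest _ _ ⟨Exp.natFree_compile _ _ _, trivial⟩
  | seq p q ihp ihq => exact ⟨ihp _, ihq _⟩
  | loop p ih => exact ih _
  | rep k p ih =>
    rw [compile]
    induction k with
    | zero => exact ih _
    | succ k ihk => rw [Function.iterate_succ_apply']; exact ihk
  | ifLt e f p q ihp ihq =>
    exact ⟨Exp.natFree_compile _ _ _, Exp.natFree_compile _ _ _, ihp _, ihq _⟩

/-- The effect of the last `j` of `i + j` nested loops: those entries are assigned whose first `i`
indices are the current values of the counters of the outer loops. -/
theorem run_nest {t a : ℕ} {e : Exp} {r m : ℕ}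
    (he : e.WF (fun b => b < t && b != a) (r + m)) (ha : a < t) (hr : 2 ≤ r) (j i : ℕ)
    (hij : i + j = m) (s : State) (hs : s.nat 1 ≠ 0) :
    let s' := run (nest (r + i) j
      (.seq (e.compile (r + m) t) (.copy ⟨a, List.range' r m⟩ ⟨t, []⟩))) s
    (∀ x < r + i, s'.nat x = s.nat x) ∧ (∀ b < t, b ≠ a → s'.real b = s.real b) ∧
      ∀ l, s'.real a l = if l.length = m ∧ l.take i = (List.range' r i).map s.nat ∧
        (∀ x ∈ l.drop i, x < s.nat 0) then e.eval (r + m) (extend s.nat r l) s.real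
        else s.real a l := by
  have hok : ∀ b, (fun b => decide (b < t) && b != a) b → b < t ∧ b ≠ a := fun b hb => by
    simpa using hb
  induction j generalizing i s with
  | zero =>
    obtain rfl : i = m := by omega
    have h := Exp.computes_compile e he (fun b hb => (hok b hb).1) (by omega) s hs
    set s₁ := run (e.compile (r + i) t) s with hs₁
    have hidx : (List.range' r i).map s₁.nat = (List.range' r i).map s.nat :=
      List.map_congr_left fun x hx => h.nat x (by rw [List.mem_range'_1] at hx; omega)
    have hrun : run (nest (r + i) 0
        (.seq (e.compile (r + i) t) (.copy ⟨a, List.range' r i⟩ ⟨t, []⟩))) s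
        = (s₁.set ⟨a, List.range' r i⟩ (s₁.get ⟨t, []⟩)).tick := rfl
    rw [hrun]
    refine ⟨h.nat, fun b hb hba => ?_, fun l => ?_⟩
    · rw [← h.real b hb]
      simp [State.tick, State.set, hba]
    · have h1 : (s₁.set ⟨a, List.range' r i⟩ (s₁.get ⟨t, []⟩)).tick.real a l
          = if l = (List.range' r i).map s.nat then s₁.get ⟨t, []⟩ else s.real a l := by
        simp only [State.tick, State.set, Function.update_self, Function.update_apply, hidx,
          h.real a ha]
      rw [h1]
      by_cases hl : l = (List.range' r i).map s.nat
      · rw [if_pos hl, if_pos ⟨by simp [hl], by simp [hl], fun x hx => by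
          rw [hl, List.drop_eq_nil_of_le (by simp)] at hx; simp at hx⟩, Exp.get_scalar, h.val]
        refine Exp.eval_congr he (by omega) (fun x hx => ?_) fun _ _ => rfl
        rw [hl, extend_map_range' _ _ _ hx]
      · rw [if_neg hl, if_neg]
        rintro ⟨h2, h3, -⟩
        rw [List.take_of_length_le h2.le] at h3
        exact hl h3
  | succ j ih =>
    rw [nest, run]
    set body := fun (q : State) (k : ℕ) => run (nest (r + i + 1) j
      (.seq (e.compile (r + m) t) (.copy ⟨a, List.range' r m⟩ ⟨t, []⟩)))
      (q.setNat (r + i) k).tick with hbody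
    have key : ∀ N ≤ s.nat 0, (∀ x < r + i, ((List.range N).foldl body s.tick).nat x = s.nat x) ∧
        (∀ b < t, b ≠ a → ((List.range N).foldl body s.tick).real b = s.real b) ∧
        ∀ l, ((List.range N).foldl body s.tick).real a l
          = if l.length = m ∧ l.take i = (List.range' r i).map s.nat ∧
            (∀ x ∈ l.drop i, x < s.nat 0) ∧ l.getD i 0 < N
            then e.eval (r + m) (extend s.nat r l) s.real else s.real a l := by
      intro N
      induction N with
      | zero => exact fun _ => ⟨fun _ _ => rfl, fun _ _ _ => rfl, fun l => by simp [State.tick]⟩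
      | succ N ihN =>
        intro hN
        obtain ⟨a₁, b₁, c₁⟩ := ihN (by omega)
        rw [List.range_succ, List.foldl_append, List.foldl_cons, List.foldl_nil]
        set q := (List.range N).foldl body s.tick
        set q₁ := (q.setNat (r + i) N).tick with hq₁
        have hν : ∀ x < r + i, q₁.nat x = s.nat x := fun x hx => by
          change Function.update q.nat (r + i) N x = _
          rw [Function.update_of_ne hx.ne, a₁ x hx]
        have hνi : q₁.nat (r + i) = N := Function.update_self _ _ _
        obtain ⟨a₂, b₂, c₂⟩ := ih (i + 1) (by omega) q₁ (by rw [hν 1 (by omega)]; exact hs)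
        refine ⟨fun x hx => (a₂ x (by omega)).trans (hν x hx), fun b hb hba =>
          (b₂ b hb hba).trans (b₁ b hb hba), fun l => (c₂ l).trans ?_⟩
        have hq₁a : q₁.real a l = q.real a l := rfl
        rw [hq₁a, c₁ l]
        by_cases hlen : l.length = m
        swap
        · simp [hlen]
        obtain ⟨u, c, v, rfl, hu⟩ : ∃ u c v, l = u ++ c :: v ∧ u.length = i := by
          have hi : i < l.length := by omega
          exact ⟨l.take i, l[i], l.drop (i + 1), by simp, by simp; omega⟩
        have hmap : (List.range' r (i + 1)).map q₁.nat
            = (List.range' r i).map s.nat ++ [N] := by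
          rw [List.range'_1_concat, List.map_append, List.map_singleton, hνi]
          congr 1
          exact List.map_congr_left fun x hx => hν x (by rw [List.mem_range'_1] at hx; omega)
        have e1 : (u ++ c :: v).take (i + 1) = u ++ [c] := by
          rw [← hu, List.take_length_add_append, List.take_succ_cons, List.take_zero]
        have e2 : (u ++ c :: v).drop (i + 1) = v := by
          rw [← hu, List.drop_length_add_append, List.drop_succ_cons, List.drop_zero]
        have e3 : (u ++ c :: v).take i = u := by rw [← hu, List.take_left']; rfl
        have e4 : (u ++ c :: v).drop i = c :: v := by rw [← hu, List.drop_left']; rfl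
        have e5 : (u ++ c :: v).getD i 0 = c := by simp [← hu]
        have hval : e.eval (r + m) (extend q₁.nat r (u ++ c :: v)) q₁.real
            = e.eval (r + m) (extend s.nat r (u ++ c :: v)) s.real := by
          rw [extend_congr fun x hx => hν x (by omega)]
          exact Exp.eval_congr he (by omega) (fun _ _ => rfl)
            fun b hb => b₁ b (hok b hb).1 (hok b hb).2
        rw [e1, e2, e3, e4, e5, hmap, hν 0 (by omega), hval]
        have hiff : (u ++ [c] = (List.range' r i).map s.nat ++ [N])
            ↔ u = (List.range' r i).map s.nat ∧ c = N := by
          refine ⟨fun h => ?_, fun h => by rw [h.1, h.2]⟩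
          obtain ⟨h1, h2⟩ := List.append_inj h (by simp [hu])
          exact ⟨h1, List.singleton_inj.1 h2⟩
        simp only [hiff, hlen, true_and, List.mem_cons, forall_eq_or_imp]
        by_cases hu' : u = (List.range' r i).map s.nat
        swap
        · simp [hu']
        by_cases hv : ∀ x ∈ v, x < s.nat 0
        swap
        · simp [hv]
        simp only [eq_true hu', eq_true hv, true_and, and_true]
        split_ifs <;> first | rfl | (exfalso; omega)
    obtain ⟨a₁, b₁, c₁⟩ := key (s.nat 0) le_rfl
    refine ⟨a₁, b₁, fun l => (c₁ l).trans ?_⟩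
    congr 1
    refine propext (and_congr_right fun h1 => and_congr_right fun _ => ⟨fun h => h.1, fun h =>
      ⟨h, h _ ?_⟩⟩)
    have hi : i < l.length := by omega
    rw [List.getD_eq_getElem _ _ hi, List.mem_drop_iff_getElem]
    exact ⟨0, by omega, by simp⟩

/-- The arrays after execution are determined, below `t`, by the registers below the level and the
arrays below `t`. -/
theorem eval_congr {t : ℕ} {p : Stmt} {r : ℕ} (hp : p.WF t r) (hr : 2 ≤ r) {ν ν' : ℕ → ℕ}
    {A A' : ℕ → List ℕ → ℝ} (hν : ∀ x < r, ν x = ν' x) (hA : ∀ a < t, A a = A' a) :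
    ∀ a < t, p.eval r ν A a = p.eval r ν' A' a := by
  induction p generalizing r ν ν' A A' with
  | asg b m e =>
    simp only [WF, Bool.and_eq_true, decide_eq_true_eq] at hp
    intro a ha
    rw [eval, eval]
    by_cases hab : a = b
    · subst hab
      rw [Function.update_self, Function.update_self]
      funext l
      rw [hν 0 (by omega), hA a ha, extend_congr hν]
      rw [Exp.eval_congr hp.2 (by omega) (fun _ _ => rfl) fun b hb => hA b (by
        simp only [Bool.and_eq_true, decide_eq_true_eq] at hb; exact hb.1)]
    · rw [Function.update_of_ne hab, Function.update_of_ne hab, hA a ha]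
  | seq p q ihp ihq =>
    simp only [WF, Bool.and_eq_true] at hp
    exact ihq hp.2 hr hν (ihp hp.1 hr hν hA)
  | loop p ih =>
    rw [eval, eval, hν 0 (by omega)]
    have key : ∀ N, ∀ a < t,
        (List.range N).foldl (fun A i => p.eval (r + 1) (Function.update ν r i) A) A a
        = (List.range N).foldl (fun A i => p.eval (r + 1) (Function.update ν' r i) A) A' a := by
      intro N
      induction N with
      | zero => exact hA
      | succ N ihN =>
        rw [List.range_succ, List.foldl_append, List.foldl_append]
        refine ih hp (by omega) (fun x hx => ?_) ihN
        simp only [Function.update_apply]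
        split_ifs with h
        · rfl
        · exact hν x (by omega)
    exact key _
  | rep k p ih =>
    rw [eval, eval, hν 1 (by omega)]
    generalize ν' 1 ^ k = N
    induction N with
    | zero => exact hA
    | succ N ihN =>
      rw [Function.iterate_succ_apply', Function.iterate_succ_apply']
      exact ih hp hr hν ihN
  | ifLt e f p q ihp ihq =>
    simp only [WF, Bool.and_eq_true] at hp
    obtain ⟨⟨⟨he, hf⟩, hp⟩, hq⟩ := hp
    have hA' : ∀ a, (fun b => decide (b < t)) a → A a = A' a := fun a ha => hA a (by simpa using ha)
    rw [eval, eval, Exp.eval_congr he (by omega) hν hA', Exp.eval_congr hf (by omega) hν hA']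
    split_ifs
    · exact ihp hp hr hν hA
    · exact ihq hq hr hν hA

theorem iterate_eval_congr {t : ℕ} {p : Stmt} {r : ℕ} (hp : p.WF t r) (hr : 2 ≤ r) {ν ν' : ℕ → ℕ}
    {A A' : ℕ → List ℕ → ℝ} (hν : ∀ x < r, ν x = ν' x) (hA : ∀ a < t, A a = A' a) (M : ℕ) :
    ∀ a < t, (p.eval r ν)^[M] A a = (p.eval r ν')^[M] A' a := by
  induction M with
  | zero => exact hA
  | succ M ihM =>
    rw [Function.iterate_succ_apply', Function.iterate_succ_apply']
    exact eval_congr hp hr hν ihM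

/-- A state is reached that agrees with the denotation, as far as it matters. -/
structure Reaches (p : Stmt) (t r : ℕ) (s s' : State) : Prop where
  nat : ∀ x < r, s'.nat x = s.nat x
  real : ∀ a < t, s'.real a = p.eval r s.nat s.real a

theorem reaches_compile {t : ℕ} (p : Stmt) {r : ℕ} (hp : p.WF t r) (hr : 2 ≤ r) (s : State)
    (hs : s.nat 1 ≠ 0) : Reaches p t r s (run (p.compile t r) s) := by
  induction p generalizing r s with
  | asg b m e =>
    simp only [WF, Bool.and_eq_true, decide_eq_true_eq] at hp
    obtain ⟨h1, h2, h3⟩ := run_nest hp.2 hp.1 hr m 0 (zero_add m) s hs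
    refine ⟨h1, fun a ha => ?_⟩
    rw [eval]
    by_cases hab : a = b
    · subst hab
      rw [Function.update_self]
      funext l
      refine (h3 l).trans ?_
      simp
    · rw [Function.update_of_ne hab]
      exact h2 a ha hab
  | seq p q ihp ihq =>
    simp only [WF, Bool.and_eq_true] at hp
    have h1 := ihp hp.1 hr s hs
    have h2 := ihq hp.2 hr (run (p.compile t r) s) (by rw [h1.nat 1 (by omega)]; exact hs)
    exact ⟨fun x hx => (h2.nat x hx).trans (h1.nat x hx), fun a ha => (h2.real a ha).trans
      (eval_congr hp.2 hr h1.nat h1.real a ha)⟩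
  | loop p ih =>
    rw [compile, run]
    set body := fun (q : State) (k : ℕ) => run (p.compile t (r + 1)) (q.setNat r k).tick with hbody
    have key : ∀ N, (∀ x < r, ((List.range N).foldl body s.tick).nat x = s.nat x) ∧
        ∀ a < t, ((List.range N).foldl body s.tick).real a = (List.range N).foldl
          (fun A i => p.eval (r + 1) (Function.update s.nat r i) A) s.real a := by
      intro N
      induction N with
      | zero => exact ⟨fun _ _ => rfl, fun _ _ => rfl⟩
      | succ N ihN =>
        rw [List.range_succ, List.foldl_append, List.foldl_append, List.foldl_cons, List.foldl_nil,
          List.foldl_cons, List.foldl_nil]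
        set q := (List.range N).foldl body s.tick
        have hν : ∀ x < r + 1, (q.setNat r N).tick.nat x = Function.update s.nat r N x :=
          fun x hx => by
            change Function.update q.nat r N x = _
            simp only [Function.update_apply]
            split_ifs with h
            · rfl
            · exact ihN.1 x (by omega)
        have h1 := ih (r := r + 1) hp (by omega) (q.setNat r N).tick (by
          rw [hν 1 (by omega), Function.update_of_ne (by omega)]; exact hs)
        refine ⟨fun x hx => ?_, fun a ha => (h1.real a ha).trans ?_⟩
        · refine (h1.nat x (by omega)).trans ?_
          rw [hν x (by omega), Function.update_of_ne (by omega)]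
        · exact eval_congr (r := r + 1) hp (by omega) hν ihN.2 a ha
    exact ⟨(key _).1, (key _).2⟩
  | rep k p ih =>
    replace hp : p.WF t r := hp
    have key : ∀ s : State, s.nat 1 ≠ 0 →
        (∀ x < r, (run ((Prog.loop r 1)^[k] (p.compile t r)) s).nat x = s.nat x) ∧
        ∀ a < t, (run ((Prog.loop r 1)^[k] (p.compile t r)) s).real a
          = (p.eval r s.nat)^[s.nat 1 ^ k] s.real a := by
      induction k with
      | zero => exact fun s hs => ⟨(ih hp hr s hs).nat, (ih hp hr s hs).real⟩
      | succ k ihk =>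
        intro s hs
        rw [Function.iterate_succ_apply', run]
        set body := fun (q : State) (i : ℕ) =>
          run ((Prog.loop r 1)^[k] (p.compile t r)) (q.setNat r i).tick with hbody
        have key : ∀ N, (∀ x < r, ((List.range N).foldl body s.tick).nat x = s.nat x) ∧
            ∀ a < t, ((List.range N).foldl body s.tick).real a
              = (p.eval r s.nat)^[s.nat 1 ^ k * N] s.real a := by
          intro N
          induction N with
          | zero => exact ⟨fun _ _ => rfl, fun _ _ => rfl⟩
          | succ N ihN =>
            rw [List.range_succ, List.foldl_append, List.foldl_cons, List.foldl_nil, mul_add_one,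
              add_comm, Function.iterate_add_apply]
            set q := (List.range N).foldl body s.tick
            have hν : ∀ x < r, (q.setNat r N).tick.nat x = s.nat x := fun x hx => by
              change Function.update q.nat r N x = _
              rw [Function.update_of_ne hx.ne, ihN.1 x hx]
            have h1 := ihk (q.setNat r N).tick (by rw [hν 1 (by omega)]; exact hs)
            refine ⟨fun x hx => (h1.1 x hx).trans (hν x hx), fun a ha => (h1.2 a ha).trans ?_⟩
            rw [hν 1 (by omega)]
            exact iterate_eval_congr hp hr hν ihN.2 _ a ha
        rw [pow_succ]
        exact key _
    exact ⟨(key s hs).1, (key s hs).2⟩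
  | ifLt e f p q ihp ihq =>
    simp only [WF, Bool.and_eq_true] at hp
    obtain ⟨⟨⟨he, hf⟩, hp⟩, hq⟩ := hp
    have hok : ∀ a, (fun b => decide (b < t)) a → a < t := fun a ha => by simpa using ha
    have h1 := Exp.computes_compile e he hok hr s hs
    set s₁ := run (e.compile r t) s with hs₁
    have h2 := Exp.computes_compile (t := t + 1) f hf
      (fun a ha => (hok a ha).trans (Nat.lt_succ_self t)) hr s₁
      (by rw [h1.nat 1 (by omega)]; exact hs)
    set s₂ := run (f.compile r (t + 1)) s₁ with hs₂
    have hν : ∀ x < r, s₂.nat x = s.nat x := fun x hx => (h2.nat x hx).trans (h1.nat x hx)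
    have hA : ∀ a < t, s₂.real a = s.real a := fun a ha =>
      (h2.real a (by omega)).trans (h1.real a ha)
    have hs2 : s₂.tick.nat 1 ≠ 0 := by
      change s₂.nat 1 ≠ 0
      rw [hν 1 (by omega)]; exact hs
    have e1 : s₂.get ⟨t, []⟩ = e.eval r s.nat s.real := by
      rw [Exp.get_scalar, h2.real t (by omega), h1.val]
    have e2 : s₂.get ⟨t + 1, []⟩ = f.eval r s.nat s.real := by
      rw [Exp.get_scalar, h2.val]
      exact Exp.eval_congr hf (by omega) h1.nat fun a ha => h1.real a (hok a ha)
    have hrun : run (compile t (.ifLt e f p q) r) s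
        = run (.ifRealLt ⟨t, []⟩ ⟨t + 1, []⟩ (p.compile t r) (q.compile t r)) s₂ := rfl
    rw [hrun, run, e1, e2]
    by_cases hlt : e.eval r s.nat s.real < f.eval r s.nat s.real
    · rw [if_pos hlt]
      have h3 := ihp hp hr s₂.tick hs2
      refine ⟨fun x hx => (h3.nat x hx).trans (hν x hx), fun a ha => (h3.real a ha).trans ?_⟩
      rw [eval, if_pos hlt]
      exact eval_congr hp hr hν hA a ha
    · rw [if_neg hlt]
      have h3 := ihq hq hr s₂.tick hs2
      refine ⟨fun x hx => (h3.nat x hx).trans (hν x hx), fun a ha => (h3.real a ha).trans ?_⟩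
      rw [eval, if_neg hlt]
      exact eval_congr hq hr hν hA a ha

end Stmt

end RealRAM

namespace RealRAM

/-! ### Evaluation of structured programs -/

namespace Exp

/-- Numerals. -/
def num : ℕ → Exp
  | 0 => .sub (.eq 0 0) (.eq 0 0)
  | k + 1 => .add (num k) (.eq 0 0)

/-- Powers. -/
def pow (e : Exp) : ℕ → Exp
  | 0 => .eq 0 0
  | k + 1 => .mul (pow e k) e

/-- Iterated sums, which bind consecutive registers. -/
def sums : ℕ → Exp → Exp
  | 0, e => e
  | k + 1, e => .sum (sums k e)

theorem eval_add (e f : Exp) (r : ℕ) (ν : ℕ → ℕ) (A : ℕ → List ℕ → ℝ) :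
    (add e f).eval r ν A = e.eval r ν A + f.eval r ν A := rfl

theorem eval_sub (e f : Exp) (r : ℕ) (ν : ℕ → ℕ) (A : ℕ → List ℕ → ℝ) :
    (sub e f).eval r ν A = e.eval r ν A - f.eval r ν A := rfl

theorem eval_mul (e f : Exp) (r : ℕ) (ν : ℕ → ℕ) (A : ℕ → List ℕ → ℝ) :
    (mul e f).eval r ν A = e.eval r ν A * f.eval r ν A := rfl

theorem eval_div (e f : Exp) (r : ℕ) (ν : ℕ → ℕ) (A : ℕ → List ℕ → ℝ) :
    (div e f).eval r ν A = e.eval r ν A / f.eval r ν A := rfl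

theorem eval_sqrt (e : Exp) (r : ℕ) (ν : ℕ → ℕ) (A : ℕ → List ℕ → ℝ) :
    (sqrt e).eval r ν A = √(e.eval r ν A) := rfl

theorem eval_num (k r : ℕ) (ν : ℕ → ℕ) (A : ℕ → List ℕ → ℝ) : (num k).eval r ν A = k := by
  induction k with
  | zero => simp [num, eval]
  | succ k ih => simp [num, eval, ih]

theorem eval_pow (e : Exp) (k r : ℕ) (ν : ℕ → ℕ) (A : ℕ → List ℕ → ℝ) :
    (e.pow k).eval r ν A = e.eval r ν A ^ k := by
  induction k with
  | zero => simp [pow, eval]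
  | succ k ih => rw [pow, eval, ih, pow_succ]

theorem eval_sum {n : ℕ} {e : Exp} {r : ℕ} {ν : ℕ → ℕ} (hν : ν 0 = n) (A : ℕ → List ℕ → ℝ) :
    (sum e).eval r ν A = ∑ i : Fin n, e.eval (r + 1) (Function.update ν r i) A := by
  rw [eval, hν, Finset.sum_range]

end Exp

namespace Stmt

theorem eval_seq (p q : Stmt) (r : ℕ) (ν : ℕ → ℕ) (A : ℕ → List ℕ → ℝ) :
    (seq p q).eval r ν A = q.eval r ν (p.eval r ν A) := rfl

theorem eval_asg_of_ne {a b : ℕ} (h : b ≠ a) (m : ℕ) (e : Exp) (r : ℕ) (ν : ℕ → ℕ)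
    (A : ℕ → List ℕ → ℝ) : (asg a m e).eval r ν A b = A b := by
  rw [eval, Function.update_of_ne h]

theorem eval_asg_apply {a m : ℕ} {e : Exp} {r : ℕ} {ν : ℕ → ℕ} {A : ℕ → List ℕ → ℝ} {l : List ℕ}
    (hl : l.length = m) (hlt : ∀ x ∈ l, x < ν 0) :
    (asg a m e).eval r ν A a l = e.eval (r + m) (extend ν r l) A := by
  rw [eval, Function.update_self, if_pos ⟨hl, hlt⟩]

theorem eval_asg_zero {a : ℕ} {e : Exp} {r : ℕ} {ν : ℕ → ℕ} {A : ℕ → List ℕ → ℝ} {ok : ℕ → Bool}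
    (he : e.WF ok r) (hr : 0 < r) : (asg a 0 e).eval r ν A a [] = e.eval r ν A := by
  refine (eval_asg_apply (m := 0) (l := []) rfl (by simp)).trans ?_
  exact Exp.eval_congr he hr (fun x hx => extend_of_lt hx) fun _ _ => rfl

/-- The arrays that a structured program may change. -/
def writes : Stmt → List ℕ
  | asg a _ _ => [a]
  | seq p q => p.writes ++ q.writes
  | loop p => p.writes
  | rep _ p => p.writes
  | ifLt _ _ p q => p.writes ++ q.writes

theorem eval_of_notMem_writes {p : Stmt} {a : ℕ} (h : a ∉ p.writes) (r : ℕ) (ν : ℕ → ℕ)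
    (A : ℕ → List ℕ → ℝ) : p.eval r ν A a = A a := by
  induction p generalizing r ν A with
  | asg b m e => exact eval_asg_of_ne (by simpa [writes] using h) _ _ _ _ _
  | seq p q ihp ihq =>
    simp only [writes, List.mem_append, not_or] at h
    rw [eval, ihq h.2, ihp h.1]
  | loop p ih =>
    rw [eval]
    generalize List.range (ν 0) = l
    induction l generalizing A with
    | nil => rfl
    | cons i l ihl => rw [List.foldl_cons, ihl, ih h]
  | rep k p ih =>
    rw [eval]
    generalize ν 1 ^ k = N
    induction N generalizing A with
    | zero => rfl
    | succ N ihN => rw [Function.iterate_succ_apply, ihN, ih h]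
  | ifLt e f p q ihp ihq =>
    simp only [writes, List.mem_append, not_or] at h
    rw [eval]
    split_ifs
    · exact ihp h.1 _ _ _
    · exact ihq h.2 _ _ _

end Stmt

end RealRAM

namespace ASVP

open Matrix RealRAM

/-! ### The iteration as a program -/

section Arrays

variable {n : ℕ}

/-- The vector held by an array. -/
def arrVec (n : ℕ) (A : List ℕ → ℝ) : Fin n → ℝ := fun u => A [(u : ℕ)]

/-- The matrix held by an array. -/
def arrMat (n : ℕ) (A : List ℕ → ℝ) : Matrix (Fin n) (Fin n) ℝ :=
  of fun u v => A [(u : ℕ), (v : ℕ)]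

/-- The position of an entry of a moment matrix. -/
def tuplePos (a b : Tuple n) : List ℕ :=
  [(a 0 : ℕ), (a 1 : ℕ), (a 2 : ℕ), (a 3 : ℕ), (a 4 : ℕ), (b 0 : ℕ), (b 1 : ℕ), (b 2 : ℕ),
    (b 3 : ℕ), (b 4 : ℕ)]

/-- The moment matrix held by an array. -/
def arrTuple (n : ℕ) (A : List ℕ → ℝ) : Matrix (Tuple n) (Tuple n) ℝ :=
  of fun a b => A (tuplePos a b)

theorem sum_range_five {M : Type*} [AddCommMonoid M] {N : ℕ} (hN : N = n)
    (f : ℕ → ℕ → ℕ → ℕ → ℕ → M) :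
    ∑ i ∈ Finset.range N, ∑ j ∈ Finset.range N, ∑ k ∈ Finset.range N, ∑ l ∈ Finset.range N,
      ∑ m ∈ Finset.range N, f i j k l m
      = ∑ c : Tuple n, f (c 0) (c 1) (c 2) (c 3) (c 4) := by
  subst hN
  simp only [Finset.sum_range]
  have h : ∀ (k : ℕ) (F : (Fin (k + 1) → Fin N) → M),
      ∑ c, F c = ∑ x, ∑ c : Fin k → Fin N, F (Fin.cons x c) := fun k F => by
    rw [← (Fin.consEquiv fun _ : Fin (k + 1) => Fin N).sum_comp, Fintype.sum_prod_type]
    rfl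
  rw [h]
  refine Finset.sum_congr rfl fun i _ => ?_
  rw [h]
  refine Finset.sum_congr rfl fun j _ => ?_
  rw [h]
  refine Finset.sum_congr rfl fun k _ => ?_
  rw [h]
  refine Finset.sum_congr rfl fun l _ => ?_
  rw [h]
  refine Finset.sum_congr rfl fun m _ => ?_
  rw [Fintype.sum_unique]
  rfl

theorem arrTuple_asg {k : ℕ} {e : Exp} {ν : ℕ → ℕ} (hν : ν 0 = n) (A : ℕ → List ℕ → ℝ) :
    arrTuple n ((Stmt.asg k 10 e).eval 2 ν A k)
      = of fun a b => e.eval 12 (extend ν 2 (tuplePos a b)) A := by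
  ext a b
  refine Stmt.eval_asg_apply rfl fun x hx => ?_
  simp only [tuplePos, List.mem_cons, List.not_mem_nil, or_false] at hx
  rw [hν]
  rcases hx with rfl | rfl | rfl | rfl | rfl | rfl | rfl | rfl | rfl | rfl <;> exact Fin.is_lt _

/-- The size of the input plus two. -/
def sizeExp : Exp := .reg 1

/-- The entry of the matrix `shiftedGrad` of the accumulator in array `3`, the row index being in
the registers `2` to `6`, and the column index in the registers `7` to `11`. -/
def gradExp : Exp :=
  .sub (.mul (.mul (.mul (.mul (.mul (.eq 2 7) (.eq 3 8)) (.eq 4 9)) (.eq 5 10)) (.eq 6 11))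
      (.add (sizeExp.pow 120) (.mul (sizeExp.pow 20) (.sqrt (.pow (.sum
        (.mul (.mul (.mul (.cell 0 [12, 2]) (.cell 0 [12, 3])) (.cell 0 [12, 4]))
          (.cell 0 [12, 5]))) 2)))))
    (.sub (.sub (.sub (.sub (.mul (.num 6) (.cell 3 [2, 3, 4, 5, 6, 7, 8, 9, 10, 11]))
      (.cell 3 [6, 2, 3, 4, 5, 11, 7, 8, 9, 10]))
      (.cell 3 [3, 4, 5, 6, 2, 8, 9, 10, 11, 7]))
      (.mul (.num 2) (.cell 3 [2, 3, 4, 5, 10, 7, 8, 9, 6, 11])))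
      (.mul (.num 2) (.cell 3 [2, 3, 4, 11, 6, 7, 8, 9, 10, 5])))

/-- The compressed gradient is put into array `5`. -/
def gradStmt : Stmt :=
  .seq (.asg 4 10 gradExp)
    (.seq (.asg 14 10 (.sum (.mul (.cell 0 [6, 12]) (.cell 4 [2, 3, 4, 5, 12, 7, 8, 9, 10, 11]))))
      (.asg 5 10 (.sum (.mul (.cell 14 [2, 3, 4, 5, 6, 7, 8, 9, 10, 12]) (.cell 0 [12, 11])))))

/-- The matrix in array `6` is multiplied by the matrix in array `5`. -/
def mulStmt : Stmt :=
  .seq (.asg 7 10 (.sums 5 (.mul (.cell 6 [2, 3, 4, 5, 6, 12, 13, 14, 15, 16])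
      (.cell 5 [12, 13, 14, 15, 16, 7, 8, 9, 10, 11]))))
    (.asg 6 10 (.cell 7 [2, 3, 4, 5, 6, 7, 8, 9, 10, 11]))

/-- The normalized power of the matrix in array `5` is added to the accumulator. -/
def powerStmt : Stmt :=
  .seq (.asg 6 10 (.cell 5 [2, 3, 4, 5, 6, 7, 8, 9, 10, 11]))
    (.seq (.rep 250 mulStmt)
      (.seq (.asg 7 10 (.add (.cell 3 [2, 3, 4, 5, 6, 7, 8, 9, 10, 11])
          (.div (.cell 6 [2, 3, 4, 5, 6, 7, 8, 9, 10, 11])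
            (.sums 5 (.cell 6 [12, 13, 14, 15, 16, 12, 13, 14, 15, 16])))))
        (.asg 3 10 (.cell 7 [2, 3, 4, 5, 6, 7, 8, 9, 10, 11]))))

/-- All iterations. -/
def accumulateStmt : Stmt := .rep 110 (.seq gradStmt powerStmt)

variable {ν : ℕ → ℕ} {Q : Matrix (Fin n) (Fin n) ℝ}

theorem eval_gradExp (hν : ν 0 = n) {A : ℕ → List ℕ → ℝ} (hA : arrMat n (A 0) = Q)
    (a b : Tuple n) :
    gradExp.eval 12 (extend ν 2 (tuplePos a b)) A
      = shiftedGrad (momentSymm n) (quadObjective Q) ((ν 1 : ℝ) ^ 20) ((ν 1 : ℝ) ^ 120)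
        (arrTuple n (A 3)) a b := by
  have hsum : (Exp.sum (.mul (.mul (.mul (.cell 0 [12, 2]) (.cell 0 [12, 3])) (.cell 0 [12, 4]))
      (.cell 0 [12, 5]))).eval 12 (extend ν 2 (tuplePos a b)) A
      = quad Q ![a 0, a 1, a 2, a 3] := by
    rw [Exp.eval_sum (n := n) (by exact hν), quad]
    refine Finset.sum_congr rfl fun u _ => ?_
    rw [Fin.prod_univ_four, ← hA]
    rfl
  have heq : ∀ x y : Fin n, (if (x : ℕ) = (y : ℕ) then (1 : ℝ) else 0) = if x = y then 1 else 0 :=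
    fun x y => by simp only [Fin.ext_iff]
  have hdelta : (Exp.mul (.mul (.mul (.mul (.eq 2 7) (.eq 3 8)) (.eq 4 9)) (.eq 5 10))
      (.eq 6 11)).eval 12 (extend ν 2 (tuplePos a b)) A = (1 : Matrix (Tuple n) (Tuple n) ℝ) a b := by
    change (if (a 0 : ℕ) = (b 0 : ℕ) then (1 : ℝ) else 0) * (if (a 1 : ℕ) = (b 1 : ℕ) then 1 else 0)
      * (if (a 2 : ℕ) = (b 2 : ℕ) then 1 else 0) * (if (a 3 : ℕ) = (b 3 : ℕ) then 1 else 0)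
      * (if (a 4 : ℕ) = (b 4 : ℕ) then 1 else 0) = _
    simp only [heq, ite_zero_mul_ite_zero, mul_one, one_apply]
    refine if_congr ⟨fun h => ?_, fun h => by simp [h]⟩ rfl rfl
    rw [← tuple_eta a, ← tuple_eta b, h.1.1.1.1, h.1.1.1.2, h.1.1.2, h.1.2, h.2]
  have hsize : sizeExp.eval 12 (extend ν 2 (tuplePos a b)) A = ν 1 := rfl
  rw [gradExp, Exp.eval_sub, Exp.eval_mul, hdelta, Exp.eval_add, Exp.eval_mul, Exp.eval_sqrt,
    Exp.eval_pow, Exp.eval_pow, Exp.eval_pow, hsum, hsize, Real.sqrt_sq_eq_abs]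
  rw [shiftedGrad, Matrix.sub_apply, penaltyGrad_momentSymm, Matrix.add_apply, Matrix.smul_apply,
    Matrix.smul_apply]
  congr 1
  · rw [diagonal_apply, one_apply, smul_eq_mul, smul_eq_mul]
    split_ifs
    · rw [quadObjective]; ring
    · ring
  · simp only [Exp.eval, Exp.eval_num]
    push_cast
    rfl

theorem eval_gradStmt (hQ : IsProjector n Q) (hν : ν 0 = n) {A : ℕ → List ℕ → ℝ}
    (hA : arrMat n (A 0) = Q) :
    arrTuple n (gradStmt.eval 2 ν A 5)
      = lastProj Q * shiftedGrad (momentSymm n) (quadObjective Q) ((ν 1 : ℝ) ^ 20)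
        ((ν 1 : ℝ) ^ 120) (arrTuple n (A 3)) * lastProj Q := by
  rw [gradStmt, Stmt.eval_seq, Stmt.eval_seq, arrTuple_asg hν]
  set A₁ := (Stmt.asg 4 10 gradExp).eval 2 ν A with hA₁
  have h1 : arrTuple n (A₁ 4) = shiftedGrad (momentSymm n) (quadObjective Q) ((ν 1 : ℝ) ^ 20)
        ((ν 1 : ℝ) ^ 120) (arrTuple n (A 3)) := by
    rw [hA₁, arrTuple_asg hν]
    ext a b
    exact eval_gradExp hν hA a b
  have h10 : arrMat n (A₁ 0) = Q := by
    rw [hA₁, Stmt.eval_asg_of_ne (by norm_num), hA]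
  rw [← h1]
  set A₂ := (Stmt.asg 14 10 (.sum (.mul (.cell 0 [6, 12])
    (.cell 4 [2, 3, 4, 5, 12, 7, 8, 9, 10, 11])))).eval 2 ν A₁ with hA₂
  have h2 : arrTuple n (A₂ 14) = lastProj Q * arrTuple n (A₁ 4) := by
    rw [hA₂, arrTuple_asg hν]
    ext a b
    rw [of_apply, Exp.eval_sum (n := n) (by exact hν), lastProj_mul_apply]
    refine Finset.sum_congr rfl fun x _ => ?_
    rw [← h10]
    rfl
  have h20 : arrMat n (A₂ 0) = Q := by
    rw [hA₂, Stmt.eval_asg_of_ne (by norm_num), h10]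
  rw [← h2]
  ext a b
  rw [of_apply, Exp.eval_sum (n := n) (by exact hν), mul_lastProj_apply hQ]
  refine Finset.sum_congr rfl fun x _ => ?_
  rw [← h20]
  rfl

theorem eval_mulStmt (hν : ν 0 = n) (A : ℕ → List ℕ → ℝ) :
    arrTuple n (mulStmt.eval 2 ν A 6) = arrTuple n (A 6) * arrTuple n (A 5) := by
  rw [mulStmt, Stmt.eval_seq, arrTuple_asg hν]
  set A₁ := (Stmt.asg 7 10 (.sums 5 (.mul (.cell 6 [2, 3, 4, 5, 6, 12, 13, 14, 15, 16])
      (.cell 5 [12, 13, 14, 15, 16, 7, 8, 9, 10, 11])))).eval 2 ν A with hA₁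
  have h1 : arrTuple n (A₁ 7) = arrTuple n (A 6) * arrTuple n (A 5) := by
    rw [hA₁, arrTuple_asg hν]
    ext a b
    refine Eq.trans ?_ (sum_range_five hν fun i j k l m =>
      A 6 [a 0, a 1, a 2, a 3, a 4, i, j, k, l, m] * A 5 [i, j, k, l, m, b 0, b 1, b 2, b 3, b 4])
    rfl
  rw [← h1]
  rfl

theorem arrTuple_iterate_mulStmt (hν : ν 0 = n) (A : ℕ → List ℕ → ℝ) (N : ℕ) :
    arrTuple n ((mulStmt.eval 2 ν)^[N] A 6) = arrTuple n (A 6) * arrTuple n (A 5) ^ N := by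
  induction N generalizing A with
  | zero => simp
  | succ N ih =>
    rw [Function.iterate_succ_apply, ih, eval_mulStmt hν,
      Stmt.eval_of_notMem_writes (a := 5) (by decide), pow_succ', Matrix.mul_assoc]

theorem eval_powerStmt (hν : ν 0 = n) (A : ℕ → List ℕ → ℝ) :
    arrTuple n (powerStmt.eval 2 ν A 3) = arrTuple n (A 3)
      + ((arrTuple n (A 5) ^ (ν 1 ^ 250 + 1)).trace)⁻¹ • arrTuple n (A 5) ^ (ν 1 ^ 250 + 1) := by
  rw [powerStmt, Stmt.eval_seq, Stmt.eval_seq, Stmt.eval_seq, arrTuple_asg hν]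
  set A₁ := (Stmt.asg 6 10 (.cell 5 [2, 3, 4, 5, 6, 7, 8, 9, 10, 11])).eval 2 ν A with hA₁
  have h1 : arrTuple n (A₁ 6) = arrTuple n (A 5) := by
    rw [hA₁, arrTuple_asg hν]
    rfl
  set A₂ := (mulStmt.eval 2 ν)^[ν 1 ^ 250] A₁ with hA₂
  have h2 : arrTuple n (A₂ 6) = arrTuple n (A 5) ^ (ν 1 ^ 250 + 1) := by
    rw [hA₂, arrTuple_iterate_mulStmt hν, h1, hA₁, Stmt.eval_asg_of_ne (by norm_num),
      pow_succ' (arrTuple n (A 5))]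
  have h3 : A₂ 3 = A 3 := by
    have : A₂ = (Stmt.rep 250 mulStmt).eval 2 ν A₁ := rfl
    rw [this, Stmt.eval_of_notMem_writes (by decide), hA₁, Stmt.eval_asg_of_ne (by norm_num)]
  rw [← h2, ← h3]
  ext a b
  set A₃ := (Stmt.asg 7 10 (.add (.cell 3 [2, 3, 4, 5, 6, 7, 8, 9, 10, 11])
    (.div (.cell 6 [2, 3, 4, 5, 6, 7, 8, 9, 10, 11])
      (.sums 5 (.cell 6 [12, 13, 14, 15, 16, 12, 13, 14, 15, 16]))))).eval 2 ν A₂ with hA₃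
  change arrTuple n (A₃ 7) a b = _
  rw [hA₃, arrTuple_asg hν, Matrix.add_apply, Matrix.smul_apply, smul_eq_mul, inv_mul_eq_div]
  have htr : (arrTuple n (A₂ 6)).trace = (Exp.sums 5
      (.cell 6 [12, 13, 14, 15, 16, 12, 13, 14, 15, 16])).eval 12
      (extend ν 2 (tuplePos a b)) A₂ := by
    refine (sum_range_five hν fun i j k l m =>
      A₂ 6 [i, j, k, l, m, i, j, k, l, m]).symm.trans ?_
    rfl
  rw [htr]
  rfl

theorem eval_accumulateStmt (hQ : IsProjector n Q) (hν : ν 0 = n) {A : ℕ → List ℕ → ℝ}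
    (hA : arrMat n (A 0) = Q) (hA3 : arrTuple n (A 3) = 0) :
    arrTuple n (accumulateStmt.eval 2 ν A 3)
      = accumulator Q ((ν 1 : ℝ) ^ 20) ((ν 1 : ℝ) ^ 120) (ν 1 ^ 250 + 1) (ν 1 ^ 110) := by
  rw [accumulateStmt, Stmt.eval]
  generalize ν 1 ^ 110 = T
  suffices h : arrMat n (((Stmt.seq gradStmt powerStmt).eval 2 ν)^[T] A 0) = Q ∧
      arrTuple n (((Stmt.seq gradStmt powerStmt).eval 2 ν)^[T] A 3)
        = accumulator Q ((ν 1 : ℝ) ^ 20) ((ν 1 : ℝ) ^ 120) (ν 1 ^ 250 + 1) T from h.2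
  induction T with
  | zero => exact ⟨hA, hA3⟩
  | succ T ih =>
    rw [Function.iterate_succ_apply', accumulator, Function.iterate_succ_apply', ← accumulator,
      ← ih.2]
    set B := ((Stmt.seq gradStmt powerStmt).eval 2 ν)^[T] A
    refine ⟨?_, ?_⟩
    · rw [Stmt.eval_of_notMem_writes (by decide), ih.1]
    · rw [Stmt.eval_seq, eval_powerStmt hν, eval_gradStmt hQ hν ih.1,
        Stmt.eval_of_notMem_writes (p := gradStmt) (by decide)]
      rfl

end Arrays

end ASVP

namespace ASVP

open Matrix RealRAM

/-! ### The rounding as a program -/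

section RoundProgram

variable {n : ℕ}

/-- The ratio that the output is chosen to maximize. -/
noncomputable def quarticRatio (g : Fin n → ℝ) : ℝ := (∑ u, g u ^ 4) / (∑ u, g u ^ 2) ^ 2

/-- The value of `roundPotential` for the parameter in array `10`, the function `g`, where `g` is
an expression in the register `R`, and the matrix in array `13`. -/
def potentialExp (g : Exp) (R : ℕ) : Exp :=
  .sub (.sum (.add (.add (g.pow 4) (.mul (.num 6) (.mul (g.pow 2) (.cell 13 [R, R]))))
      (Exp.pow (.cell 13 [R, R]) 2)))
    (.mul (.cell 10 []) (.add (.add (Exp.pow (.sum (g.pow 2)) 2)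
        (.mul (.num 6) (.mul (.sum (g.pow 2)) (.sum (.cell 13 [R, R])))))
      (.mul (.num 3) (Exp.pow (.sum (.cell 13 [R, R])) 2))))

/-- One step of the rounding of the matrix in array `8`, at the pivot in the register `r`. -/
def pivotStmt (r : ℕ) : Stmt :=
  .seq (.asg 11 1 (.div (.cell 8 [r + 1, r]) (.sqrt (.cell 8 [r, r]))))
    (.seq (.asg 13 2 (.sub (.cell 8 [r + 1, r + 2])
        (.mul (.cell 11 [r + 1]) (.cell 11 [r + 2]))))
      (.seq (.ifLt (potentialExp (.sub (.cell 9 [r + 1]) (.cell 11 [r + 1])) (r + 1))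
          (potentialExp (.add (.cell 9 [r + 1]) (.cell 11 [r + 1])) (r + 1))
          (.asg 12 1 (.add (.cell 9 [r + 1]) (.cell 11 [r + 1])))
          (.asg 12 1 (.sub (.cell 9 [r + 1]) (.cell 11 [r + 1]))))
        (.seq (.asg 9 1 (.cell 12 [r + 1])) (.asg 8 2 (.cell 13 [r + 1, r + 2])))))

def ratioExp (r : ℕ) : Exp :=
  .div (.sum (Exp.pow (.cell 9 [r]) 4)) (Exp.pow (.sum (Exp.pow (.cell 9 [r]) 2)) 2)

/-- At level `r`: the matrix in array `8` is rounded, and the result is copied to the output array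
if its ratio exceeds the one in array `2`. -/
def roundStmt (r : ℕ) : Stmt :=
  .seq (.asg 10 0 (.div (.sum (Exp.pow (.cell 8 [r, r]) 2))
      (.mul (.num 6) (Exp.pow (.sum (.cell 8 [r, r])) 2))))
    (.seq (.asg 9 1 (.num 0))
      (.seq (.loop (pivotStmt r))
        (.ifLt (.cell 2 []) (ratioExp r)
          (.seq (.asg 1 1 (.cell 9 [r])) (.asg 2 0 (ratioExp r)))
          (.asg 12 1 (.num 0)))))

variable {ν : ℕ → ℕ} {r : ℕ}

theorem arrVec_asg {k : ℕ} {e : Exp} (hν : ν 0 = n) (A : ℕ → List ℕ → ℝ) :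
    arrVec n ((Stmt.asg k 1 e).eval r ν A k)
      = fun u : Fin n => e.eval (r + 1) (extend ν r [(u : ℕ)]) A := by
  ext u
  exact Stmt.eval_asg_apply rfl fun x hx => by
    rw [List.mem_singleton.1 hx, hν]; exact u.2

theorem arrMat_asg {k : ℕ} {e : Exp} (hν : ν 0 = n) (A : ℕ → List ℕ → ℝ) :
    arrMat n ((Stmt.asg k 2 e).eval r ν A k)
      = of fun u v : Fin n => e.eval (r + 2) (extend ν r [(u : ℕ), (v : ℕ)]) A := by
  ext u v
  refine Stmt.eval_asg_apply rfl fun x hx => ?_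
  simp only [List.mem_cons, List.not_mem_nil, or_false] at hx
  rw [hν]
  rcases hx with rfl | rfl <;> exact Fin.is_lt _

theorem extend_self (ν : ℕ → ℕ) (r x : ℕ) (l : List ℕ) : extend ν r (x :: l) r = x := by
  simp [extend]

theorem extend_succ (ν : ℕ → ℕ) (r x y : ℕ) (l : List ℕ) :
    extend ν r (x :: y :: l) (r + 1) = y := by
  simp [extend]

theorem extend_update (ν : ℕ → ℕ) (r i : ℕ) (l : List ℕ) :
    extend (Function.update ν r i) (r + 1) l r = i := by
  simp [extend]

theorem eval_potentialExp {g : Exp} {f : Fin n → ℝ} (hν : ν 0 = n) {A : ℕ → List ℕ → ℝ}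
    (hg : ∀ u : Fin n, g.eval (r + 1) (Function.update ν r u) A = f u) :
    (potentialExp g r).eval r ν A = roundPotential (A 10 []) f (arrMat n (A 13)) := by
  have h13 : ∀ u : Fin n, (Exp.cell 13 [r, r]).eval (r + 1) (Function.update ν r u) A
      = arrMat n (A 13) u u := fun u => by
    simp [Exp.eval, arrMat]
  simp only [potentialExp, Exp.eval_sub, Exp.eval_add, Exp.eval_mul, Exp.eval_pow, Exp.eval_num,
    Exp.eval_sum hν, hg, h13, roundPotential]
  push_cast
  rfl

theorem eval_pivotStmt (hr : 0 < r) (hν : ν 0 = n) (A : ℕ → List ℕ → ℝ) (i : Fin n) :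
    (arrMat n ((pivotStmt r).eval (r + 1) (Function.update ν r i) A 8),
      arrVec n ((pivotStmt r).eval (r + 1) (Function.update ν r i) A 9))
      = roundStep (A 10 []) (arrMat n (A 8), arrVec n (A 9)) i := by
  set ν' := Function.update ν r (i : ℕ) with hν'
  have h0 : ν' 0 = n := by rw [hν', Function.update_of_ne hr.ne, hν]
  simp only [pivotStmt, Stmt.eval_seq]
  set A₁ := (Stmt.asg 11 1 (.div (.cell 8 [r + 1, r]) (.sqrt (.cell 8 [r, r])))).eval (r + 1) ν' A
    with hA₁
  have h1 : arrVec n (A₁ 11) = pivotFun (arrMat n (A 8)) i := by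
    rw [hA₁, arrVec_asg h0]
    ext u
    simp [Exp.eval, extend_self, extend_update, hν', pivotFun, arrMat]
  have h1' : ∀ k ≠ 11, A₁ k = A k := fun k hk => Stmt.eval_asg_of_ne hk _ _ _ _ _
  set A₂ := (Stmt.asg 13 2 (.sub (.cell 8 [r + 1, r + 2])
        (.mul (.cell 11 [r + 1]) (.cell 11 [r + 2])))).eval (r + 1) ν' A₁ with hA₂
  have h2 : arrMat n (A₂ 13) = pivotRest (arrMat n (A 8)) i := by
    rw [hA₂, arrMat_asg h0]
    ext u v
    rw [pivotRest, of_apply, of_apply, ← h1, ← h1' 8 (by norm_num)]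
    simp only [Exp.eval, List.map_cons, List.map_nil, extend_self, extend_succ]
    rfl
  have h2' : ∀ k ≠ 13, A₂ k = A₁ k := fun k hk => Stmt.eval_asg_of_ne hk _ _ _ _ _
  have h11 : arrVec n (A₂ 11) = pivotFun (arrMat n (A 8)) i := by rw [h2' 11 (by norm_num), h1]
  have h9 : arrVec n (A₂ 9) = arrVec n (A 9) := by
    rw [h2' 9 (by norm_num), h1' 9 (by norm_num)]
  have h10 : A₂ 10 = A 10 := by rw [h2' 10 (by norm_num), h1' 10 (by norm_num)]
  have hsub : ∀ u : Fin n, (Exp.sub (.cell 9 [r + 1]) (.cell 11 [r + 1])).eval (r + 1 + 1)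
      (Function.update ν' (r + 1) u) A₂ = arrVec n (A 9) u - pivotFun (arrMat n (A 8)) i u :=
    fun u => by
      rw [← h9, ← h11]
      simp [Exp.eval, arrVec]
  have hadd : ∀ u : Fin n, (Exp.add (.cell 9 [r + 1]) (.cell 11 [r + 1])).eval (r + 1 + 1)
      (Function.update ν' (r + 1) u) A₂ = arrVec n (A 9) u + pivotFun (arrMat n (A 8)) i u :=
    fun u => by
      rw [← h9, ← h11]
      simp [Exp.eval, arrVec]
  set A₃ := (Stmt.ifLt (potentialExp (.sub (.cell 9 [r + 1]) (.cell 11 [r + 1])) (r + 1))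
          (potentialExp (.add (.cell 9 [r + 1]) (.cell 11 [r + 1])) (r + 1))
          (.asg 12 1 (.add (.cell 9 [r + 1]) (.cell 11 [r + 1])))
          (.asg 12 1 (.sub (.cell 9 [r + 1]) (.cell 11 [r + 1])))).eval (r + 1) ν' A₂ with hA₃
  have h3 : arrVec n (A₃ 12) = (roundStep (A 10 []) (arrMat n (A 8), arrVec n (A 9)) i).2 := by
    rw [hA₃, Stmt.eval, eval_potentialExp h0 hsub, eval_potentialExp h0 hadd, h10, h2, roundStep]
    split_ifs
    · rw [arrVec_asg h0]
      ext u
      rw [← h9, ← h11]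
      simp only [Exp.eval, List.map_cons, List.map_nil, extend_self]
      rfl
    · rw [arrVec_asg h0]
      ext u
      rw [← h9, ← h11]
      simp only [Exp.eval, List.map_cons, List.map_nil, extend_self]
      rfl
  have h3' : A₃ 13 = A₂ 13 := Stmt.eval_of_notMem_writes (by simp [Stmt.writes]) _ _ _
  refine Prod.ext ?_ ?_
  · change arrMat n _ = pivotRest (arrMat n (A 8)) i
    have h4 : (Stmt.asg 9 1 (.cell 12 [r + 1])).eval (r + 1) ν' A₃ 13 = A₃ 13 :=
      Stmt.eval_asg_of_ne (by norm_num) _ _ _ _ _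
    rw [arrMat_asg h0, ← h2, ← h3', ← h4]
    ext u v
    simp only [of_apply, Exp.eval, List.map_cons, List.map_nil, extend_self, extend_succ]
    rfl
  · dsimp only
    rw [Stmt.eval_asg_of_ne (b := 9) (by norm_num), arrVec_asg h0]
    rw [← h3]
    ext u
    simp only [Exp.eval, List.map_cons, List.map_nil, extend_self]
    rfl

theorem writes_pivotStmt (r : ℕ) : (pivotStmt r).writes = [11, 13, 12, 12, 9, 8] := rfl

theorem foldl_pivotStmt (hr : 0 < r) (hν : ν 0 = n) (l : List (Fin n)) (A : ℕ → List ℕ → ℝ) :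
    (arrMat n (l.foldl (fun A (i : Fin n) =>
        (pivotStmt r).eval (r + 1) (Function.update ν r i) A) A 8),
      arrVec n (l.foldl (fun A (i : Fin n) =>
        (pivotStmt r).eval (r + 1) (Function.update ν r i) A) A 9))
      = l.foldl (roundStep (A 10 [])) (arrMat n (A 8), arrVec n (A 9)) := by
  induction l generalizing A with
  | nil => rfl
  | cons i l ih =>
    rw [List.foldl_cons, List.foldl_cons, ih, eval_pivotStmt hr hν,
      Stmt.eval_of_notMem_writes (a := 10) (by simp [writes_pivotStmt])]

theorem eval_loop_pivotStmt (hr : 0 < r) (hν : ν 0 = n) (A : ℕ → List ℕ → ℝ) :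
    arrVec n ((Stmt.loop (pivotStmt r)).eval r ν A 9)
      = ((List.finRange n).foldl (roundStep (A 10 [])) (arrMat n (A 8), arrVec n (A 9))).2 := by
  rw [← foldl_pivotStmt hr hν, Stmt.eval, hν, ← List.map_coe_finRange_eq_range, List.foldl_map]

theorem eval_ratioExp (hν : ν 0 = n) (A : ℕ → List ℕ → ℝ) :
    (ratioExp r).eval r ν A = quarticRatio (arrVec n (A 9)) := by
  have h9 : ∀ u : Fin n, (Exp.cell 9 [r]).eval (r + 1) (Function.update ν r u) A
      = arrVec n (A 9) u := fun u => by simp [Exp.eval, arrVec]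
  simp only [ratioExp, Exp.eval_div, Exp.eval_pow, Exp.eval_sum hν, h9, quarticRatio]

/-- The output is replaced if the rounded function has a larger ratio. -/
theorem eval_roundStmt (hr : 2 ≤ r) (hν : ν 0 = n) (A : ℕ → List ℕ → ℝ) :
    (A 2 [] < quarticRatio (signRound (arrMat n (A 8))) →
      arrVec n ((roundStmt r).eval r ν A 1) = signRound (arrMat n (A 8)) ∧
        (roundStmt r).eval r ν A 2 [] = quarticRatio (signRound (arrMat n (A 8)))) ∧
    (quarticRatio (signRound (arrMat n (A 8))) ≤ A 2 [] →
      (roundStmt r).eval r ν A 1 = A 1 ∧ (roundStmt r).eval r ν A 2 = A 2) := by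
  simp only [roundStmt, Stmt.eval_seq]
  set A₁ := (Stmt.asg 10 0 (.div (.sum (Exp.pow (.cell 8 [r, r]) 2))
      (.mul (.num 6) (Exp.pow (.sum (.cell 8 [r, r])) 2)))).eval r ν A with hA₁
  have h8 : ∀ u : Fin n, (Exp.cell 8 [r, r]).eval (r + 1) (Function.update ν r u) A
      = arrMat n (A 8) u u := fun u => by simp [Exp.eval, arrMat]
  have h1 : A₁ 10 [] = sparsityRatio (arrMat n (A 8)) := by
    rw [hA₁, Stmt.eval_asg_zero (ok := fun _ => true) (by
      simp [Exp.WF, Exp.pow, Exp.num]; omega) (by omega)]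
    simp only [Exp.eval_div, Exp.eval_mul, Exp.eval_num, Exp.eval_pow, Exp.eval_sum hν, h8,
      sparsityRatio]
    push_cast
    rfl
  have h1' : ∀ k ≠ 10, A₁ k = A k := fun k hk => Stmt.eval_asg_of_ne hk _ _ _ _ _
  set A₂ := (Stmt.asg 9 1 (.num 0)).eval r ν A₁ with hA₂
  have h2 : arrVec n (A₂ 9) = fun _ => 0 := by
    rw [hA₂, arrVec_asg hν]
    ext u
    rw [Exp.eval_num, Nat.cast_zero]
  have h2' : ∀ k ≠ 9, A₂ k = A₁ k := fun k hk => Stmt.eval_asg_of_ne hk _ _ _ _ _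
  set A₃ := (Stmt.loop (pivotStmt r)).eval r ν A₂ with hA₃
  have h3 : arrVec n (A₃ 9) = signRound (arrMat n (A 8)) := by
    rw [hA₃, eval_loop_pivotStmt (by omega) hν, h2, h2' 10 (by norm_num), h1, h2' 8 (by norm_num),
      h1' 8 (by norm_num), signRound]
  have h31 : A₃ 1 = A 1 := by
    rw [hA₃, Stmt.eval_of_notMem_writes (by simp [Stmt.writes, writes_pivotStmt]),
      h2' 1 (by norm_num), h1' 1 (by norm_num)]
  have h32 : A₃ 2 = A 2 := by
    rw [hA₃, Stmt.eval_of_notMem_writes (by simp [Stmt.writes, writes_pivotStmt]),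
      h2' 2 (by norm_num), h1' 2 (by norm_num)]
  have hcell : (Exp.cell 2 []).eval r ν A₃ = A 2 [] := by rw [← h32]; rfl
  have hwf : (ratioExp r).WF (fun _ => true) r := by
    simp [ratioExp, Exp.WF, Exp.pow]; omega
  rw [Stmt.eval, hcell, eval_ratioExp hν, h3]
  constructor
  · intro h
    rw [if_pos h, Stmt.eval_seq]
    refine ⟨?_, ?_⟩
    · rw [Stmt.eval_asg_of_ne (by norm_num), arrVec_asg hν, ← h3]
      ext u
      simp only [Exp.eval, List.map_cons, List.map_nil, extend_self]
      rfl
    · rw [Stmt.eval_asg_zero hwf (by omega), eval_ratioExp hν,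
        Stmt.eval_asg_of_ne (by norm_num), h3]
  · intro h
    rw [if_neg (not_lt.2 h)]
    exact ⟨(Stmt.eval_asg_of_ne (by norm_num) _ _ _ _ _).trans h31,
      (Stmt.eval_asg_of_ne (by norm_num) _ _ _ _ _).trans h32⟩

theorem writes_roundStmt (r : ℕ) :
    (roundStmt r).writes = [10, 9, 11, 13, 12, 12, 9, 8, 1, 2, 12] := rfl

end RoundProgram

end ASVP

namespace ASVP

open Matrix RealRAM

/-! ### The algorithm -/

section Search

variable {n : ℕ} {Q : Matrix (Fin n) (Fin n) ℝ} {S : Matrix (Tuple n) (Tuple n) ℝ}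

/-- The matrix with the entries given by `e`, at level `r`, is rounded, and the result is compared
with the output. -/
def tryStmt (r : ℕ) (e : Exp) : Stmt := .seq (.asg 8 2 e) (roundStmt r)

/-- The candidates: the input, the rank one matrices of its columns, and the diagonal blocks of the
accumulator. -/
def searchStmt : Stmt :=
  .seq (tryStmt 2 (.cell 0 [2, 3]))
    (.seq (.loop (tryStmt 3 (.mul (.cell 0 [3, 2]) (.cell 0 [4, 2]))))
      (.loop (.loop (.loop (.loop (tryStmt 6 (.cell 3 [2, 3, 4, 5, 6, 2, 3, 4, 5, 7])))))))

/-- During the search, the input and the accumulator stay in place, the output is in the image of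
the input, and its ratio is in array `2`. -/
structure SearchInvariant (Q : Matrix (Fin n) (Fin n) ℝ) (S : Matrix (Tuple n) (Tuple n) ℝ)
    (A : ℕ → List ℕ → ℝ) : Prop where
  input : arrMat n (A 0) = Q
  acc : arrTuple n (A 3) = S
  mem : Q *ᵥ arrVec n (A 1) = arrVec n (A 1)
  ratio : A 2 [] = quarticRatio (arrVec n (A 1))

/-- A part of the search after which the ratio of the output is at least as large as before, and
at least as large as the numbers in `vals`. -/
def Improves (Q : Matrix (Fin n) (Fin n) ℝ) (S : Matrix (Tuple n) (Tuple n) ℝ)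
    (F : (ℕ → List ℕ → ℝ) → ℕ → List ℕ → ℝ) (vals : Set ℝ) : Prop :=
  ∀ A, SearchInvariant Q S A → SearchInvariant Q S (F A) ∧ A 2 [] ≤ F A 2 [] ∧
    ∀ c ∈ vals, c ≤ F A 2 []

theorem Improves.comp {F G : (ℕ → List ℕ → ℝ) → ℕ → List ℕ → ℝ} {s t : Set ℝ}
    (hF : Improves Q S F s) (hG : Improves Q S G t) :
    Improves Q S (fun A => G (F A)) (s ∪ t) := fun A hA => by
  obtain ⟨h1, h2, h3⟩ := hF A hA
  obtain ⟨h4, h5, h6⟩ := hG (F A) h1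
  exact ⟨h4, h2.trans h5, fun c hc => hc.elim (fun h => (h3 c h).trans h5) (h6 c)⟩

theorem Improves.loop {p : Stmt} {r : ℕ} {ν : ℕ → ℕ} (hν : ν 0 = n) {vals : Fin n → Set ℝ}
    (h : ∀ i : Fin n, Improves Q S (p.eval (r + 1) (Function.update ν r i)) (vals i)) :
    Improves Q S ((Stmt.loop p).eval r ν) (⋃ i, vals i) := by
  have key : ∀ l : List (Fin n), Improves Q S (fun A =>
      l.foldl (fun A (i : Fin n) => p.eval (r + 1) (Function.update ν r i) A) A)
      {c | ∃ i ∈ l, c ∈ vals i} := by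
    intro l
    induction l with
    | nil => exact fun A hA => ⟨hA, le_rfl, by simp⟩
    | cons i l ih =>
      intro A hA
      obtain ⟨h1, h2, h3⟩ := (h i).comp ih A hA
      refine ⟨h1, h2, fun c hc => h3 c ?_⟩
      obtain ⟨j, hj, hc⟩ := hc
      rcases List.mem_cons.1 hj with rfl | hj
      exacts [Or.inl hc, Or.inr ⟨j, hj, hc⟩]
  intro A hA
  rw [Stmt.eval, hν, ← List.map_coe_finRange_eq_range, List.foldl_map]
  obtain ⟨h1, h2, h3⟩ := key (List.finRange n) A hA
  refine ⟨h1, h2, fun c hc => h3 c ?_⟩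
  obtain ⟨i, hi⟩ := Set.mem_iUnion.1 hc
  exact ⟨i, List.mem_finRange i, hi⟩

theorem improves_tryStmt {r : ℕ} {e : Exp} {ν : ℕ → ℕ} (hr : 2 ≤ r) (hν : ν 0 = n)
    {P : Matrix (Fin n) (Fin n) ℝ} (hP : P.PosSemidef)
    (hQP : ∀ j, Q *ᵥ (fun u => P u j) = fun u => P u j)
    (he : ∀ A, SearchInvariant Q S A → ∀ u v : Fin n,
      e.eval (r + 2) (extend ν r [(u : ℕ), (v : ℕ)]) A = P u v) :
    Improves Q S ((tryStmt r e).eval r ν) {quarticRatio (signRound P)} := by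
  intro A hA
  rw [tryStmt, Stmt.eval_seq]
  set A₁ := (Stmt.asg 8 2 e).eval r ν A with hA₁
  have h8 : arrMat n (A₁ 8) = P := by
    rw [hA₁, arrMat_asg hν]
    ext u v
    exact he A hA u v
  have h1' : ∀ k ≠ 8, A₁ k = A k := fun k hk => Stmt.eval_asg_of_ne hk _ _ _ _ _
  obtain ⟨hlt, hle⟩ := eval_roundStmt hr hν A₁
  rw [h8, h1' 2 (by norm_num), h1' 1 (by norm_num)] at *
  set A₂ := (roundStmt r).eval r ν A₁ with hA₂
  have h0 : A₂ 0 = A 0 := by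
    rw [hA₂, Stmt.eval_of_notMem_writes (by simp [writes_roundStmt]), h1' 0 (by norm_num)]
  have h3 : A₂ 3 = A 3 := by
    rw [hA₂, Stmt.eval_of_notMem_writes (by simp [writes_roundStmt]), h1' 3 (by norm_num)]
  have hin : arrMat n (A₂ 0) = Q := by rw [h0, hA.input]
  have hacc : arrTuple n (A₂ 3) = S := by rw [h3, hA.acc]
  rcases lt_or_ge (A 2 []) (quarticRatio (signRound P)) with h | h
  · obtain ⟨h1, h2⟩ := hlt h
    exact ⟨⟨hin, hacc, by rw [h1, mulVec_signRound hP hQP], by rw [h2, h1]⟩, by rw [h2]; exact h.le,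
      fun c hc => by rw [h2, Set.mem_singleton_iff.1 hc]⟩
  · obtain ⟨h1, h2⟩ := hle h
    exact ⟨⟨hin, hacc, by rw [h1, hA.mem], by rw [h2, h1, hA.ratio]⟩, by rw [h2],
      fun c hc => by rw [h2, Set.mem_singleton_iff.1 hc]; exact h⟩

/-- The diagonal block of a moment matrix at four points. -/
def diagBlock (S : Matrix (Tuple n) (Tuple n) ℝ) (v₁ v₂ v₃ v₄ : Fin n) :
    Matrix (Fin n) (Fin n) ℝ :=
  of fun x y => S ![v₁, v₂, v₃, v₄, x] ![v₁, v₂, v₃, v₄, y]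

/-- The rank one matrix of a column. -/
def colMatrix (Q : Matrix (Fin n) (Fin n) ℝ) (u : Fin n) : Matrix (Fin n) (Fin n) ℝ :=
  of fun x y => Q x u * Q y u

theorem posSemidef_colMatrix (Q : Matrix (Fin n) (Fin n) ℝ) (u : Fin n) :
    (colMatrix Q u).PosSemidef := by
  have := posSemidef_vecMulVec_self_star fun x => Q x u
  rwa [star_trivial] at this

theorem IsProjector.mulVec_col (hQ : IsProjector n Q) (j : Fin n) :
    Q *ᵥ (fun u => Q u j) = fun u => Q u j := by
  ext u
  exact congrFun (congrFun hQ.2 u) j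

theorem improves_searchStmt (hQ : IsProjector n Q) (hS : S.PosSemidef) (hQS : lastProj Q * S = S)
    {ν : ℕ → ℕ} (hν : ν 0 = n) :
    Improves Q S (searchStmt.eval 2 ν) ({quarticRatio (signRound Q)} ∪
      ((⋃ u, {quarticRatio (signRound (colMatrix Q u))}) ∪
        ⋃ v₁, ⋃ v₂, ⋃ v₃, ⋃ v₄, {quarticRatio (signRound (diagBlock S v₁ v₂ v₃ v₄))})) := by
  have h1 : Improves Q S ((tryStmt 2 (.cell 0 [2, 3])).eval 2 ν) {quarticRatio (signRound Q)} := by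
    refine improves_tryStmt le_rfl hν hQ.posSemidef hQ.mulVec_col fun A hA u v => ?_
    rw [← hA.input]
    rfl
  have h2 : Improves Q S
      ((Stmt.loop (tryStmt 3 (.mul (.cell 0 [3, 2]) (.cell 0 [4, 2])))).eval 2 ν)
      (⋃ u, {quarticRatio (signRound (colMatrix Q u))}) := by
    refine Improves.loop hν fun u => ?_
    have h0 : Function.update ν 2 (u : ℕ) 0 = n := hν
    refine improves_tryStmt (r := 3) (by norm_num) h0 (posSemidef_colMatrix Q u) (fun j => ?_)
      fun A hA x y => ?_
    · have h : (fun x => colMatrix Q u x j) = Q j u • fun x => Q x u := by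
        ext x
        rw [colMatrix, of_apply, Pi.smul_apply, smul_eq_mul, mul_comm]
      rw [h, mulVec_smul, hQ.mulVec_col]
    · rw [← hA.input]
      rfl
  have h3 : Improves Q S
      ((Stmt.loop (.loop (.loop (.loop
        (tryStmt 6 (.cell 3 [2, 3, 4, 5, 6, 2, 3, 4, 5, 7])))))).eval 2 ν)
      (⋃ v₁, ⋃ v₂, ⋃ v₃, ⋃ v₄, {quarticRatio (signRound (diagBlock S v₁ v₂ v₃ v₄))}) := by
    refine Improves.loop hν fun v₁ => ?_
    have e1 : Function.update ν 2 (v₁ : ℕ) 0 = n := hν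
    refine Improves.loop (r := 3) e1 fun v₂ => ?_
    have e2 : Function.update (Function.update ν 2 (v₁ : ℕ)) 3 (v₂ : ℕ) 0 = n := e1
    refine Improves.loop (r := 4) e2 fun v₃ => ?_
    have e3 : Function.update (Function.update (Function.update ν 2 (v₁ : ℕ)) 3 (v₂ : ℕ)) 4
      (v₃ : ℕ) 0 = n := e2
    refine Improves.loop (r := 5) e3 fun v₄ => ?_
    have e4 : Function.update (Function.update (Function.update (Function.update ν 2 (v₁ : ℕ)) 3
      (v₂ : ℕ)) 4 (v₃ : ℕ)) 5 (v₄ : ℕ) 0 = n := e3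
    refine improves_tryStmt (r := 6) (P := diagBlock S v₁ v₂ v₃ v₄) (by norm_num) e4
      (hS.submatrix fun x => (![v₁, v₂, v₃, v₄, x] : Tuple n))
      (fun j => apply_lastProj_mul hQS _ _ _ _ _) fun A hA x y => ?_
    rw [← hA.acc]
    rfl
  exact h1.comp (h2.comp h3)

/-- The whole algorithm, once register `1` holds the size of the input plus two. -/
def mainStmt : Stmt := .seq accumulateStmt searchStmt

/-- The program. -/
def mainProg : Prog :=
  .seq (.natConst 1 2) (.seq (.natAdd 1 1 0) (mainStmt.compile 15 2))

theorem polyTimeOn_mainProg (inputs : ∀ n : ℕ, Matrix (Fin n) (Fin n) ℝ → Prop) :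
    PolyTimeOn mainProg inputs := by
  obtain ⟨q, hq⟩ := (Stmt.natFree_compile 15 mainStmt 2).exists_clock_le
  refine ⟨2 + q.comp (Polynomial.X + 2), fun n M _ w => ?_⟩
  have h := (hq (run (.natAdd 1 1 0) (run (.natConst 1 2) (init M w))) (n + 2) fun x => ?_).2
  · rw [Polynomial.eval_add, Polynomial.eval_comp, Polynomial.eval_add, Polynomial.eval_X,
      Polynomial.eval_ofNat]
    exact h
  · simp only [run, State.tick, State.setNat, init, Function.update_apply]
    rcases eq_or_ne x 1 with rfl | h1
    · simp [add_comm]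
    · by_cases h0 : x = 0 <;> simp [h0, h1]

set_option maxRecDepth 100000 in
theorem wf_mainStmt : mainStmt.WF 15 2 := by decide

theorem run_mainProg (M : Matrix (Fin n) (Fin n) ℝ) (w : ℕ → ℝ) :
    ∃ ν : ℕ → ℕ, ν 0 = n ∧ ν 1 = n + 2 ∧
      output mainProg M w = arrVec n (mainStmt.eval 2 ν (init M w).real 1) := by
  set s := run (.natAdd 1 1 0) (run (.natConst 1 2) (init M w)) with hs
  have h1 : s.nat 1 = n + 2 := by
    simp [hs, run, State.tick, State.setNat, init, add_comm]
  refine ⟨s.nat, rfl, h1, ?_⟩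
  have h := (Stmt.reaches_compile (t := 15) mainStmt (r := 2) wf_mainStmt le_rfl s (by omega)).real 1
    (by norm_num)
  ext u
  exact congrFun h [(u : ℕ)]

/-- The output is in the image, and its ratio is at least that of the best candidate. -/
theorem exists_output (hQ : IsProjector n Q) {f : Fin n → ℝ} (hf : IsNearlyIn (1 / 4) Q f)
    (w : ℕ → ℝ) {A : ℝ} (hA : A = 1 / 64 * level (expect f) Q) :
    Q *ᵥ output mainProg Q w = output mainProg Q w ∧
      A / 6 < quarticRatio (output mainProg Q w) := by
  obtain ⟨ν, h0, h1, hout⟩ := run_mainProg Q w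
  rw [hout]
  set A₀ := (init Q w).real with hA₀
  have hin : arrMat n (A₀ 0) = Q := by
    ext u v
    simp [hA₀, arrMat, init]
  rw [mainStmt, Stmt.eval_seq]
  set m : ℝ := (ν 1 : ℝ) with hm
  have hm' : m = n + 2 := by rw [hm, h1]; push_cast; ring
  set A₁ := accumulateStmt.eval 2 ν A₀ with hA₁
  set S := accumulator Q (m ^ 20) (m ^ 120) (ν 1 ^ 250 + 1) (ν 1 ^ 110) with hS
  have hacc : arrTuple n (A₁ 3) = S := eval_accumulateStmt hQ h0 hin (by ext a b; rfl)
  have hT : ((ν 1 ^ 110 : ℕ) : ℝ) = m ^ 110 := by push_cast; rfl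
  have hN : m ^ 250 ≤ ((ν 1 ^ 250 + 1 : ℕ) : ℝ) := by push_cast; linarith
  have hinv := driftInvariant_accumulator_pow hQ hf hm' hT hN
  have hinit : SearchInvariant Q S A₁ := by
    have e1 : A₁ 1 = A₀ 1 := Stmt.eval_of_notMem_writes (by decide) _ _ _
    have e2 : A₁ 2 = A₀ 2 := Stmt.eval_of_notMem_writes (by decide) _ _ _
    have e0 : A₁ 0 = A₀ 0 := Stmt.eval_of_notMem_writes (by decide) _ _ _
    have hz : arrVec n (A₁ 1) = 0 := by rw [e1]; rfl
    refine ⟨by rw [e0, hin], hacc, by rw [hz, mulVec_zero], ?_⟩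
    rw [hz, e2, quarticRatio]
    simp [hA₀, init]
  obtain ⟨hfin, -, hbest⟩ := improves_searchStmt hQ hinv.posSemidef hinv.mul_eq h0 A₁ hinit
  refine ⟨hfin.mem, ?_⟩
  rw [← hfin.ratio]
  have hA0 : 0 ≤ A := by
    rw [hA]
    have : 0 ≤ expect f := div_nonneg hf.sum_pos.le (Nat.cast_nonneg n)
    have := level_nonneg this Q
    positivity
  have hround : ∀ P : Matrix (Fin n) (Fin n) ℝ, P.PosSemidef →
      A * (∑ u, P u u) ^ 2 < ∑ u, P u u ^ 2 → A / 6 < quarticRatio (signRound P) := by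
    intro P hP hlt
    have h2 := lt_sum_signRound_pow_four hP hlt hA0
    have h3 : 0 < (∑ u, signRound P u ^ 2) ^ 2 := by
      refine (sq_nonneg _).lt_of_ne' fun h3 => ?_
      rw [pow_eq_zero_iff two_ne_zero, Finset.sum_eq_zero_iff_of_nonneg fun _ _ => sq_nonneg _]
        at h3
      have h4 : ∀ u, signRound P u = 0 := fun u =>
        pow_eq_zero_iff two_ne_zero |>.1 (h3 u (Finset.mem_univ u))
      simp [h4] at h2
    rwa [quarticRatio, lt_div_iff₀ h3]
  rcases exists_candidate hQ hf hm' hT hN hA with h | ⟨u, h⟩ | ⟨ω, h⟩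
  · exact (hround Q hQ.posSemidef h).trans_le (hbest _ (Or.inl rfl))
  · refine (hround (colMatrix Q u) (posSemidef_colMatrix Q u) ?_).trans_le
      (hbest _ (Or.inr (Or.inl (Set.mem_iUnion.2 ⟨u, rfl⟩))))
    have e1 : ∑ v, colMatrix Q u v v = Q u u := by
      rw [← hQ.sum_sq u]
      exact Finset.sum_congr rfl fun v _ => by rw [colMatrix, of_apply, hQ.symm v u, sq]
    have e2 : ∑ v, colMatrix Q u v v ^ 2 = ∑ v, Q u v ^ 4 :=
      Finset.sum_congr rfl fun v _ => by rw [colMatrix, of_apply, hQ.symm v u]; ring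
    rwa [e1, e2]
  · refine (hround (diagBlock S (ω 0) (ω 1) (ω 2) (ω 3))
      (hinv.posSemidef.submatrix fun x => (![ω 0, ω 1, ω 2, ω 3, x] : Tuple n)) h).trans_le
      (hbest _ (Or.inr (Or.inr ?_)))
    simp only [Set.mem_iUnion]
    exact ⟨ω 0, ω 1, ω 2, ω 3, rfl⟩

theorem level_anti {μ μ' : ℝ} (hμ : 0 < μ) (h : μ ≤ μ') (Q : Matrix (Fin n) (Fin n) ℝ) :
    level μ' Q ≤ level μ Q := by
  unfold level
  rcases (by positivity : (0 : ℝ) ≤ n * μ * (Q.rank : ℝ) ^ (1 / 3 : ℝ)).eq_or_lt with h0 | h0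
  · have h1 : (n : ℝ) * (Q.rank : ℝ) ^ (1 / 3 : ℝ) = 0 := by
      have : μ * (n * (Q.rank : ℝ) ^ (1 / 3 : ℝ)) = 0 := by linarith
      exact (mul_eq_zero.1 this).resolve_left hμ.ne'
    have h2 : n * μ' * (Q.rank : ℝ) ^ (1 / 3 : ℝ) = 0 := by linear_combination μ' * h1
    rw [← h0, h2]
  · exact one_div_le_one_div_of_le h0 (by gcongr)

theorem IsGood.mono {c c' μ : ℝ} {g : Fin n → ℝ} (hμ : 0 ≤ μ) (h : c' ≤ c)
    (hg : IsGood c μ Q g) : IsGood c' μ Q g := by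
  rw [isGood_iff] at hg ⊢
  refine ⟨hg.1, hg.2.1, le_trans ?_ hg.2.2⟩
  have := level_nonneg hμ Q
  gcongr

/-- The algorithm succeeds for all random choices. -/
theorem isGood_output (hQ : IsProjector n Q) {f : Fin n → ℝ} (hf : IsNearlyIn (1 / 4) Q f) {μ : ℝ}
    (hμ : expect f ≤ μ) (w : ℕ → ℝ) : IsGood (1 / 384) μ Q (output mainProg Q w) := by
  obtain ⟨h1, h2⟩ := exists_output hQ hf w rfl
  set g := output mainProg Q w with hg
  have hf0 : 0 < expect f := div_pos hf.sum_pos (by exact_mod_cast hf.pos)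
  have hl := level_nonneg hf0.le Q
  have hr : 0 < quarticRatio g := lt_of_le_of_lt (by positivity) h2
  have hs : 0 < (∑ u, g u ^ 2) ^ 2 := by
    refine (sq_nonneg _).lt_of_ne' fun h0 => hr.ne' ?_
    rw [quarticRatio, h0, div_zero]
  rw [isGood_iff]
  refine ⟨fun h0 => ?_, ⟨g, h1.symm⟩, ?_⟩
  · rw [h0] at hs
    simp at hs
  · rw [quarticRatio, lt_div_iff₀ hs] at h2
    have h3 := mul_le_mul_of_nonneg_right (level_anti hf0 hμ Q) hs.le
    linarith

end Search

theorem RoundingSucceeds.mono {n : ℕ} {p₀ c c' μ : ℝ} {Q : Matrix (Fin n) (Fin n) ℝ}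
    {L : MvPolynomial (Var n) ℝ →ₗ[ℝ] ℝ} (hμ : 0 ≤ μ) (hc : c' ≤ c)
    (h : RoundingSucceeds p₀ c μ Q L) : RoundingSucceeds p₀ c' μ Q L := by
  have : MeasureTheory.IsProbabilityMeasure (stdGaussianFun n) := by
    unfold stdGaussianFun; infer_instance
  have (w : MvPolynomial (Var n) ℝ) :
      MeasureTheory.IsProbabilityMeasure (matchingGaussian L w) := by
    unfold matchingGaussian; infer_instance
  rcases h with ⟨u, h⟩ | h | ⟨ω, hω, h⟩
  · exact Or.inl ⟨u, h.mono hμ hc⟩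
  · exact Or.inr (Or.inl (h.trans (MeasureTheory.measureReal_mono fun t ht => ht.mono hμ hc)))
  · exact Or.inr (Or.inr ⟨ω, hω, h.trans (MeasureTheory.measureReal_mono fun t ht =>
      ht.mono hμ hc)⟩)

end ASVP

theorem theorem4p1 :
    ∃ ε a b c p₀ : ℝ, 0 < ε ∧ 0 < a ∧ 0 < b ∧ 0 < c ∧ 0 < p₀ ∧ ∃ l : ℕ,
      -- the relaxation has every nearly contained Boolean function as a solution
      (∀ (n : ℕ) (Q : Matrix (Fin n) (Fin n) ℝ) (f : Fin n → ℝ),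
        ASVP.IsProjector n Q → ASVP.IsNearlyIn ε Q f →
        ∃ x : ASVP.Var n → ℝ, (∀ u, x (.val u) = f u) ∧
          ASVP.IsFeasible l ε a b (ASVP.expect f) Q (MvPolynomial.aeval x).toLinearMap) ∧
      -- every solution of the relaxation is rounded successfully
      (∀ (n : ℕ) (Q : Matrix (Fin n) (Fin n) ℝ) (μ : ℝ)
        (L : MvPolynomial (ASVP.Var n) ℝ →ₗ[ℝ] ℝ),
        ASVP.IsProjector n Q → 0 < μ → ASVP.IsFeasible l ε a b μ Q L →
        ASVP.RoundingSucceeds p₀ c μ Q L) ∧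
      -- the problem is solved in polynomial time
      (∃ A : RealRAM.Prog, RealRAM.PolyTimeOn A ASVP.IsProjector ∧
        ∀ (n : ℕ) (Q : Matrix (Fin n) (Fin n) ℝ) (μ : ℝ) (f : Fin n → ℝ),
          ASVP.IsProjector n Q → ASVP.IsNearlyIn ε Q f → ASVP.expect f ≤ μ →
          2 / 3 ≤ RealRAM.tapeLaw.real
            {w | ASVP.IsGood c μ Q (RealRAM.output A Q w)}) := by
  have hK := ASVP.one_le_gaussConst
  refine ⟨1 / 4, 1 / 256, 1 / 4, min (1 / 64 / (256 * ASVP.gaussConst ^ 2)) (1 / 384),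
    1 / (8 * ASVP.gaussConst), by norm_num, by norm_num, by norm_num,
    lt_min (by positivity) (by norm_num), by positivity, 40, ?_, ?_, ?_⟩
  · exact fun n Q f hQ hf =>
      ⟨ASVP.planted Q f, fun _ => rfl, ASVP.isFeasible_planted (by norm_num) hQ hf⟩
  · exact fun n Q μ L hQ hμ hL => (hL.roundingSucceeds hQ hμ).mono hμ.le (min_le_left _ _)
  · refine ⟨ASVP.mainProg, ASVP.polyTimeOn_mainProg _, fun n Q μ f hQ hf hμ => ?_⟩
    have h0 : 0 ≤ μ :=
      (div_nonneg hf.sum_pos.le (Nat.cast_nonneg n) : 0 ≤ ASVP.expect f).trans hμ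
    have : MeasureTheory.IsProbabilityMeasure RealRAM.tapeLaw := by
      unfold RealRAM.tapeLaw; infer_instance
    have h1 : {w | ASVP.IsGood (min (1 / 64 / (256 * ASVP.gaussConst ^ 2)) (1 / 384)) μ Q
        (RealRAM.output ASVP.mainProg Q w)} = Set.univ :=
      Set.eq_univ_of_forall fun w => (ASVP.isGood_output hQ hf hμ w).mono h0 (min_le_right _ _)
    rw [h1, MeasureTheory.probReal_univ]
    norm_num
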